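/- **Setting.** Let $U\subset\mathbb C$ be open, let $M=\mathbb C^3\times U$ with coordinates $(t_1,t_2,t_3,t_4)$, $t_4\in U$, and let $\eta_{ij}=\delta_{i+j,5}$. For $0<\sigma\le\frac12$, a *polynomial Frobenius manifold of degrees $(1,1-\sigma,\sigma)$* on $M$ is a prepotential $$F=\tfrac12t_1^2t_4+t_1t_2t_3+\sum_{(a,b)\in S}t_2^a\,t_3^b\,g_{(a,b)}(t_4),\qquad S\subset\mathbb Z_{\ge0}^2\text{ finite},\ g_{(a,b)}\text{ holomorphic on }U,$$ (so $\partial_1\partial_i\partial_jF=\eta_{ij}$) which satisfies the WDVV equations and $E(F)=2F$ for $E=t_1\partial_1+(1-\sigma)t_2\partial_2+\sigma t_3\partial_3$. The tangent algebra at $t$ has structure constants $\eta^{\alpha\varepsilon}\partial_\varepsilon\partial_\beta\partial_\gamma F(t)$; it is semi-simple if it has a basis of orthogonal idempotents, and $F$ is semi-simple if this holds on a dense subset of $M$. The inversion of $F$ is $$\hat F(t)=t_4^2\,F\Big(\tfrac{t_\sigma t^\sigma}{2t_4},-\tfrac{t_2}{t_4},-\tfrac{t_3}{t_4},-\tfrac1{t_4}\Big)+\tfrac12t_1\,t_\sigma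 t^\sigma,\qquad t_\sigma t^\sigma=2t_1t_4+2t_2t_3 ,$$ and $F$ is modular if $U$ does not contain $0$, is stable under $\tau\mapsto-1/\tau$, and $\hat F=F$. The classification below does not need this last condition; it therefore applies in particular to modular Frobenius manifolds. A prime is $d/dt_4$, a dot is $d/dt$ with $t=\frac12t_4$. $S[n,m,p,t]$ denotes any Schwarzian triangle function: a holomorphic $y(t)\in\mathbb C\setminus\{0,1\}$ which is locally an inverse of a ratio of two linearly independent solutions of the hypergeometric equation with parameters $a=\frac{1-n-m+p}2$, $b=\frac{1-n-m-p}2$, $c=1-n$ (angles $n\pi,m\pi,p\pi$ at $y=0,1,\infty$). **1. Monomials.** For $0<\sigma\le\frac12$, the function $F$ displayed above satisfies $E(F)=2F$ if and only if $(1-\sigma)a+\sigma b=2$ for all $(a,b)\in S$ with $g_{(a,b)}\not\equiv0$. The solutions $(a,b)\ne(2,2)$ of this equation in $\mathbb Z_{\ge0}^2$ are: $(4,0),(3,1),(1,3),(0,4)$ for $\sigma=\frac12$; $(3,0),(1,4),(0,6)$ for $\sigma=\frac13$; $(1,n+1),(0,2n)$ for $\sigma=\frac1n$, $n\ge4$;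 $(0,2n+1)$ for $\sigma=\frac2{2n+1}$, $n\ge2$; none for every other $\sigma\in(0,\frac12]$. **2.** If $\sigma\in(0,\frac12]$ and $\sigma\ne\frac12,\frac13$, then for every polynomial Frobenius manifold of degrees $(1,1-\sigma,\sigma)$ the tangent algebra at every point has a non-zero nilpotent element, and so is not semi-simple. **3. $\sigma=\frac12$.** Let $U$ be connected and non-empty. Then $F$ is a semi-simple polynomial Frobenius manifold of degrees $(1,\frac12,\frac12)$ if and only if there are functions $\gamma,g_1,\dots,g_4$ holomorphic on $U$ with $$F=\tfrac12t_1^2t_4+t_1t_2t_3-\tfrac14(t_2t_3)^2\gamma(t_4)+t_3^4g_1(t_4)+t_2t_3^3g_2(t_4)+t_2^3t_3g_3(t_4)+t_2^4g_4(t_4)$$ such that one of the following holds. * *Case I:* $g_2=g_3=0$ and $g_4=\mu g_1$ for a constant $\mu\neq0$, $$\gamma'=\tfrac12\gamma^2-288\mu g_1^2,\qquad g_1''=3\gamma g_1'-3g_1\gamma',\tag{I}$$ and $(g_1'-\gamma g_1)^2\ne576\mu g_1^4$ at some point of $U$. * *Case II:* for a constant $K\ne0$, $g_2=\frac4Kg_4$,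 $g_3=Kg_1$, and with $L=4/K^2$ $$\gamma'=\tfrac12\gamma^2-288g_1g_4,\quad g_1'=\gamma g_1+24L\,g_4^2,\quad g_4'=\gamma g_4+24L^{-1}g_1^2,\tag{II}$$ and $L^{-1}g_1^3\neq Lg_4^3$ at some point of $U$. **4. Case I.** Let $\mu\ne0$ and let $\gamma,g_1$ be holomorphic on $U$; in (a) and (c) $U$ need not be connected. (a) If $g_1$ has no zeros, (I) is equivalent to $\dot\gamma-\gamma^2=-576\mu g_1^2$ together with $$\dddot\gamma=\frac12\frac{(\ddot\gamma-2\gamma\dot\gamma)^2}{\dot\gamma-\gamma^2}+8\gamma\ddot\gamma-10\dot\gamma^2 ,$$ which is the equation $\dddot u=\alpha\frac{(\ddot u-2u\dot u)^2}{\dot u-u^2}+\beta u\ddot u+\kappa\dot u^2+\delta(\dot u-u^2)^2$ of Bureau's class ($16\alpha-\kappa=18$, $2\beta+\kappa=6$) with $(\alpha,\beta,\kappa,\delta)=(\frac12,8,-10,0)$. (b) Let $U$ be connected and non-empty. If (I) holds with $(g_1'-\gamma g_1)^2\not\equiv576\mu g_1^4$, there is a function $y(t)$, holomorphic for $2t\in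 U$, such that the set where $y\ne0,1$ is dense and on it $y=S[\frac12,\frac14,0,t]$ and $$\gamma=\frac12\Big\{\frac{\ddot y}{\dot y}-\Big(\frac{1/2}y+\frac{3/4}{y-1}\Big)\dot y\Big\},\qquad g_1=\frac{1}{192\,\mu^{1/2}}\frac{\dot y}{y^{1/2}(y-1)^{1/2}}$$ for some holomorphic branch of $\mu^{1/2}y^{1/2}(y-1)^{1/2}$. Conversely, if these formulae hold for all $t$ with $2t\in U$, with some $y=S[\frac12,\frac14,0,t]$, then (I) holds and $(g_1'-\gamma g_1)^2\not\equiv576\mu g_1^4$. (c) Fix a square root $\mu^{1/2}$. Then (I) holds on $U$ if and only if near every $t$ with $2t\in U$ there is a solution of the Halphen system $\dot\omega_1=-\omega_2\omega_3+\omega_1(\omega_2+\omega_3)$ and its two cyclic permutations with $$\gamma=\tfrac14(\omega_1+2\omega_2+\omega_3),\qquad g_1=\tfrac1{96\mu^{1/2}}(\omega_1-2\omega_2+\omega_3)$$ for which, at each point, $(g_1'-\gamma g_1)^2\ne576\mu g_1^4$ if and only if $\omega_1,\omega_2,\omega_3$ are distinct. **5. Case II.** Let $U$ be connected and non-empty,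 $L\neq0$, and let $\gamma,g_1,g_4$ be holomorphic on $U$. If (II) holds, then $\gamma$ satisfies the Chazy equation $\gamma'''-6\gamma\gamma''+9(\gamma')^2=0$. If $L^{-1}g_1^3\not\equiv Lg_4^3$, then (II) is equivalent to the Chazy equation for $\gamma$ together with the two algebraic relations $$288\,g_1g_4=-(\gamma'-\tfrac12\gamma^2)=:288P,\qquad 6912\,(L^{-1}g_1^3+Lg_4^3)=-(\gamma''-3\gamma\gamma'+\gamma^3)=:6912R.$$ Conversely, if a holomorphic $\gamma$ satisfies the Chazy equation on $U$ and $R^2\not\equiv4P^3$, where $P,R$ are defined from $\gamma$ by these equations, then near every point of $U$ there are $g_1,g_4$ such that (II) holds and $L^{-1}g_1^3\neq Lg_4^3$ everywhere. **6. $\sigma=\frac13$.** Let $U$ be connected and non-empty. Then $F$ is a semi-simple polynomial Frobenius manifold of degrees $(1,\frac23,\frac13)$ if and only if there are functions $\gamma,g_1,g_3,g_4$ holomorphic on $U$ and a constant $K\ne0$ with $$F=\tfrac12t_1^2t_4+t_1t_2t_3-\tfrac14(t_2t_3)^2\gamma(t_4)+t_3^6g_4(t_4)+t_2t_3^4g_3(t_4)+t_2^3g_1(t_4),$$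 $$\gamma'=\tfrac12\gamma^2-72Kg_1^4,\qquad g_1''=2\gamma g_1'-g_1\gamma',\tag{III}$$ $$g_3=Kg_1^3,\qquad g_4=\tfrac{Kg_1}{30}\big[g_1'-\tfrac12g_1\gamma\big],\tag{III$'$}$$ and $(g_1'-\frac12\gamma g_1)^2\ne36Kg_1^6$ at some point of $U$. **7. Solution for $\sigma=\frac13$.** Let $K\ne0$ and let $\gamma,g_1$ be holomorphic on $U$; in (a) and (c) $U$ need not be connected. (a) If $g_1$ has no zeros, (III) is equivalent to $\dot\gamma-\gamma^2=-144Kg_1^4$ together with $$\dddot\gamma=\frac34\frac{(\ddot\gamma-2\gamma\dot\gamma)^2}{\dot\gamma-\gamma^2}+6\gamma\ddot\gamma-6\dot\gamma^2,$$ which is in Bureau's class with $(\alpha,\beta,\kappa,\delta)=(\frac34,6,-6,0)$. (b) Let $U$ be connected and non-empty. If (III) holds with $(g_1'-\frac12\gamma g_1)^2\not\equiv36Kg_1^6$, there is a function $y(t)$, holomorphic for $2t\in U$, such that the set where $y\neq0,1$ is dense and on it $y=S[\frac12,\frac16,0,t]$ and $$\gamma=\frac12\Big\{\frac{\ddot y}{\dot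 y}-\Big(\frac{1/2}y+\frac{5/6}{y-1}\Big)\dot y\Big\},\qquad g_1^4=\frac1{5184K}\,\frac{\dot y^2}{y(y-1)} .$$ Conversely, if these formulae hold for all $t$ with $2t\in U$, with some $y=S[\frac12,\frac16,0,t]$, then (III) holds and $(g_1'-\frac12\gamma g_1)^2\not\equiv36Kg_1^6$. (c) If the formulae of (b) hold for all $t$ with $2t\in U$, with some $y=S[\frac12,\frac16,0,t]$, and $g_3,g_4$ are given by (III$'$), then $$g_3^4=\frac{K}{5184^3}\frac{\dot y^6}{y^3(y-1)^3},\qquad g_4^2=\frac{K}{25920^2}\frac{\dot y^4}{y(y-1)^3},\qquad g_4=\frac K{360}\frac{g_1^2\,\dot y}{y-1}.$$ So each $g_i$ ($i=1,3,4$) has the form $c_i\,\dot y^{\,i/2}\,y^{-a_i}(y-1)^{-b_i}$ with $(a_i,b_i)=(\frac14,\frac14),(\frac34,\frac34),(\frac12,\frac32)$. **8. Inversion.** For arbitrary functions, and $t_4\ne0$, the inversion of the prepotential displayed in 3 (in 6) is a prepotential of the same form, with $\gamma(\tau)$ replaced by $\tau^{-2}\gamma(-1/\tau)-2/\tau$ and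 each coefficient $g(\tau)$ of a monomial of degree $k+2$ in $t_2,t_3$ by $(-1)^k\tau^{-k}g(-1/\tau)$. Hence, if $0\notin U$ and $U$ is stable under $\tau\mapsto-1/\tau$, these prepotentials are modular if and only if on $U$ each of these functions equals its replacement. -/

import Mathlib

/-! # Four-dimensional polynomial Frobenius manifolds with `d = 1`

Flat coordinates are `t : Fin 4 → ℂ`; the index `0, 1, 2, 3` of the code is the index
`1, 2, 3, 4` of the usual notation `t¹, t², t³, t⁴`. -/

namespace ModularFrobenius

/-! ## Frobenius manifolds in flat coordinates -/

/-- The domain `ℂ³ × U` of a prepotential which is polynomial in `t¹, t², t³` and whose coefficients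
are functions of `t⁴ ∈ U`. -/
def domain (U : Set ℂ) : Set (Fin 4 → ℂ) := {t | t 3 ∈ U}

/-- The coordinate derivative `∂F/∂tⁱ`. -/
noncomputable def pd (i : Fin 4) (F : (Fin 4 → ℂ) → ℂ) : (Fin 4 → ℂ) → ℂ :=
  fun t => deriv (fun s => F (Function.update t i s)) (t i)

/-- The third derivatives `c_{ijk} = ∂ᵢ∂ⱼ∂ₖF`. -/
noncomputable def c (F : (Fin 4 → ℂ) → ℂ) (i j k : Fin 4) : (Fin 4 → ℂ) → ℂ :=
  pd i (pd j (pd k F))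

/-- The flat metric, `η_{ij} = δ_{i+j,5}` (for indices running from `1` to `4`). -/
def eta : Matrix (Fin 4) (Fin 4) ℂ := Matrix.of fun i j => if j = i.rev then 1 else 0

/-- The multiplication `X ∘ Y` on the tangent space at `t`, with structure constants
`c^α_{βγ} = η^{αε} c_{εβγ}`. -/
noncomputable def mul (F : (Fin 4 → ℂ) → ℂ) (t X Y : Fin 4 → ℂ) : Fin 4 → ℂ :=
  fun α => ∑ β, ∑ γ, (∑ ε, eta⁻¹ α ε * c F ε β γ t) * X β * Y γ

/-- The WDVV equations at the point `t`. -/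
def WDVV (F : (Fin 4 → ℂ) → ℂ) (t : Fin 4 → ℂ) : Prop :=
  ∀ α β γ δ : Fin 4,
    ∑ l, ∑ m, c F α β l t * eta⁻¹ l m * c F m δ γ t =
      ∑ l, ∑ m, c F δ β l t * eta⁻¹ l m * c F m α γ t

/-- The degrees `(1, 1 - σ, σ, 0)` of the flat coordinates. -/
noncomputable def deg (σ : ℝ) : Fin 4 → ℂ := ![1, 1 - (σ : ℂ), (σ : ℂ), 0]

/-- Quasi-homogeneity `E(F) = 2F` at `t` for
`E = t¹∂₁ + (1 - σ) t²∂₂ + σ t³∂₃`. -/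
def Quasihomogeneous (σ : ℝ) (F : (Fin 4 → ℂ) → ℂ) (t : Fin 4 → ℂ) : Prop :=
  ∑ i, deg σ i * t i * pd i F t = 2 * F t

/-- The prepotential `½ (t¹)² t⁴ + t¹ t² t³ + ∑_{(a,b) ∈ S} (t²)ᵃ (t³)ᵇ g_{(a,b)}(t⁴)`. -/
noncomputable def polyPrepotential (S : Finset (ℕ × ℕ)) (g : ℕ × ℕ → ℂ → ℂ) (t : Fin 4 → ℂ) : ℂ :=
  1 / 2 * t 0 ^ 2 * t 3 + t 0 * t 1 * t 2 + ∑ p ∈ S, t 1 ^ p.1 * t 2 ^ p.2 * g p (t 3)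

/-- `F` is, on `ℂ³ × U`, the prepotential of a Frobenius manifold with flat metric `η`, unity `∂₁`
and Euler field of degrees `(1, 1 - σ, σ, 0)`, which is polynomial in `t¹, t², t³` with coefficients
holomorphic in `t⁴`. -/
structure IsPolynomialFrobenius (σ : ℝ) (U : Set ℂ) (F : (Fin 4 → ℂ) → ℂ) : Prop where
  polynomial : ∃ (S : Finset (ℕ × ℕ)) (g : ℕ × ℕ → ℂ → ℂ),
    (∀ p ∈ S, DifferentiableOn ℂ (g p) U) ∧ ∀ t ∈ domain U, F t = polyPrepotential S g t
  metric : ∀ t ∈ domain U, ∀ i j, c F 0 i j t = eta i j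
  wdvv : ∀ t ∈ domain U, WDVV F t
  euler : ∀ t ∈ domain U, Quasihomogeneous σ F t

/-- The tangent algebra at `t` is semi-simple: it has a basis of orthogonal idempotents. -/
def SemisimpleAt (F : (Fin 4 → ℂ) → ℂ) (t : Fin 4 → ℂ) : Prop :=
  ∃ b : Module.Basis (Fin 4) ℂ (Fin 4 → ℂ), ∀ i j, mul F t (b i) (b j) = if i = j then b i else 0

/-- The tangent algebra at `t` has a non-zero nilpotent element. -/
def NilpotentAt (F : (Fin 4 → ℂ) → ℂ) (t : Fin 4 → ℂ) : Prop :=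
  ∃ v : Fin 4 → ℂ, v ≠ 0 ∧ mul F t v v = 0

/-- A Frobenius manifold is semi-simple if its tangent algebra is so at a generic point. -/
def IsSemisimple (U : Set ℂ) (F : (Fin 4 → ℂ) → ℂ) : Prop :=
  domain U ⊆ closure {t | t ∈ domain U ∧ SemisimpleAt F t}

/-! ## Inversion and modular invariance -/

/-- The square length `t_σ t^σ`. -/
noncomputable def sqLength (t : Fin 4 → ℂ) : ℂ := ∑ i, ∑ j, eta i j * t i * t j

/-- The prepotential obtained from `F` by the inversion symmetry. -/
noncomputable def inversion (F : (Fin 4 → ℂ) → ℂ) (t : Fin 4 → ℂ) : ℂ :=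
  t 3 ^ 2 * F ![1 / 2 * (sqLength t / t 3), -(t 1 / t 3), -(t 2 / t 3), -(1 / t 3)]
    + 1 / 2 * t 0 * sqLength t

/-- Modular invariance `F̂ = F` on `ℂ³ × U`. (Inversion preserves the Euler fields considered here.) -/
def IsModular (U : Set ℂ) (F : (Fin 4 → ℂ) → ℂ) : Prop :=
  (∀ τ ∈ U, τ ≠ 0 ∧ -(1 / τ) ∈ U) ∧ ∀ t ∈ domain U, inversion F t = F t

/-- The action of the inversion on functions of weight `2` with an inhomogeneous term. -/
noncomputable def hatPivot (γ : ℂ → ℂ) : ℂ → ℂ := fun τ => γ (-(1 / τ)) / τ ^ 2 - 2 / τ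

/-- The action of the inversion on the coefficient of a monomial of degree `k + 2`. -/
noncomputable def hatWeight (k : ℕ) (g : ℂ → ℂ) : ℂ → ℂ :=
  fun τ => (-1) ^ k * g (-(1 / τ)) / τ ^ k

/-! ## Monomials -/

/-- The solutions `(α₂, α₃)`, other than the pivot-point `(2, 2)`, of
`(1 - σ) α₂ + σ α₃ = 2`. -/
def nonPivotSolutions (σ : ℝ) : Set (ℕ × ℕ) :=
  {p | p ≠ (2, 2) ∧ (1 - σ) * (p.1 : ℝ) + σ * (p.2 : ℝ) = 2}

/-- The prepotential for `σ = 1/2`. -/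
noncomputable def prepotentialHalf (γ g₁ g₂ g₃ g₄ : ℂ → ℂ) (t : Fin 4 → ℂ) : ℂ :=
  1 / 2 * t 0 ^ 2 * t 3 + t 0 * t 1 * t 2 - 1 / 4 * (t 1 * t 2) ^ 2 * γ (t 3)
    + (t 2 ^ 4 * g₁ (t 3) + t 1 * t 2 ^ 3 * g₂ (t 3) + t 1 ^ 3 * t 2 * g₃ (t 3) + t 1 ^ 4 * g₄ (t 3))

/-- The prepotential for `σ = 1/3`. -/
noncomputable def prepotentialThird (γ g₁ g₃ g₄ : ℂ → ℂ) (t : Fin 4 → ℂ) : ℂ :=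
  1 / 2 * t 0 ^ 2 * t 3 + t 0 * t 1 * t 2 - 1 / 4 * (t 1 * t 2) ^ 2 * γ (t 3)
    + (t 2 ^ 6 * g₄ (t 3) + t 1 * t 2 ^ 4 * g₃ (t 3) + t 1 ^ 3 * g₁ (t 3))

/-! ## The systems of differential equations -/

/-- `γ' = ½γ² - 288 μ g₁²`, `g₁'' = 3γ g₁' - 3 g₁ γ'`. -/
def CaseI (U : Set ℂ) (μ : ℂ) (γ g₁ : ℂ → ℂ) : Prop :=
  ∀ τ ∈ U, deriv γ τ = 1 / 2 * γ τ ^ 2 - 288 * μ * g₁ τ ^ 2 ∧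
    deriv (deriv g₁) τ = 3 * γ τ * deriv g₁ τ - 3 * g₁ τ * deriv γ τ

/-- `γ' = ½γ² - 288 g₁g₄`, `g₁' = γ g₁ + 24 L g₄²`, `g₄' = γ g₄ + 24 L⁻¹ g₁²`. -/
def CaseII (U : Set ℂ) (L : ℂ) (γ g₁ g₄ : ℂ → ℂ) : Prop :=
  ∀ τ ∈ U, deriv γ τ = 1 / 2 * γ τ ^ 2 - 288 * g₁ τ * g₄ τ ∧
    deriv g₁ τ = γ τ * g₁ τ + 24 * L * g₄ τ ^ 2 ∧
    deriv g₄ τ = γ τ * g₄ τ + 24 * L⁻¹ * g₁ τ ^ 2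

/-- `γ' = ½γ² - 72 K g₁⁴`, `g₁'' = 2γ g₁' - g₁ γ'`. -/
def CaseIII (U : Set ℂ) (K : ℂ) (γ g₁ : ℂ → ℂ) : Prop :=
  ∀ τ ∈ U, deriv γ τ = 1 / 2 * γ τ ^ 2 - 72 * K * g₁ τ ^ 4 ∧
    deriv (deriv g₁) τ = 2 * γ τ * deriv g₁ τ - g₁ τ * deriv γ τ

/-- Non-degeneracy of a solution of `CaseI` at the point `τ`. -/
def NondegenerateI (μ : ℂ) (γ g₁ : ℂ → ℂ) (τ : ℂ) : Prop :=
  (deriv g₁ τ - γ τ * g₁ τ) ^ 2 ≠ 576 * μ * g₁ τ ^ 4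

/-- Non-degeneracy of a solution of `CaseII` at the point `τ`. -/
def NondegenerateII (L : ℂ) (g₁ g₄ : ℂ → ℂ) (τ : ℂ) : Prop :=
  L⁻¹ * g₁ τ ^ 3 ≠ L * g₄ τ ^ 3

/-- Non-degeneracy of a solution of `CaseIII` at the point `τ`. -/
def NondegenerateIII (K : ℂ) (γ g₁ : ℂ → ℂ) (τ : ℂ) : Prop :=
  (deriv g₁ τ - 1 / 2 * γ τ * g₁ τ) ^ 2 ≠ 36 * K * g₁ τ ^ 6

/-- The domain of the rescaled independent variable `t = ½ t⁴`. -/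
def halfDomain (U : Set ℂ) : Set ℂ := {t | 2 * t ∈ U}

/-- The function `g` in terms of the rescaled independent variable `t = ½ t⁴`. -/
def rescale (g : ℂ → ℂ) : ℂ → ℂ := fun t => g (2 * t)

/-- `u` solves, on `T`, the equation
`u''' = α (u'' - 2uu')² / (u' - u²) + β u u'' + κ u'² + δ (u' - u²)²` of Bureau's class. -/
def SolvesBureau (α β κ δ : ℂ) (T : Set ℂ) (u : ℂ → ℂ) : Prop :=
  (16 * α - κ = 18 ∧ 2 * β + κ = 6) ∧
  ∀ t ∈ T, deriv u t - u t ^ 2 ≠ 0 ∧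
    deriv (deriv (deriv u)) t =
      α * ((deriv (deriv u) t - 2 * u t * deriv u t) ^ 2 / (deriv u t - u t ^ 2))
        + β * u t * deriv (deriv u) t + κ * deriv u t ^ 2 + δ * (deriv u t - u t ^ 2) ^ 2

/-- The Chazy equation `γ''' - 6γγ'' + 9γ'² = 0` on `U`. -/
def SolvesChazy (U : Set ℂ) (γ : ℂ → ℂ) : Prop :=
  ∀ τ ∈ U, deriv (deriv (deriv γ)) τ - 6 * γ τ * deriv (deriv γ) τ + 9 * deriv γ τ ^ 2 = 0

/-- The Halphen system on `T`. -/
def SolvesHalphen (T : Set ℂ) (ω₁ ω₂ ω₃ : ℂ → ℂ) : Prop :=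
  (DifferentiableOn ℂ ω₁ T ∧ DifferentiableOn ℂ ω₂ T ∧ DifferentiableOn ℂ ω₃ T) ∧
  ∀ t ∈ T, deriv ω₁ t = -(ω₂ t * ω₃ t) + ω₁ t * (ω₂ t + ω₃ t) ∧
    deriv ω₂ t = -(ω₃ t * ω₁ t) + ω₂ t * (ω₃ t + ω₁ t) ∧
    deriv ω₃ t = -(ω₁ t * ω₂ t) + ω₃ t * (ω₁ t + ω₂ t)

/-! ## Schwarzian triangle functions -/

/-- `w` is, on `V`, a holomorphic solution of the hypergeometric equation with parameters
`a, b, c`. -/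
def IsHypergeometric (a b c : ℂ) (V : Set ℂ) (w : ℂ → ℂ) : Prop :=
  DifferentiableOn ℂ w V ∧ ∀ z ∈ V,
    z * (1 - z) * deriv (deriv w) z + (c - (a + b + 1) * z) * deriv w z - a * b * w z = 0

/-- `y` is, on `T`, a Schwarzian triangle function `S[n, m, p, t]` with angles `nπ, mπ, pπ` at
`y = 0, 1, ∞`: it is holomorphic with values in `ℂ ∖ {0, 1}`, and locally it is an inverse of the
ratio `w₁ / w₂` of two linearly independent solutions of the hypergeometric equation with
parameters `a = (1-n-m+p)/2`, `b = (1-n-m-p)/2`, `c = 1-n`, so that `n² = (1-c)²`, `m² = (a+b-c)²`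
and `p² = (a-b)²`. -/
def IsTriangleFunction (n m p : ℂ) (T : Set ℂ) (y : ℂ → ℂ) : Prop :=
  DifferentiableOn ℂ y T ∧ ∀ t₀ ∈ T, y t₀ ≠ 0 ∧ y t₀ ≠ 1 ∧
    ∃ (V N : Set ℂ) (w₁ w₂ : ℂ → ℂ), IsOpen V ∧ IsOpen N ∧ y t₀ ∈ V ∧ t₀ ∈ N ∧
      IsHypergeometric ((1 - n - m + p) / 2) ((1 - n - m - p) / 2) (1 - n) V w₁ ∧
      IsHypergeometric ((1 - n - m + p) / 2) ((1 - n - m - p) / 2) (1 - n) V w₂ ∧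
      (∀ z ∈ V, w₁ z * deriv w₂ z - deriv w₁ z * w₂ z ≠ 0 ∧ w₂ z ≠ 0) ∧
      ∀ t ∈ N, y t ∈ V ∧ w₁ (y t) / w₂ (y t) = t

/-- `u = ½ { y''/y' - ( (1-n)/y + (1-m)/(y-1) ) y' }` at `t`. -/
def BureauFormula (n m : ℂ) (u y : ℂ → ℂ) (t : ℂ) : Prop :=
  u t = 1 / 2 * (deriv (deriv y) t / deriv y t
    - ((1 - n) / y t + (1 - m) / (y t - 1)) * deriv y t)

/-- On `T`, `y = S[1/2, 1/4, 0, t]` and `γ, g₁` are the functions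
`γ = ½ { y''/y' - ( (1/2)/y + (3/4)/(y-1) ) y' }`, `g₁ = y' / (192 s)`, where `s` is a branch of
`μ^{1/2} y^{1/2} (y-1)^{1/2}`. -/
def TriangleSolutionI (μ : ℂ) (T : Set ℂ) (γ g₁ y : ℂ → ℂ) : Prop :=
  IsTriangleFunction (1 / 2) (1 / 4) 0 T y ∧ (∀ t ∈ T, BureauFormula (1 / 2) (1 / 4) γ y t) ∧
  ∃ s : ℂ → ℂ, DifferentiableOn ℂ s T ∧
    ∀ t ∈ T, s t ^ 2 = μ * (y t * (y t - 1)) ∧ g₁ t = 1 / 192 * (deriv y t / s t)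

/-- On `T`, `y = S[1/2, 1/6, 0, t]`, `γ` is the function
`½ { y''/y' - ( (1/2)/y + (5/6)/(y-1) ) y' }`, and `g₁` is a branch of
`c₁ (y')^{1/2} / (y^{1/4} (y-1)^{1/4})` with `c₁⁴ = 1 / (5184 K)`. -/
def TriangleSolutionIII (K : ℂ) (T : Set ℂ) (γ g₁ y : ℂ → ℂ) : Prop :=
  IsTriangleFunction (1 / 2) (1 / 6) 0 T y ∧ (∀ t ∈ T, BureauFormula (1 / 2) (1 / 6) γ y t) ∧
  ∀ t ∈ T, g₁ t ^ 4 = 1 / (5184 * K) * (deriv y t ^ 2 / (y t * (y t - 1)))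

/-- `g₃ = K g₁³` and `g₄ = (K g₁ / 30) (g₁' - ½ g₁ γ)`. -/
def DependentIII (U : Set ℂ) (K : ℂ) (γ g₁ g₃ g₄ : ℂ → ℂ) : Prop :=
  ∀ τ ∈ U, g₃ τ = K * g₁ τ ^ 3 ∧ g₄ τ = K * g₁ τ / 30 * (deriv g₁ τ - 1 / 2 * g₁ τ * γ τ)

end ModularFrobenius

namespace ModularFrobenius

open Set Filter Topology

/-! ## Holomorphic functions on open sets -/

section Holomorphic

variable {U : Set ℂ} {f g : ℂ → ℂ}

/-! For fixed t₄ the monomials in t₂, t₃ are linearly independent, so quasi-homogeneity is a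
condition on each monomial separately. It leaves the pivot (t₂t₃)² and the solutions of a small
Diophantine equation. Since ∂₁ is the unity, WDVV reduces to six relations (`Associative`) between
the third derivatives of the non-trivial part. Read as polynomial identities in t₂, t₃, these are
differential equations for the coefficients.

Semi-simplicity is controlled from both sides. A non-zero v with v∘v = 0 excludes it at the point in
question. Conversely, if the trace form is non-degenerate, the algebra is reduced, hence a product
of copies of ℂ; the determinant of the form is holomorphic, so over a connected U one non-zero value
gives a dense set of semi-simple points (`isSemisimple_of_det_gram_ne_zero`).

Nilpotents arise in two ways. If no monomial other than the pivot contains t₂² (or none contains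
t₃²), WDVV forces γ' = ½γ², and then ∂₂ (or ∂₃) plus a multiple of ∂₁ squares to zero; this settles
all σ other than 1/2 and 1/3. If all coefficients are constant, ∂₄∘∂₄ = 0; such prepotentials and
the translates of their inversions form the second degenerate family (`nilpotentAt_half_of_weight`,
`nilpotentAt_third_of_weight`).

For σ = 1/2 and σ = 1/3 the equations contain vanishing Wronskians, which produce the constants μ
and K; on a connected U the identity theorem allows division by functions with zeros. If the
non-degeneracy condition fails identically, the solution lies in one of the two nilpotent families.
Otherwise the determinant of the trace form at a suitable point is a non-zero constant times a power
of g₁ times the quantity in that condition. This quantity solves a homogeneous linear equation of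
first order along each system, so it has no zeros unless it vanishes identically.

The explicit solutions rest on one observation. Pulled back along y, the hypergeometric equation
with a = b becomes (d/dt − u)² f = 0, where u is given by Bureau's formula, precisely when (u' − u²)
y(1 − y) = ((1−n−m)/2)² y'². Its solutions are φ and tφ with φ' = uφ, and their ratio is t. In cases
I and III, with A = g₁' − γg₁ resp. g₁' − ½γg₁ and N the non-degeneracy quantity, y = A²/N has these
properties. In case II, P = g₁g₄ and R = L⁻¹g₁³ + Lg₄³ are differential polynomials in γ, and g₁, g₄
are recovered from the roots of z² − Rz + P³. -/

theorem hasDerivAt_of_mem (hU : IsOpen U) (hf : DifferentiableOn ℂ f U) {τ : ℂ} (hτ : τ ∈ U) :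
    HasDerivAt f (deriv f τ) τ :=
  (hf.differentiableAt (hU.mem_nhds hτ)).hasDerivAt

theorem eventuallyEq_of_mem (hU : IsOpen U) (h : ∀ τ ∈ U, f τ = g τ) {τ : ℂ} (hτ : τ ∈ U) :
    f =ᶠ[𝓝 τ] g := by
  filter_upwards [hU.mem_nhds hτ] with s hs using h s hs

theorem deriv_eq_of_mem (hU : IsOpen U) (h : ∀ τ ∈ U, f τ = g τ) {τ : ℂ} (hτ : τ ∈ U) :
    deriv f τ = deriv g τ :=
  (eventuallyEq_of_mem hU h hτ).deriv_eq

theorem hasDerivAt_unique_of_mem (hU : IsOpen U) (h : ∀ τ ∈ U, f τ = g τ) {τ a b : ℂ}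
    (hτ : τ ∈ U) (hf : HasDerivAt f a τ) (hg : HasDerivAt g b τ) : a = b := by
  rw [← hf.deriv, ← hg.deriv, deriv_eq_of_mem hU h hτ]

theorem deriv_deriv_of_mem (hU : IsOpen U) {f' : ℂ → ℂ}
    (hf : ∀ τ ∈ U, HasDerivAt f (f' τ) τ) {τ f'' : ℂ} (hτ : τ ∈ U)
    (hf' : HasDerivAt f' f'' τ) : deriv (deriv f) τ = f'' := by
  rw [deriv_eq_of_mem hU (fun s hs => (hf s hs).deriv) hτ, hf'.deriv]

/-- Holomorphic functions on a connected open set have no zero divisors. This replaces division by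
coefficients that may have isolated zeros. -/
theorem eq_zero_of_mul_eq_zero (hU : IsOpen U) (hc : IsPreconnected U)
    (hf : DifferentiableOn ℂ f U) (hg : DifferentiableOn ℂ g U)
    (h : ∀ τ ∈ U, f τ * g τ = 0) (hne : ∃ τ ∈ U, f τ ≠ 0) : ∀ τ ∈ U, g τ = 0 := by
  obtain ⟨τ, hτ, hfτ⟩ := hne
  rcases AnalyticOnNhd.eq_zero_or_eq_zero_of_mul_eq_zero (hf.analyticOnNhd hU)
    (hg.analyticOnNhd hU) h hc with h0 | h0
  · exact absurd (h0 τ hτ) hfτ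
  · exact h0

theorem subset_closure_ne_zero (hU : IsOpen U) (hc : IsPreconnected U)
    (hf : DifferentiableOn ℂ f U) (hne : ∃ τ ∈ U, f τ ≠ 0) :
    U ⊆ closure {τ | τ ∈ U ∧ f τ ≠ 0} := by
  obtain ⟨σ, hσ, hfσ⟩ := hne
  intro τ hτ
  by_contra hcl
  have h0 : f =ᶠ[𝓝 τ] 0 := by
    rw [mem_closure_iff_frequently, not_frequently] at hcl
    filter_upwards [hcl, hU.mem_nhds hτ] with s hs hsU
    by_contra hne
    exact hs ⟨hsU, hne⟩
  exact hfσ ((hf.analyticOnNhd hU).eqOn_zero_of_preconnected_of_eventuallyEq_zero hc hτ h0 hσ)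

theorem exists_mul_ne_zero (hU : IsOpen U) (hc : IsPreconnected U)
    (hf : DifferentiableOn ℂ f U) (hg : DifferentiableOn ℂ g U)
    (hnf : ∃ τ ∈ U, f τ ≠ 0) (hng : ∃ τ ∈ U, g τ ≠ 0) : ∃ τ ∈ U, f τ ≠ 0 ∧ g τ ≠ 0 := by
  by_contra! h
  obtain ⟨τ, hτ, hgτ⟩ := hng
  refine hgτ (eq_zero_of_mul_eq_zero hU hc hf hg (fun s hs => ?_) hnf τ hτ)
  by_cases h0 : f s = 0
  · simp [h0]
  · simp [h s hs h0]

/-- A local solution of `E' = a E` with `E(τ₀) = 1`. -/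
theorem exists_local_exp (hU : IsOpen U) {a : ℂ → ℂ} (ha : DifferentiableOn ℂ a U) {τ₀ : ℂ}
    (hτ₀ : τ₀ ∈ U) : ∃ V ⊆ U, IsOpen V ∧ IsPreconnected V ∧ τ₀ ∈ V ∧ ∃ E : ℂ → ℂ, E τ₀ = 1 ∧
      ∀ τ ∈ V, E τ ≠ 0 ∧ HasDerivAt E (a τ * E τ) τ := by
  obtain ⟨r, hr, hball⟩ := Metric.isOpen_iff.1 hU τ₀ hτ₀
  obtain ⟨B, hB0, hB⟩ := ((ha.mono hball).isExactOn_ball).with_val_at τ₀ 0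
  refine ⟨Metric.ball τ₀ r, hball, Metric.isOpen_ball, (convex_ball τ₀ r).isPreconnected,
    Metric.mem_ball_self hr, fun τ => Complex.exp (B τ), by simp [hB0], fun τ hτ =>
    ⟨Complex.exp_ne_zero _, ?_⟩⟩
  simpa [mul_comm] using (hB τ hτ).cexp

/-- Near every point, a solution of `f' = a f` is a multiple of a function without zeros. -/
theorem exists_local_eq_const_mul (hU : IsOpen U) {a : ℂ → ℂ} (ha : DifferentiableOn ℂ a U)
    (hf : ∀ τ ∈ U, HasDerivAt f (a τ * f τ) τ) {τ₀ : ℂ} (hτ₀ : τ₀ ∈ U) :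
    ∃ V ⊆ U, IsOpen V ∧ τ₀ ∈ V ∧ ∃ E : ℂ → ℂ, E τ₀ = 1 ∧
      ∀ τ ∈ V, E τ ≠ 0 ∧ HasDerivAt E (a τ * E τ) τ ∧ f τ = f τ₀ * E τ := by
  obtain ⟨V, hVU, hV, hVc, hτV, E, hE1, hE⟩ := exists_local_exp hU ha hτ₀
  refine ⟨V, hVU, hV, hτV, E, hE1, fun τ hτ => ⟨(hE τ hτ).1, (hE τ hτ).2, ?_⟩⟩
  have hd : ∀ s ∈ V, HasDerivAt (fun s => f s / E s) 0 s := fun s hs => by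
    refine ((hf s (hVU hs)).div (hE s hs).2 (hE s hs).1).congr_deriv ?_
    rw [div_eq_iff (pow_ne_zero 2 (hE s hs).1)]
    ring
  have := hV.is_const_of_deriv_eq_zero hVc
    (fun s hs => (hd s hs).differentiableAt.differentiableWithinAt)
    (fun s hs => (hd s hs).deriv) hτ hτV
  simp only [hE1, div_one] at this
  rw [← this, div_mul_cancel₀ _ (hE τ hτ).1]

/-- A solution of a homogeneous linear equation of first order has no zeros or vanishes. -/
theorem ne_zero_of_hasDerivAt_mul (hU : IsOpen U) (hc : IsPreconnected U) {a : ℂ → ℂ}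
    (ha : DifferentiableOn ℂ a U) (hf : ∀ τ ∈ U, HasDerivAt f (a τ * f τ) τ)
    (hne : ∃ τ ∈ U, f τ ≠ 0) : ∀ τ ∈ U, f τ ≠ 0 := by
  intro τ₀ hτ₀ h0
  obtain ⟨V, hVU, hV, hτV, E, -, hE⟩ := exists_local_eq_const_mul hU ha hf hτ₀
  obtain ⟨σ, hσ, hfσ⟩ := hne
  have hd : DifferentiableOn ℂ f U := fun s hs =>
    (hf s hs).differentiableAt.differentiableWithinAt
  refine hfσ ((hd.analyticOnNhd hU).eqOn_zero_of_preconnected_of_eventuallyEq_zero hc hτ₀ ?_ hσ)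
  filter_upwards [hV.mem_nhds hτV] with s hs
  simp [(hE s hs).2.2, h0]

/-- Functions with vanishing Wronskian are proportional. -/
theorem exists_eq_const_mul_of_wronskian (hU : IsOpen U) (hc : IsPreconnected U)
    (hf : DifferentiableOn ℂ f U) (hg : DifferentiableOn ℂ g U)
    (h : ∀ τ ∈ U, f τ * deriv g τ = g τ * deriv f τ) (hne : ∃ τ ∈ U, f τ ≠ 0) :
    ∃ k : ℂ, ∀ τ ∈ U, g τ = k * f τ := by
  obtain ⟨τ₀, hτ₀, hf0⟩ := hne
  have hW : IsOpen (U ∩ {τ | f τ ≠ 0}) :=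
    hf.continuousOn.isOpen_inter_preimage hU isOpen_ne
  have hfW := hf.mono (inter_subset_left (s := U) (t := {τ | f τ ≠ 0}))
  -- Where f ≠ 0, the difference g − (g(τ₀)/f(τ₀)) f solves h' = (f'/f) h and vanishes at τ₀. It is
  -- therefore zero near τ₀, and by the identity theorem on all of U.
  have hk : ∀ τ ∈ U ∩ {τ | f τ ≠ 0}, HasDerivAt (fun s => g s - g τ₀ / f τ₀ * f s)
      (deriv f τ / f τ * (g τ - g τ₀ / f τ₀ * f τ)) τ := by
    rintro τ ⟨hτ, hfτ⟩
    refine ((hasDerivAt_of_mem hU hg hτ).sub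
      ((hasDerivAt_of_mem hU hf hτ).const_mul (g τ₀ / f τ₀))).congr_deriv ?_
    have h1 := h τ hτ
    have h2 : f τ ≠ 0 := hfτ
    field_simp
    linear_combination f τ₀ * h1
  obtain ⟨V, hVU, hV, hτV, E, -, hE⟩ := exists_local_eq_const_mul hW
    ((hfW.deriv hW).div hfW fun τ hτ => hτ.2) hk ⟨hτ₀, hf0⟩
  refine ⟨g τ₀ / f τ₀, fun τ hτ => sub_eq_zero.1 ?_⟩
  have hd : DifferentiableOn ℂ (fun s => g s - g τ₀ / f τ₀ * f s) U := hg.sub (hf.const_mul _)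
  refine (hd.analyticOnNhd hU).eqOn_zero_of_preconnected_of_eventuallyEq_zero hc hτ₀ ?_ hτ
  filter_upwards [hV.mem_nhds hτV] with s hs
  rw [(hE s hs).2.2, div_mul_cancel₀ _ hf0, sub_self, zero_mul]
  rfl

/-- A holomorphic function without zeros has local holomorphic roots. -/
theorem exists_local_root (hU : IsOpen U) (hf : DifferentiableOn ℂ f U) {τ₀ : ℂ} (hτ₀ : τ₀ ∈ U)
    (h0 : f τ₀ ≠ 0) {n : ℕ} (hn : n ≠ 0) :
    ∃ V ⊆ U, IsOpen V ∧ τ₀ ∈ V ∧ ∃ g : ℂ → ℂ, DifferentiableOn ℂ g V ∧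
      ∀ τ ∈ V, g τ ≠ 0 ∧ g τ ^ n = f τ := by
  have hW : IsOpen (U ∩ {τ | f τ ≠ 0}) :=
    hf.continuousOn.isOpen_inter_preimage hU isOpen_ne
  have hfW := hf.mono (inter_subset_left (s := U) (t := {τ | f τ ≠ 0}))
  obtain ⟨V, hVU, hV, hτV, E, -, hE⟩ := exists_local_eq_const_mul hW
    (a := fun τ => deriv f τ / f τ) ((hfW.deriv hW).div hfW fun τ hτ => hτ.2)
    (fun τ hτ => by
      have := hasDerivAt_of_mem hU hf hτ.1
      rwa [div_mul_cancel₀ _ hτ.2]) ⟨hτ₀, h0⟩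
  -- The root is built from its logarithmic derivative f'/(nf), scaled by an n-th root of f(τ₀); the
  -- quotient of its n-th power by f is then constant.
  obtain ⟨V', hV'U, hV', hV'c, hτV', G, hG1, hG⟩ := exists_local_exp hV
    (a := fun τ => (n : ℂ)⁻¹ * (deriv f τ / f τ))
    ((((hfW.deriv hW).div hfW fun τ hτ => hτ.2).mono hVU).const_mul _) hτV
  obtain ⟨w, hw⟩ := IsAlgClosed.exists_pow_nat_eq (f τ₀) (Nat.pos_of_ne_zero hn)
  have hw0 : w ≠ 0 := by
    rintro rfl
    exact h0 (by rw [← hw, zero_pow hn])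
  refine ⟨V', fun τ hτ => (hVU (hV'U hτ)).1, hV', hτV', fun τ => w * G τ,
    fun τ hτ => ((hG τ hτ).2.differentiableAt.const_mul w).differentiableWithinAt,
    fun τ hτ => ⟨mul_ne_zero hw0 (hG τ hτ).1, ?_⟩⟩
  have hd : ∀ s ∈ V', HasDerivAt (fun s => (w * G s) ^ n / f s) 0 s := fun s hs => by
    have hfs : f s ≠ 0 := (hVU (hV'U hs)).2
    refine ((((hG s hs).2.const_mul w).pow n).div
      (hasDerivAt_of_mem hU hf (hVU (hV'U hs)).1) hfs).congr_deriv ?_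
    obtain ⟨m, rfl⟩ := Nat.exists_eq_succ_of_ne_zero hn
    have hm : ((m.succ : ℕ) : ℂ) ≠ 0 := Nat.cast_ne_zero.2 hn
    rw [div_eq_zero_iff]
    left
    simp only [Nat.succ_eq_add_one, Nat.add_sub_cancel, Pi.pow_apply] at hm ⊢
    field_simp
    ring
  have := hV'.is_const_of_deriv_eq_zero hV'c
    (fun s hs => (hd s hs).differentiableAt.differentiableWithinAt)
    (fun s hs => (hd s hs).deriv) hτ hτV'
  simp only [hG1, mul_one, hw, div_self h0] at this
  exact (div_eq_one_iff_eq (hVU (hV'U hτ)).2).1 this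

end Holomorphic

/-! ## The rescaled variable -/

theorem isOpen_halfDomain {U : Set ℂ} (hU : IsOpen U) : IsOpen (halfDomain U) :=
  hU.preimage (continuous_const.mul continuous_id)

theorem halfDomain_eq_image (U : Set ℂ) : halfDomain U = (fun τ : ℂ => τ / 2) '' U := by
  ext t
  constructor
  · exact fun ht => ⟨2 * t, ht, by simp⟩
  · rintro ⟨τ, hτ, rfl⟩
    simpa [halfDomain, mul_div_cancel₀] using hτ

theorem differentiableOn_rescale {U : Set ℂ} {g : ℂ → ℂ} (hg : DifferentiableOn ℂ g U) :
    DifferentiableOn ℂ (rescale g) (halfDomain U) :=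
  hg.comp (by fun_prop) fun _ ht => ht

theorem deriv_rescale (g : ℂ → ℂ) : deriv (rescale g) = fun t => 2 * rescale (deriv g) t := by
  funext t
  exact deriv_comp_mul_left (2 : ℂ) g t

theorem forall_halfDomain {U : Set ℂ} {p : ℂ → Prop} :
    (∀ t ∈ halfDomain U, p (2 * t)) ↔ ∀ τ ∈ U, p τ := by
  constructor
  · intro h τ hτ
    have := h (τ / 2) (by simpa [halfDomain, mul_div_cancel₀] using hτ)
    simpa [mul_div_cancel₀] using this
  · exact fun h t ht => h _ ht

/-! ## The non-pivot monomials -/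

theorem nonPivotSolutions_half :
    nonPivotSolutions (1 / 2) = {(4, 0), (3, 1), (1, 3), (0, 4)} := by
  ext ⟨a, b⟩
  have h : (1 - 1 / 2 : ℝ) * a + 1 / 2 * b = 2 ↔ a + b = 4 := by
    rw [← Nat.cast_inj (R := ℝ)]
    push_cast
    constructor <;> intro h <;> linarith
  simp only [nonPivotSolutions, mem_ofPred_eq, h, mem_insert_iff, mem_singleton_iff,
    Prod.mk.injEq, ne_eq]
  omega

theorem nonPivotSolutions_third :
    nonPivotSolutions (1 / 3) = {(3, 0), (1, 4), (0, 6)} := by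
  ext ⟨a, b⟩
  have h : (1 - 1 / 3 : ℝ) * a + 1 / 3 * b = 2 ↔ 2 * a + b = 6 := by
    rw [← Nat.cast_inj (R := ℝ)]
    push_cast
    constructor <;> intro h <;> linarith
  simp only [nonPivotSolutions, mem_ofPred_eq, h, mem_insert_iff, mem_singleton_iff,
    Prod.mk.injEq, ne_eq]
  omega

theorem nonPivotSolutions_one_div {n : ℕ} (hn : 4 ≤ n) :
    nonPivotSolutions (1 / (n : ℝ)) = {(1, n + 1), (0, 2 * n)} := by
  ext ⟨a, b⟩
  have hn0 : (n : ℝ) ≠ 0 := Nat.cast_ne_zero.2 (by omega)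
  have h : (1 - 1 / (n : ℝ)) * a + 1 / n * b = 2 ↔ n * a + b = 2 * n + a := by
    rw [← Nat.cast_inj (R := ℝ)]
    push_cast
    field_simp
    constructor <;> intro h <;> linarith
  simp only [nonPivotSolutions, mem_ofPred_eq, h, mem_insert_iff, mem_singleton_iff,
    Prod.mk.injEq, ne_eq]
  constructor
  · rintro ⟨hp, h⟩
    have ha : a < 3 := by
      by_contra! ha
      nlinarith [Nat.mul_le_mul hn ha, Nat.mul_le_mul_left n ha]
    interval_cases a <;> omega
  · rintro (⟨rfl, rfl⟩ | ⟨rfl, rfl⟩) <;> omega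

theorem nonPivotSolutions_two_div {n : ℕ} (hn : 2 ≤ n) :
    nonPivotSolutions (2 / (2 * (n : ℝ) + 1)) = {(0, 2 * n + 1)} := by
  ext ⟨a, b⟩
  have hn0 : 2 * (n : ℝ) + 1 ≠ 0 := by positivity
  have h : (1 - 2 / (2 * (n : ℝ) + 1)) * a + 2 / (2 * (n : ℝ) + 1) * b = 2 ↔
      2 * n * a + 2 * b = 4 * n + 2 + a := by
    rw [← Nat.cast_inj (R := ℝ)]
    push_cast
    field_simp
    constructor <;> intro h <;> linarith
  simp only [nonPivotSolutions, mem_ofPred_eq, h, mem_singleton_iff, Prod.mk.injEq, ne_eq]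
  constructor
  · rintro ⟨hp, h⟩
    have ha : a < 4 := by
      by_contra! ha
      nlinarith [Nat.mul_le_mul hn ha, Nat.mul_le_mul_left n ha]
    interval_cases a <;> omega
  · rintro ⟨rfl, rfl⟩
    omega

/-- Since σ ≤ 1/2, the exponent a of t₂ is at most 4, and each value determines σ: a = 0 gives σb =
2, a = 1 gives σ(b−1) = 1, a = 2 forces the pivot, a = 3 gives σ(3−b) = 1, and a = 4 gives σ = 1/2.
All these values are excluded. -/
theorem nonPivotSolutions_eq_empty {σ : ℝ} (h0 : 0 < σ) (h1 : σ ≤ 1 / 2)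
    (h2 : ∀ n : ℕ, 2 ≤ n → σ ≠ 1 / (n : ℝ)) (h3 : ∀ n : ℕ, 2 ≤ n → σ ≠ 2 / (2 * (n : ℝ) + 1)) :
    nonPivotSolutions σ = ∅ := by
  have hinv : ∀ n : ℕ, 2 ≤ n → σ * n ≠ 1 := fun n hn h =>
    h2 n hn (eq_div_of_mul_eq (Nat.cast_ne_zero.2 (by omega)) h)
  rw [eq_empty_iff_forall_notMem]
  rintro ⟨a, b⟩ ⟨hp, h⟩
  simp only at h
  have hb0 : (0 : ℝ) ≤ b := b.cast_nonneg
  have ha : a < 5 := by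
    by_contra! ha
    have : (5 : ℝ) ≤ a := by exact_mod_cast ha
    nlinarith
  interval_cases a
  · have hb : 4 ≤ b := by
      by_contra! hb
      have : (b : ℝ) ≤ 3 := by exact_mod_cast Nat.le_of_lt_succ hb
      norm_num at h
      nlinarith
    rcases Nat.even_or_odd' b with ⟨m, rfl | rfl⟩
    · refine hinv m (by omega) ?_
      push_cast at h
      linarith
    · refine h3 m (by omega) (eq_div_of_mul_eq (by positivity) ?_)
      push_cast at h
      linarith
  · have hb : 3 ≤ b := by
      by_contra! hb
      have : (b : ℝ) ≤ 2 := by exact_mod_cast Nat.le_of_lt_succ hb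
      norm_num at h
      nlinarith
    refine hinv (b - 1) (by omega) ?_
    rw [Nat.cast_sub (by omega)]
    push_cast at h ⊢
    linarith
  · have : σ * ((b : ℝ) - 2) = 0 := by
      push_cast at h
      linarith
    rcases mul_eq_zero.1 this with h | h
    · linarith
    · have : b = 2 := by exact_mod_cast sub_eq_zero.1 h
      exact hp (by rw [this])
  · have hb : b < 2 := by
      by_contra! hb
      have : (2 : ℝ) ≤ b := by exact_mod_cast hb
      push_cast at h
      nlinarith
    refine hinv (3 - b) (by omega) ?_
    rw [Nat.cast_sub (by omega)]
    push_cast at h ⊢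
    linarith
  · have hb : b = 0 := by
      by_contra hb
      have : (1 : ℝ) ≤ b := by exact_mod_cast Nat.one_le_iff_ne_zero.2 hb
      push_cast at h
      nlinarith
    subst hb
    refine hinv 2 le_rfl ?_
    push_cast at h ⊢
    linarith

/-! ## Inversion -/

theorem sqLength_eq (t : Fin 4 → ℂ) : sqLength t = 2 * (t 0 * t 3 + t 1 * t 2) := by
  simp [sqLength, eta, Fin.sum_univ_four, Fin.rev, Fin.ext_iff]
  ring

theorem inversion_prepotentialHalf (γ g₁ g₂ g₃ g₄ : ℂ → ℂ) {t : Fin 4 → ℂ} (ht : t 3 ≠ 0) :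
    inversion (prepotentialHalf γ g₁ g₂ g₃ g₄) t =
      prepotentialHalf (hatPivot γ) (hatWeight 2 g₁) (hatWeight 2 g₂) (hatWeight 2 g₃)
        (hatWeight 2 g₄) t := by
  simp only [inversion, prepotentialHalf, hatPivot, hatWeight, sqLength_eq, Matrix.cons_val]
  field_simp
  ring

theorem inversion_prepotentialThird (γ g₁ g₃ g₄ : ℂ → ℂ) {t : Fin 4 → ℂ} (ht : t 3 ≠ 0) :
    inversion (prepotentialThird γ g₁ g₃ g₄) t =
      prepotentialThird (hatPivot γ) (hatWeight 1 g₁) (hatWeight 3 g₃) (hatWeight 4 g₄) t := by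
  simp only [inversion, prepotentialThird, hatPivot, hatWeight, sqLength_eq, Matrix.cons_val]
  field_simp
  ring

theorem isModular_prepotentialHalf (γ g₁ g₂ g₃ g₄ : ℂ → ℂ) {U : Set ℂ}
    (hU : ∀ τ ∈ U, τ ≠ 0 ∧ -(1 / τ) ∈ U) :
    IsModular U (prepotentialHalf γ g₁ g₂ g₃ g₄) ↔ ∀ τ ∈ U, hatPivot γ τ = γ τ ∧
      hatWeight 2 g₁ τ = g₁ τ ∧ hatWeight 2 g₂ τ = g₂ τ ∧ hatWeight 2 g₃ τ = g₃ τ ∧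
      hatWeight 2 g₄ τ = g₄ τ := by
  constructor
  · rintro ⟨-, h⟩ τ hτ
    have key : ∀ x y : ℂ, _ := fun x y => h ![0, x, y, τ] (by simpa [domain] using hτ)
    simp only [inversion_prepotentialHalf γ g₁ g₂ g₃ g₄ (t := ![0, _, _, τ]) (hU τ hτ).1,
      prepotentialHalf, Matrix.cons_val] at key
    -- The points (0,1) and (1,0) isolate the coefficients of the pure powers; the values at (1,1),
    -- (1,−1) and (1,2) then separate the three mixed monomials.
    have h1 := key 0 1
    have h4 := key 1 0
    have ha := key 1 1
    have hb := key 1 (-1)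
    have hc := key 1 2
    have e1 : hatWeight 2 g₁ τ = g₁ τ := by linear_combination h1
    have e4 : hatWeight 2 g₄ τ = g₄ τ := by linear_combination h4
    rw [e1, e4] at ha hb hc
    refine ⟨?_, e1, ?_, ?_, e4⟩
    · linear_combination -2 * ha - 2 * hb
    · linear_combination (hc - 2 * ha - (ha + hb)) / 6
    · linear_combination (ha - hb) / 2 - (hc - 2 * ha - (ha + hb)) / 6
  · refine fun h => ⟨hU, fun t ht => ?_⟩
    obtain ⟨e0, e1, e2, e3, e4⟩ := h (t 3) ht
    rw [inversion_prepotentialHalf _ _ _ _ _ (hU _ ht).1]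
    simp only [prepotentialHalf, e0, e1, e2, e3, e4]

theorem isModular_prepotentialThird (γ g₁ g₃ g₄ : ℂ → ℂ) {U : Set ℂ}
    (hU : ∀ τ ∈ U, τ ≠ 0 ∧ -(1 / τ) ∈ U) :
    IsModular U (prepotentialThird γ g₁ g₃ g₄) ↔ ∀ τ ∈ U, hatPivot γ τ = γ τ ∧
      hatWeight 1 g₁ τ = g₁ τ ∧ hatWeight 3 g₃ τ = g₃ τ ∧ hatWeight 4 g₄ τ = g₄ τ := by
  constructor
  · rintro ⟨-, h⟩ τ hτ
    have key : ∀ x y : ℂ, _ := fun x y => h ![0, x, y, τ] (by simpa [domain] using hτ)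
    simp only [inversion_prepotentialThird γ g₁ g₃ g₄ (t := ![0, _, _, τ]) (hU τ hτ).1,
      prepotentialThird, Matrix.cons_val] at key
    have h4 := key 0 1
    have h1 := key 1 0
    have ha := key 1 1
    have hb := key 1 2
    have e1 : hatWeight 1 g₁ τ = g₁ τ := by linear_combination h1
    have e4 : hatWeight 4 g₄ τ = g₄ τ := by linear_combination h4
    rw [e1, e4] at ha hb
    refine ⟨?_, e1, ?_, e4⟩
    · linear_combination (hb - 16 * ha) / 3
    · linear_combination (hb - 4 * ha) / 12
  · refine fun h => ⟨hU, fun t ht => ?_⟩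
    obtain ⟨e0, e1, e3, e4⟩ := h (t 3) ht
    rw [inversion_prepotentialThird _ _ _ _ (hU _ ht).1]
    simp only [prepotentialThird, e0, e1, e3, e4]

/-! ## Elimination of `g₁` -/

theorem solvesBureau_rescale_iff {U : Set ℂ} {γ : ℂ → ℂ} {α β κ : ℂ}
    (h : 16 * α - κ = 18 ∧ 2 * β + κ = 6) :
    SolvesBureau α β κ 0 (halfDomain U) (rescale γ) ↔ ∀ τ ∈ U, 2 * deriv γ τ - γ τ ^ 2 ≠ 0 ∧
      8 * deriv (deriv (deriv γ)) τ =
        α * ((4 * deriv (deriv γ) τ - 4 * γ τ * deriv γ τ) ^ 2 / (2 * deriv γ τ - γ τ ^ 2)) +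
          4 * β * γ τ * deriv (deriv γ) τ + 4 * κ * deriv γ τ ^ 2 := by
  have h1 : ∀ t, deriv (rescale γ) t = 2 * deriv γ (2 * t) := fun t => by
    rw [deriv_rescale]; rfl
  have h2 : deriv (deriv (rescale γ)) = fun t => 4 * rescale (deriv (deriv γ)) t := by
    rw [deriv_rescale]
    funext t
    rw [deriv_const_mul_field, deriv_rescale]
    ring
  have h3 : ∀ t, deriv (deriv (deriv (rescale γ))) t = 8 * deriv (deriv (deriv γ)) (2 * t) :=
    fun t => by
      rw [h2, deriv_const_mul_field, deriv_rescale]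
      simp only [rescale]
      ring
  rw [← forall_halfDomain]
  simp only [SolvesBureau, h, h3, true_and]
  simp only [h2, h1]
  refine forall₂_congr fun t _ => and_congr Iff.rfl ?_
  simp only [rescale]
  rw [show 4 * deriv (deriv γ) (2 * t) - 2 * γ (2 * t) * (2 * deriv γ (2 * t)) =
    4 * deriv (deriv γ) (2 * t) - 4 * γ (2 * t) * deriv γ (2 * t) by ring]
  constructor <;> intro h <;> linear_combination h

theorem deriv_rescale_sub_sq_iff {U : Set ℂ} {γ r : ℂ → ℂ} :
    (∀ t ∈ halfDomain U, deriv (rescale γ) t - rescale γ t ^ 2 = rescale r t) ↔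
      ∀ τ ∈ U, deriv γ τ = 1 / 2 * γ τ ^ 2 + 1 / 2 * r τ := by
  rw [← forall_halfDomain (U := U)]
  refine forall₂_congr fun t _ => ?_
  rw [deriv_rescale]
  simp only [rescale]
  constructor <;> intro h
  · linear_combination 1 / 2 * h
  · linear_combination 2 * h

/-- After γ' = ½γ² − 288μg₁² is differentiated twice, the defect of Bureau's equation equals
−4608μg₁ times the defect of the equation for g₁''. The absence of zeros of g₁ makes the two
equations equivalent. -/
theorem caseI_iff_bureau {U : Set ℂ} {μ : ℂ} {γ g₁ : ℂ → ℂ} (hU : IsOpen U) (hμ : μ ≠ 0)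
    (hγ : DifferentiableOn ℂ γ U) (hg : DifferentiableOn ℂ g₁ U) (h0 : ∀ τ ∈ U, g₁ τ ≠ 0) :
    CaseI U μ γ g₁ ↔ SolvesBureau (1 / 2) 8 (-10) 0 (halfDomain U) (rescale γ) ∧
      ∀ t ∈ halfDomain U,
        deriv (rescale γ) t - rescale γ t ^ 2 = -576 * μ * rescale g₁ t ^ 2 := by
  rw [solvesBureau_rescale_iff (by norm_num),
    show (∀ t ∈ halfDomain U, deriv (rescale γ) t - rescale γ t ^ 2 =
      -576 * μ * rescale g₁ t ^ 2) ↔ _ from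
      deriv_rescale_sub_sq_iff (r := fun τ => -576 * μ * g₁ τ ^ 2)]
  suffices key : (∀ τ ∈ U, deriv γ τ = 1 / 2 * γ τ ^ 2 - 288 * μ * g₁ τ ^ 2) → ∀ τ ∈ U,
      2 * deriv γ τ - γ τ ^ 2 ≠ 0 ∧ 8 * deriv (deriv (deriv γ)) τ -
        (1 / 2 * ((4 * deriv (deriv γ) τ - 4 * γ τ * deriv γ τ) ^ 2 /
          (2 * deriv γ τ - γ τ ^ 2)) + 4 * 8 * γ τ * deriv (deriv γ) τ
          + 4 * -10 * deriv γ τ ^ 2) = -4608 * μ * g₁ τ *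
          (deriv (deriv g₁) τ - (3 * γ τ * deriv g₁ τ - 3 * g₁ τ * deriv γ τ)) by
    constructor
    · intro h
      have hR := fun τ hτ => (h τ hτ).1
      refine ⟨fun τ hτ => ⟨(key hR τ hτ).1, ?_⟩, fun τ hτ => by rw [hR τ hτ]; ring⟩
      rw [← sub_eq_zero, (key hR τ hτ).2, (h τ hτ).2, sub_self, mul_zero]
    · rintro ⟨h, hR'⟩ τ hτ
      have hR : ∀ τ ∈ U, deriv γ τ = 1 / 2 * γ τ ^ 2 - 288 * μ * g₁ τ ^ 2 := fun τ hτ => by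
        rw [hR' τ hτ]; ring
      refine ⟨hR τ hτ, ?_⟩
      have hk := (key hR τ hτ).2
      rw [(h τ hτ).2, sub_self, eq_comm, mul_eq_zero] at hk
      exact sub_eq_zero.1 (hk.resolve_left
        (mul_ne_zero (mul_ne_zero (by norm_num) hμ) (h0 τ hτ)))
  intro hR
  have h2 : ∀ τ ∈ U,
      deriv (deriv γ) τ = γ τ * deriv γ τ - 576 * μ * (g₁ τ * deriv g₁ τ) := fun τ hτ => by
    refine hasDerivAt_unique_of_mem hU hR hτ (hasDerivAt_of_mem hU (hγ.deriv hU) hτ)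
      (((((hasDerivAt_of_mem hU hγ hτ).fun_pow 2).const_mul (1 / 2)).fun_sub
        (((hasDerivAt_of_mem hU hg hτ).fun_pow 2).const_mul (288 * μ))).congr_deriv ?_)
    push_cast
    ring
  intro τ hτ
  have h3 : deriv (deriv (deriv γ)) τ = deriv γ τ ^ 2 + γ τ * deriv (deriv γ) τ
        - 576 * μ * (deriv g₁ τ ^ 2 + g₁ τ * deriv (deriv g₁) τ) := by
    refine hasDerivAt_unique_of_mem hU h2 hτ
      (hasDerivAt_of_mem hU ((hγ.deriv hU).deriv hU) hτ)
      ((((hasDerivAt_of_mem hU hγ hτ).fun_mul (hasDerivAt_of_mem hU (hγ.deriv hU) hτ)).fun_sub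
        (((hasDerivAt_of_mem hU hg hτ).fun_mul
          (hasDerivAt_of_mem hU (hg.deriv hU) hτ)).const_mul (576 * μ))).congr_deriv ?_)
    ring
  have h0' := h0 τ hτ
  have hW : 2 * deriv γ τ - γ τ ^ 2 = -576 * μ * g₁ τ ^ 2 := by rw [hR τ hτ]; ring
  have hne : -576 * μ * g₁ τ ^ 2 ≠ 0 :=
    mul_ne_zero (mul_ne_zero (by norm_num) hμ) (pow_ne_zero 2 h0')
  have hq : (4 * deriv (deriv γ) τ - 4 * γ τ * deriv γ τ) ^ 2 / (2 * deriv γ τ - γ τ ^ 2) =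
      -9216 * μ * deriv g₁ τ ^ 2 := by
    rw [hW, div_eq_iff hne, h2 τ hτ]
    ring
  refine ⟨by rwa [hW], ?_⟩
  rw [hq, h3, h2 τ hτ]
  linear_combination 24 * deriv γ τ * hW

/-- The same elimination as in case I; the factor between the two defects is now −2304Kg₁³. -/
theorem caseIII_iff_bureau {U : Set ℂ} {K : ℂ} {γ g₁ : ℂ → ℂ} (hU : IsOpen U) (hK : K ≠ 0)
    (hγ : DifferentiableOn ℂ γ U) (hg : DifferentiableOn ℂ g₁ U) (h0 : ∀ τ ∈ U, g₁ τ ≠ 0) :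
    CaseIII U K γ g₁ ↔ SolvesBureau (3 / 4) 6 (-6) 0 (halfDomain U) (rescale γ) ∧
      ∀ t ∈ halfDomain U,
        deriv (rescale γ) t - rescale γ t ^ 2 = -144 * K * rescale g₁ t ^ 4 := by
  rw [solvesBureau_rescale_iff (by norm_num),
    show (∀ t ∈ halfDomain U, deriv (rescale γ) t - rescale γ t ^ 2 =
      -144 * K * rescale g₁ t ^ 4) ↔ _ from
      deriv_rescale_sub_sq_iff (r := fun τ => -144 * K * g₁ τ ^ 4)]
  suffices key : (∀ τ ∈ U, deriv γ τ = 1 / 2 * γ τ ^ 2 - 72 * K * g₁ τ ^ 4) → ∀ τ ∈ U,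
      2 * deriv γ τ - γ τ ^ 2 ≠ 0 ∧ 8 * deriv (deriv (deriv γ)) τ -
        (3 / 4 * ((4 * deriv (deriv γ) τ - 4 * γ τ * deriv γ τ) ^ 2 /
          (2 * deriv γ τ - γ τ ^ 2)) + 4 * 6 * γ τ * deriv (deriv γ) τ
          + 4 * -6 * deriv γ τ ^ 2) = -2304 * K * g₁ τ ^ 3 *
          (deriv (deriv g₁) τ - (2 * γ τ * deriv g₁ τ - g₁ τ * deriv γ τ)) by
    constructor
    · intro h
      have hR := fun τ hτ => (h τ hτ).1
      refine ⟨fun τ hτ => ⟨(key hR τ hτ).1, ?_⟩, fun τ hτ => by rw [hR τ hτ]; ring⟩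
      rw [← sub_eq_zero, (key hR τ hτ).2, (h τ hτ).2, sub_self, mul_zero]
    · rintro ⟨h, hR'⟩ τ hτ
      have hR : ∀ τ ∈ U, deriv γ τ = 1 / 2 * γ τ ^ 2 - 72 * K * g₁ τ ^ 4 := fun τ hτ => by
        rw [hR' τ hτ]; ring
      refine ⟨hR τ hτ, ?_⟩
      have hk := (key hR τ hτ).2
      rw [(h τ hτ).2, sub_self, eq_comm, mul_eq_zero] at hk
      exact sub_eq_zero.1 (hk.resolve_left
        (mul_ne_zero (mul_ne_zero (by norm_num) hK) (pow_ne_zero 3 (h0 τ hτ))))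
  intro hR
  have h2 : ∀ τ ∈ U,
      deriv (deriv γ) τ = γ τ * deriv γ τ - 288 * K * (g₁ τ ^ 3 * deriv g₁ τ) := fun τ hτ => by
    refine hasDerivAt_unique_of_mem hU hR hτ (hasDerivAt_of_mem hU (hγ.deriv hU) hτ)
      (((((hasDerivAt_of_mem hU hγ hτ).fun_pow 2).const_mul (1 / 2)).fun_sub
        (((hasDerivAt_of_mem hU hg hτ).fun_pow 4).const_mul (72 * K))).congr_deriv ?_)
    push_cast
    ring
  intro τ hτ
  have h3 : deriv (deriv (deriv γ)) τ = deriv γ τ ^ 2 + γ τ * deriv (deriv γ) τ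
        - 288 * K * (3 * g₁ τ ^ 2 * deriv g₁ τ ^ 2 + g₁ τ ^ 3 * deriv (deriv g₁) τ) := by
    refine hasDerivAt_unique_of_mem hU h2 hτ
      (hasDerivAt_of_mem hU ((hγ.deriv hU).deriv hU) hτ)
      ((((hasDerivAt_of_mem hU hγ hτ).fun_mul (hasDerivAt_of_mem hU (hγ.deriv hU) hτ)).fun_sub
        ((((hasDerivAt_of_mem hU hg hτ).fun_pow 3).fun_mul
          (hasDerivAt_of_mem hU (hg.deriv hU) hτ)).const_mul (288 * K))).congr_deriv ?_)
    push_cast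
    ring
  have h0' := h0 τ hτ
  have hW : 2 * deriv γ τ - γ τ ^ 2 = -144 * K * g₁ τ ^ 4 := by rw [hR τ hτ]; ring
  have hne : -144 * K * g₁ τ ^ 4 ≠ 0 :=
    mul_ne_zero (mul_ne_zero (by norm_num) hK) (pow_ne_zero 4 h0')
  have hq : (4 * deriv (deriv γ) τ - 4 * γ τ * deriv γ τ) ^ 2 / (2 * deriv γ τ - γ τ ^ 2) =
      -9216 * K * (g₁ τ ^ 2 * deriv g₁ τ ^ 2) := by
    rw [hW, div_eq_iff hne, h2 τ hτ]
    ring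
  refine ⟨by rwa [hW], ?_⟩
  rw [hq, h3, h2 τ hτ]
  linear_combination 16 * deriv γ τ * hW

/-! ## The Halphen system -/

theorem hasDerivAt_rescale {U : Set ℂ} {g : ℂ → ℂ} (hU : IsOpen U) (hg : DifferentiableOn ℂ g U)
    {t : ℂ} (ht : t ∈ halfDomain U) : HasDerivAt (rescale g) (2 * deriv g (2 * t)) t := by
  have := hasDerivAt_of_mem (isOpen_halfDomain hU) (differentiableOn_rescale hg) ht
  rwa [deriv_rescale] at this

/-- The two linear formulas give ω₂ and ω₁ + ω₃; only Δ = ω₁ − ω₃ is missing, and the Halphen system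
prescribes Δ². A square root of that function has to exist locally even where it might vanish, which
is where its linear differential equation is used. -/
theorem exists_halphen_of_caseI {U : Set ℂ} {μ r : ℂ} {γ g₁ : ℂ → ℂ} (hU : IsOpen U)
    (hμ : μ ≠ 0) (hr : r ^ 2 = μ) (hγ : DifferentiableOn ℂ γ U) (hg : DifferentiableOn ℂ g₁ U)
    (h : CaseI U μ γ g₁) {t₀ : ℂ} (ht₀ : t₀ ∈ halfDomain U) :
    ∃ T : Set ℂ, IsOpen T ∧ t₀ ∈ T ∧ T ⊆ halfDomain U ∧
      ∃ ω₁ ω₂ ω₃ : ℂ → ℂ, SolvesHalphen T ω₁ ω₂ ω₃ ∧ ∀ t ∈ T,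
        rescale γ t = 1 / 4 * (ω₁ t + 2 * ω₂ t + ω₃ t) ∧
        rescale g₁ t = 1 / (96 * r) * (ω₁ t - 2 * ω₂ t + ω₃ t) ∧
        (NondegenerateI μ γ g₁ (2 * t) ↔ ω₁ t ≠ ω₂ t ∧ ω₂ t ≠ ω₃ t ∧ ω₃ t ≠ ω₁ t) := by
  have hr0 : r ≠ 0 := by
    rintro rfl
    exact hμ (by rw [← hr]; norm_num)
  set T := halfDomain U with hT
  have hTo : IsOpen T := isOpen_halfDomain hU
  have hu : ∀ t ∈ T, HasDerivAt (rescale γ)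
      (rescale γ t ^ 2 - 576 * r ^ 2 * rescale g₁ t ^ 2) t := fun t ht => by
    refine (hasDerivAt_rescale hU hγ ht).congr_deriv ?_
    rw [(h _ ht).1, hr]
    simp only [rescale]
    ring
  have hG : ∀ t ∈ T, HasDerivAt (rescale g₁) (2 * rescale (deriv g₁) t) t := fun t ht =>
    hasDerivAt_rescale hU hg ht
  have hG' : ∀ t ∈ T, HasDerivAt (rescale (deriv g₁)) (6 * rescale γ t * rescale (deriv g₁) t
      - 3 * rescale g₁ t * (rescale γ t ^ 2 - 576 * r ^ 2 * rescale g₁ t ^ 2)) t := fun t ht => by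
    refine (hasDerivAt_rescale hU (hg.deriv hU) ht).congr_deriv ?_
    rw [(h _ ht).2, (h _ ht).1, hr]
    simp only [rescale]
    ring
  -- The function f is the required Δ². The coefficient a is 4ω₂, in accordance with (ω₁ − ω₃)' =
  -- 2ω₂(ω₁ − ω₃).
  obtain ⟨V, hVT, hV, ht₀V, E, -, hE⟩ := exists_local_eq_const_mul hTo
    (a := fun t => 4 * rescale γ t - 96 * r * rescale g₁ t)
    (f := fun t => -192 * r *
      (rescale (deriv g₁) t - rescale γ t * rescale g₁ t - 24 * r * rescale g₁ t ^ 2))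
    ((((differentiableOn_rescale hγ).const_mul 4).sub
      ((differentiableOn_rescale hg).const_mul (96 * r)))) (fun t ht => by
      refine ((((hG' t ht).fun_sub ((hu t ht).fun_mul (hG t ht))).fun_sub
        (((hG t ht).fun_pow 2).const_mul (24 * r))).const_mul (-192 * r)).congr_deriv ?_
      push_cast
      ring) ht₀
  obtain ⟨W, hWV, hW, ht₀W, E₂, hEd, hE2⟩ := exists_local_root (n := 2) hV
    (fun t ht => (hE t ht).2.1.differentiableAt.differentiableWithinAt) ht₀V (hE t₀ ht₀V).1
    two_ne_zero
  -- Only the factor without zeros needs a holomorphic root. The constant f(t₀) may be zero; then w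
  -- = 0 and ω₁ = ω₃.
  obtain ⟨w, hw⟩ := IsAlgClosed.exists_pow_nat_eq (-192 * r *
      (rescale (deriv g₁) t₀ - rescale γ t₀ * rescale g₁ t₀ - 24 * r * rescale g₁ t₀ ^ 2))
      (n := 2) two_pos
  set Δ : ℂ → ℂ := fun t => w * E₂ t with hΔ
  have hΔ2 : ∀ t ∈ W, Δ t ^ 2 = -192 * r *
      (rescale (deriv g₁) t - rescale γ t * rescale g₁ t - 24 * r * rescale g₁ t ^ 2) :=
    fun t ht => by
      rw [(hE t (hWV ht)).2.2, hΔ, mul_pow, hw, (hE2 t ht).2]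
  have hΔd : ∀ t ∈ W, HasDerivAt Δ ((2 * rescale γ t - 48 * r * rescale g₁ t) * Δ t) t :=
    fun t ht => by
      have h1 := hasDerivAt_of_mem hW hEd ht
      have h2 : 2 * E₂ t * deriv E₂ t = (4 * rescale γ t - 96 * r * rescale g₁ t) * E₂ t ^ 2 := by
        rw [(hE2 t ht).2]
        refine hasDerivAt_unique_of_mem hW (fun s hs => (hE2 s hs).2) ht
          ((h1.fun_pow 2).congr_deriv ?_) (hE t (hWV ht)).2.1
        push_cast
        ring
      refine (h1.const_mul w).congr_deriv ?_
      refine mul_left_cancel₀ (mul_ne_zero two_ne_zero (hE2 t ht).1) ?_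
      simp only [hΔ]
      linear_combination w * h2
  have hsub : W ⊆ T := hWV.trans hVT
  have hω₁ : ∀ t ∈ W, HasDerivAt (fun t => rescale γ t + 24 * r * rescale g₁ t + Δ t / 2) _ t :=
    fun t ht => ((hu t (hsub ht)).fun_add ((hG t (hsub ht)).const_mul (24 * r))).fun_add
      ((hΔd t ht).div_const 2)
  have hω₂ : ∀ t ∈ W, HasDerivAt (fun t => rescale γ t - 24 * r * rescale g₁ t) _ t :=
    fun t ht => (hu t (hsub ht)).fun_sub ((hG t (hsub ht)).const_mul (24 * r))
  have hω₃ : ∀ t ∈ W, HasDerivAt (fun t => rescale γ t + 24 * r * rescale g₁ t - Δ t / 2) _ t :=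
    fun t ht => ((hu t (hsub ht)).fun_add ((hG t (hsub ht)).const_mul (24 * r))).fun_sub
      ((hΔd t ht).div_const 2)
  refine ⟨W, hW, ht₀W, hsub, _, _, _, ⟨⟨
    fun t ht => (hω₁ t ht).differentiableAt.differentiableWithinAt,
    fun t ht => (hω₂ t ht).differentiableAt.differentiableWithinAt,
    fun t ht => (hω₃ t ht).differentiableAt.differentiableWithinAt⟩, fun t ht => ?_⟩,
    fun t ht => ⟨by ring, by field_simp; ring, ?_⟩⟩
  · rw [(hω₁ t ht).deriv, (hω₂ t ht).deriv, (hω₃ t ht).deriv]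
    have := hΔ2 t ht
    refine ⟨?_, ?_, ?_⟩
    · linear_combination 1 / 4 * this
    · linear_combination -1 / 4 * this
    · linear_combination 1 / 4 * this
  · have e1 := hΔ2 t ht
    -- The non-degeneracy quantity splits into two factors because μ = r². They are proportional to
    -- (ω₃ − ω₁)² and (ω₁ − ω₂)(ω₂ − ω₃), so it is non-zero exactly when the ω are distinct.
    have e2 : (deriv g₁ (2 * t) - γ (2 * t) * g₁ (2 * t)) ^ 2 - 576 * μ * g₁ (2 * t) ^ 4 =
        (rescale (deriv g₁) t - rescale γ t * rescale g₁ t - 24 * r * rescale g₁ t ^ 2) *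
        (rescale (deriv g₁) t - rescale γ t * rescale g₁ t + 24 * r * rescale g₁ t ^ 2) := by
      rw [← hr]
      simp only [rescale]
      ring
    set a := rescale γ t
    set b := rescale g₁ t
    set d := rescale (deriv g₁) t
    have e3 : (a + 24 * r * b + Δ t / 2 - (a - 24 * r * b)) *
        (a - 24 * r * b - (a + 24 * r * b - Δ t / 2)) = -48 * r * (d - a * b + 24 * r * b ^ 2) := by
      linear_combination 1 / 4 * e1
    have e4 : (a + 24 * r * b - Δ t / 2 - (a + 24 * r * b + Δ t / 2)) ^ 2 =
        -192 * r * (d - a * b - 24 * r * b ^ 2) := by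
      linear_combination e1
    rw [NondegenerateI, ← sub_ne_zero, e2, ← and_assoc, ← sub_ne_zero (a := a + _ + _),
      ← sub_ne_zero (a := a - _), ← sub_ne_zero (a := a + _ - _), ← mul_ne_zero_iff, e3,
      ← pow_ne_zero_iff (two_ne_zero) (a := a + 24 * r * b - Δ t / 2 - _), e4]
    simp only [ne_eq, mul_eq_zero, hr0, neg_eq_zero, OfNat.ofNat_ne_zero, not_or, false_or]
    tauto

theorem caseI_of_halphen {U : Set ℂ} {μ r : ℂ} {γ g₁ : ℂ → ℂ} (hU : IsOpen U)
    (hμ : μ ≠ 0) (hr : r ^ 2 = μ) (hγ : DifferentiableOn ℂ γ U) (hg : DifferentiableOn ℂ g₁ U)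
    (h : ∀ t₀ ∈ halfDomain U, ∃ T : Set ℂ, IsOpen T ∧ t₀ ∈ T ∧ T ⊆ halfDomain U ∧
      ∃ ω₁ ω₂ ω₃ : ℂ → ℂ, SolvesHalphen T ω₁ ω₂ ω₃ ∧ ∀ t ∈ T,
        rescale γ t = 1 / 4 * (ω₁ t + 2 * ω₂ t + ω₃ t) ∧
        rescale g₁ t = 1 / (96 * r) * (ω₁ t - 2 * ω₂ t + ω₃ t)) : CaseI U μ γ g₁ := by
  have hr0 : r ≠ 0 := by
    rintro rfl
    exact hμ (by rw [← hr]; norm_num)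
  refine forall_halfDomain.1 fun t ht => ?_
  obtain ⟨T, hT, htT, hTU, ω₁, ω₂, ω₃, ⟨⟨hd₁, hd₂, hd₃⟩, hω⟩, hf⟩ := h t ht
  have h1 : ∀ s ∈ T, HasDerivAt ω₁ (-(ω₂ s * ω₃ s) + ω₁ s * (ω₂ s + ω₃ s)) s := fun s hs => by
    rw [← (hω s hs).1]; exact hasDerivAt_of_mem hT hd₁ hs
  have h2 : ∀ s ∈ T, HasDerivAt ω₂ (-(ω₃ s * ω₁ s) + ω₂ s * (ω₃ s + ω₁ s)) s := fun s hs => by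
    rw [← (hω s hs).2.1]; exact hasDerivAt_of_mem hT hd₂ hs
  have h3 : ∀ s ∈ T, HasDerivAt ω₃ (-(ω₁ s * ω₂ s) + ω₃ s * (ω₁ s + ω₂ s)) s := fun s hs => by
    rw [← (hω s hs).2.2]; exact hasDerivAt_of_mem hT hd₃ hs
  have eγ : ∀ s ∈ T, 2 * deriv γ (2 * s) = 1 / 2 * (ω₂ s * (ω₁ s + ω₃ s)) := fun s hs =>
    hasDerivAt_unique_of_mem hT (fun s hs => (hf s hs).1) hs (hasDerivAt_rescale hU hγ (hTU hs))
      (((((h1 s hs).fun_add ((h2 s hs).const_mul 2)).fun_add (h3 s hs)).const_mul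
        (1 / 4)).congr_deriv (by ring))
  have eg : ∀ s ∈ T, rescale (deriv g₁) s =
      1 / (96 * r) * (2 * (ω₁ s * ω₃ s) - ω₂ s * (ω₁ s + ω₃ s)) := fun s hs => by
    have := hasDerivAt_unique_of_mem hT (fun s hs => (hf s hs).2) hs
      (hasDerivAt_rescale hU hg (hTU hs))
      ((((h1 s hs).fun_sub ((h2 s hs).const_mul 2)).fun_add (h3 s hs)).const_mul (1 / (96 * r)))
    simp only [rescale]
    linear_combination 1 / 2 * this
  have egg := hasDerivAt_unique_of_mem hT eg htT (hasDerivAt_rescale hU (hg.deriv hU) (hTU htT))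
    (((((h1 t htT).fun_mul (h3 t htT)).const_mul 2).fun_sub
      ((h2 t htT).fun_mul ((h1 t htT).fun_add (h3 t htT)))).const_mul (1 / (96 * r)))
  have e1 := eγ t htT
  have e2 := eg t htT
  obtain ⟨e3, e4⟩ := hf t htT
  simp only [rescale] at e2 e3 e4
  have e5 : deriv γ (2 * t) = 1 / 4 * (ω₂ t * (ω₁ t + ω₃ t)) := by linear_combination 1 / 2 * e1
  have e6 := (eq_div_iff (two_ne_zero' ℂ)).2 ((mul_comm _ _).trans egg)
  rw [e6, e5, e2, e3, e4, ← hr]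
  constructor <;> field_simp <;> ring

/-! ## The Chazy equation -/

section Chazy

variable {U : Set ℂ} {L : ℂ} {γ g₁ g₄ : ℂ → ℂ}

theorem CaseII.hasDerivAt (hU : IsOpen U) (hγ : DifferentiableOn ℂ γ U)
    (h₁ : DifferentiableOn ℂ g₁ U) (h₄ : DifferentiableOn ℂ g₄ U) (h : CaseII U L γ g₁ g₄)
    {τ : ℂ} (hτ : τ ∈ U) :
    HasDerivAt γ (1 / 2 * γ τ ^ 2 - 288 * g₁ τ * g₄ τ) τ ∧
      HasDerivAt g₁ (γ τ * g₁ τ + 24 * L * g₄ τ ^ 2) τ ∧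
      HasDerivAt g₄ (γ τ * g₄ τ + 24 * L⁻¹ * g₁ τ ^ 2) τ := by
  obtain ⟨e, e₁, e₄⟩ := h τ hτ
  rw [← e, ← e₁, ← e₄]
  exact ⟨hasDerivAt_of_mem hU hγ hτ, hasDerivAt_of_mem hU h₁ hτ, hasDerivAt_of_mem hU h₄ hτ⟩

theorem CaseII.deriv_deriv (hU : IsOpen U) (hγ : DifferentiableOn ℂ γ U)
    (h₁ : DifferentiableOn ℂ g₁ U) (h₄ : DifferentiableOn ℂ g₄ U) (h : CaseII U L γ g₁ g₄)
    {τ : ℂ} (hτ : τ ∈ U) :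
    deriv (deriv γ) τ = γ τ * (1 / 2 * γ τ ^ 2 - 288 * g₁ τ * g₄ τ)
      - 288 * (2 * (γ τ * (g₁ τ * g₄ τ)) + 24 * (L * g₄ τ ^ 3 + L⁻¹ * g₁ τ ^ 3)) := by
  obtain ⟨e, e₁, e₄⟩ := h.hasDerivAt hU hγ h₁ h₄ hτ
  refine deriv_deriv_of_mem hU (fun s hs => (h.hasDerivAt hU hγ h₁ h₄ hs).1) hτ
    ((((e.fun_pow 2).const_mul (1 / 2)).fun_sub ((e₁.const_mul 288).fun_mul e₄)).congr_deriv ?_)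
  push_cast
  ring

theorem CaseII.solvesChazy (hU : IsOpen U) (hL : L ≠ 0) (hγ : DifferentiableOn ℂ γ U)
    (h₁ : DifferentiableOn ℂ g₁ U) (h₄ : DifferentiableOn ℂ g₄ U) (h : CaseII U L γ g₁ g₄) :
    SolvesChazy U γ := by
  intro τ hτ
  obtain ⟨e, e₁, e₄⟩ := h.hasDerivAt hU hγ h₁ h₄ hτ
  have e3 := hasDerivAt_unique_of_mem hU (fun s hs => h.deriv_deriv hU hγ h₁ h₄ hs) hτ
    (hasDerivAt_of_mem hU ((hγ.deriv hU).deriv hU) hτ)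
    ((e.fun_mul (((e.fun_pow 2).const_mul (1 / 2)).fun_sub
      ((e₁.const_mul 288).fun_mul e₄))).fun_sub
      ((((e.fun_mul (e₁.fun_mul e₄)).const_mul 2).fun_add
        ((((e₄.fun_pow 3).const_mul L).fun_add ((e₁.fun_pow 3).const_mul L⁻¹)).const_mul
          24)).const_mul 288))
  rw [e3, h.deriv_deriv hU hγ h₁ h₄ hτ, e.deriv]
  field_simp
  ring

/-- The functions `P` and `R` of a solution of the Chazy equation, up to constant factors. -/
theorem SolvesChazy.hasDerivAt (hU : IsOpen U) (hγ : DifferentiableOn ℂ γ U)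
    (h : SolvesChazy U γ) {P R : ℂ → ℂ}
    (hP : ∀ τ, P τ = -(deriv γ τ - 1 / 2 * γ τ ^ 2) / 288)
    (hR : ∀ τ, R τ = -(deriv (deriv γ) τ - 3 * γ τ * deriv γ τ + γ τ ^ 3) / 6912)
    {τ : ℂ} (hτ : τ ∈ U) :
    HasDerivAt P (2 * γ τ * P τ + 24 * R τ) τ ∧
      HasDerivAt R (3 * γ τ * R τ + 144 * P τ ^ 2) τ := by
  have d0 := hasDerivAt_of_mem hU hγ hτ
  have d1 := hasDerivAt_of_mem hU (hγ.deriv hU) hτ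
  have d2 := hasDerivAt_of_mem hU ((hγ.deriv hU).deriv hU) hτ
  have hC := h τ hτ
  have eP : P = fun τ => -(deriv γ τ - 1 / 2 * γ τ ^ 2) / 288 := funext hP
  have eR : R = fun τ => -(deriv (deriv γ) τ - 3 * γ τ * deriv γ τ + γ τ ^ 3) / 6912 :=
    funext hR
  constructor
  · rw [eP, eR]
    refine ((d1.fun_sub ((d0.fun_pow 2).const_mul (1 / 2))).fun_neg.div_const 288).congr_deriv ?_
    push_cast
    ring
  · rw [eP, eR]
    refine (((d2.fun_sub ((d0.const_mul 3).fun_mul d1)).fun_add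
      (d0.fun_pow 3)).fun_neg.div_const 6912).congr_deriv ?_
    push_cast
    linear_combination (-1 / 6912) * hC

/-- For the converse, the derivatives of P = g₁g₄ and R = L⁻¹g₁³ + Lg₄³ are computed once from the
Chazy equation and once by the product rule. The comparison is a homogeneous linear system for the
defects of the equations for g₁' and g₄', with determinant ±(L⁻¹g₁³ − Lg₄³). -/
theorem caseII_iff_chazy (hU : IsOpen U) (hc : IsPreconnected U) (hL : L ≠ 0)
    (hγ : DifferentiableOn ℂ γ U) (h₁ : DifferentiableOn ℂ g₁ U) (h₄ : DifferentiableOn ℂ g₄ U)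
    (hne : ∃ τ ∈ U, NondegenerateII L g₁ g₄ τ) :
    CaseII U L γ g₁ g₄ ↔ SolvesChazy U γ ∧ ∀ τ ∈ U,
      288 * (g₁ τ * g₄ τ) = -(deriv γ τ - 1 / 2 * γ τ ^ 2) ∧
      6912 * (L⁻¹ * g₁ τ ^ 3 + L * g₄ τ ^ 3) =
        -(deriv (deriv γ) τ - 3 * γ τ * deriv γ τ + γ τ ^ 3) := by
  constructor
  · refine fun h => ⟨h.solvesChazy hU hL hγ h₁ h₄, fun τ hτ => ?_⟩
    rw [h.deriv_deriv hU hγ h₁ h₄ hτ, (h τ hτ).1]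
    constructor <;> ring
  · rintro ⟨hC, h⟩
    have hP : ∀ τ ∈ U, g₁ τ * g₄ τ = -(deriv γ τ - 1 / 2 * γ τ ^ 2) / 288 := fun τ hτ => by
      linear_combination 1 / 288 * (h τ hτ).1
    have hR : ∀ τ ∈ U, L⁻¹ * g₁ τ ^ 3 + L * g₄ τ ^ 3 =
        -(deriv (deriv γ) τ - 3 * γ τ * deriv γ τ + γ τ ^ 3) / 6912 := fun τ hτ => by
      linear_combination 1 / 6912 * (h τ hτ).2
    have key : ∀ τ ∈ U,
        g₄ τ * (deriv g₁ τ - γ τ * g₁ τ - 24 * L * g₄ τ ^ 2) +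
          g₁ τ * (deriv g₄ τ - γ τ * g₄ τ - 24 * L⁻¹ * g₁ τ ^ 2) = 0 ∧
        L⁻¹ * g₁ τ ^ 2 * (deriv g₁ τ - γ τ * g₁ τ - 24 * L * g₄ τ ^ 2) +
          L * g₄ τ ^ 2 * (deriv g₄ τ - γ τ * g₄ τ - 24 * L⁻¹ * g₁ τ ^ 2) = 0 := by
      intro τ hτ
      obtain ⟨dP, dR⟩ := hC.hasDerivAt hU hγ (fun _ => rfl) (fun _ => rfl) hτ
      have d₁ := hasDerivAt_of_mem hU h₁ hτ
      have d₄ := hasDerivAt_of_mem hU h₄ hτ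
      have eP := hasDerivAt_unique_of_mem hU hP hτ (d₁.fun_mul d₄) dP
      have eR := hasDerivAt_unique_of_mem hU hR hτ
        (((d₁.fun_pow 3).const_mul L⁻¹).fun_add ((d₄.fun_pow 3).const_mul L)) dR
      rw [← hP τ hτ, ← hR τ hτ] at eP eR
      push_cast at eR
      constructor
      · linear_combination eP
      · linear_combination 1 / 3 * eR + (-48 * g₁ τ ^ 2 * g₄ τ ^ 2) * mul_inv_cancel₀ hL
    have hdet : ∃ τ ∈ U, L⁻¹ * g₁ τ ^ 3 - L * g₄ τ ^ 3 ≠ 0 := by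
      obtain ⟨τ, hτ, h⟩ := hne
      exact ⟨τ, hτ, sub_ne_zero.2 h⟩
    have ddet : DifferentiableOn ℂ (fun τ => L⁻¹ * g₁ τ ^ 3 - L * g₄ τ ^ 3) U :=
      ((h₁.fun_pow 3).const_mul _).fun_sub ((h₄.fun_pow 3).const_mul _)
    -- Cramer's rule: determinant times defect is zero, and the determinant does not vanish
    -- identically.
    have e₁ := eq_zero_of_mul_eq_zero hU hc ddet
      (g := fun τ => deriv g₁ τ - γ τ * g₁ τ - 24 * L * g₄ τ ^ 2)
      (((h₁.deriv hU).fun_sub (hγ.fun_mul h₁)).fun_sub ((h₄.fun_pow 2).const_mul _))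
      (fun τ hτ => by
        linear_combination g₁ τ * (key τ hτ).2 - L * g₄ τ ^ 2 * (key τ hτ).1) hdet
    have e₄ := eq_zero_of_mul_eq_zero hU hc ddet
      (g := fun τ => deriv g₄ τ - γ τ * g₄ τ - 24 * L⁻¹ * g₁ τ ^ 2)
      (((h₄.deriv hU).fun_sub (hγ.fun_mul h₄)).fun_sub ((h₁.fun_pow 2).const_mul _))
      (fun τ hτ => by
        linear_combination L⁻¹ * g₁ τ ^ 2 * (key τ hτ).1 - g₄ τ * (key τ hτ).2) hdet
    refine fun τ hτ => ⟨?_, ?_, ?_⟩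
    · linear_combination (h τ hτ).1
    · linear_combination e₁ τ hτ
    · linear_combination e₄ τ hτ

/-- The construction of `g₁` and `g₄` where `g₄` has no zeros. -/
theorem exists_caseII_aux {V : Set ℂ} (hV : IsOpen V) (hL : L ≠ 0)
    {P X Y : ℂ → ℂ} (hγ : ∀ τ ∈ V, deriv γ τ = 1 / 2 * γ τ ^ 2 - 288 * P τ)
    (hP : ∀ τ ∈ V, HasDerivAt P (2 * γ τ * P τ + 24 * (X τ + Y τ)) τ)
    (hY : ∀ τ ∈ V, HasDerivAt Y (3 * γ τ * Y τ + 72 * P τ ^ 2) τ)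
    (hXY : ∀ τ ∈ V, X τ * Y τ = P τ ^ 3) {τ₀ : ℂ} (hτ₀ : τ₀ ∈ V) (h0 : Y τ₀ ≠ 0) :
    ∃ W ⊆ V, IsOpen W ∧ τ₀ ∈ W ∧ ∃ g₁ g₄ : ℂ → ℂ, DifferentiableOn ℂ g₁ W ∧
      DifferentiableOn ℂ g₄ W ∧ CaseII W L γ g₁ g₄ ∧
      ∀ τ ∈ W, L⁻¹ * g₁ τ ^ 3 = X τ ∧ L * g₄ τ ^ 3 = Y τ := by
  have dY : DifferentiableOn ℂ (fun τ => L⁻¹ * Y τ) V := fun τ hτ =>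
    ((hY τ hτ).differentiableAt.const_mul _).differentiableWithinAt
  obtain ⟨W, hWV, hW, hτW, g, hg, hgY⟩ := exists_local_root hV dY hτ₀
    (mul_ne_zero (inv_ne_zero hL) h0) three_ne_zero
  have hg3 : ∀ τ ∈ W, Y τ = L * g τ ^ 3 := fun τ hτ => by
    rw [(hgY τ hτ).2, mul_inv_cancel_left₀ hL]
  have hX : ∀ τ ∈ W, X τ = L⁻¹ * (P τ / g τ) ^ 3 := fun τ hτ => by
    have h1 := hXY τ (hWV hτ)
    rw [hg3 τ hτ] at h1
    have := (hgY τ hτ).1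
    field_simp
    linear_combination h1
  have hgd : ∀ τ ∈ W, deriv g τ = γ τ * g τ + 24 * L⁻¹ * (P τ / g τ) ^ 2 := fun τ hτ => by
    have h1 := hasDerivAt_unique_of_mem hW hg3 hτ (hY τ (hWV hτ))
      (((hasDerivAt_of_mem hW hg hτ).fun_pow 3).const_mul L)
    rw [hg3 τ hτ] at h1
    have := (hgY τ hτ).1
    push_cast at h1
    field_simp
    linear_combination -1 / 3 * h1
  have hgd' : ∀ τ ∈ W, HasDerivAt (fun τ => P τ / g τ)
      (γ τ * (P τ / g τ) + 24 * L * g τ ^ 2) τ := fun τ hτ => by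
    have h0 := (hgY τ hτ).1
    have h1 := hasDerivAt_of_mem hW hg hτ
    rw [hgd τ hτ] at h1
    refine ((hP τ (hWV hτ)).fun_div h1 h0).congr_deriv ?_
    rw [hX τ hτ, hg3 τ hτ]
    field_simp
    ring
  refine ⟨W, hWV, hW, hτW, fun τ => P τ / g τ, g,
    fun τ hτ => (hgd' τ hτ).differentiableAt.differentiableWithinAt, hg,
    fun τ hτ => ⟨?_, (hgd' τ hτ).deriv, hgd τ hτ⟩, fun τ hτ => ⟨(hX τ hτ).symm, (hg3 τ hτ).symm⟩⟩
  have := (hgY τ hτ).1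
  rw [hγ τ (hWV hτ)]
  field_simp

/-- The symmetry g₁ ↔ g₄, L ↔ L⁻¹ covers the points where the function chosen for Lg₄³ vanishes. -/
theorem CaseII.swap (h : CaseII U L⁻¹ γ g₄ g₁) : CaseII U L γ g₁ g₄ := fun τ hτ => by
  obtain ⟨e, e₄, e₁⟩ := h τ hτ
  refine ⟨by rw [e]; ring, ?_, e₄⟩
  rwa [inv_inv] at e₁

/-- The quantities L⁻¹g₁³ and Lg₄³ must have sum R and product P³. The discriminant R² − 4P³ solves
D' = 6γD, so it has no zeros and a local square root Δ; both roots (R ± Δ)/2 then satisfy the same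
linear equation, and cube roots give g₁ and g₄. -/
theorem exists_caseII_of_chazy (hU : IsOpen U) (hc : IsPreconnected U) (hL : L ≠ 0)
    (hγ : DifferentiableOn ℂ γ U) (hC : SolvesChazy U γ)
    (hne : ∃ τ ∈ U, (-(deriv (deriv γ) τ - 3 * γ τ * deriv γ τ + γ τ ^ 3) / 6912) ^ 2 ≠
      4 * (-(deriv γ τ - 1 / 2 * γ τ ^ 2) / 288) ^ 3) {τ₀ : ℂ} (hτ₀ : τ₀ ∈ U) :
    ∃ V : Set ℂ, IsOpen V ∧ τ₀ ∈ V ∧ V ⊆ U ∧ ∃ g₁ g₄ : ℂ → ℂ,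
      DifferentiableOn ℂ g₁ V ∧ DifferentiableOn ℂ g₄ V ∧ CaseII V L γ g₁ g₄ ∧
      ∀ τ ∈ V, NondegenerateII L g₁ g₄ τ := by
  set P : ℂ → ℂ := fun τ => -(deriv γ τ - 1 / 2 * γ τ ^ 2) / 288 with hP
  set R : ℂ → ℂ := fun τ => -(deriv (deriv γ) τ - 3 * γ τ * deriv γ τ + γ τ ^ 3) / 6912 with hR
  have hd : ∀ τ ∈ U, HasDerivAt P (2 * γ τ * P τ + 24 * R τ) τ ∧
      HasDerivAt R (3 * γ τ * R τ + 144 * P τ ^ 2) τ := fun τ hτ =>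
    hC.hasDerivAt hU hγ (fun _ => rfl) (fun _ => rfl) hτ
  have hγP : ∀ τ ∈ U, deriv γ τ = 1 / 2 * γ τ ^ 2 - 288 * P τ := fun τ _ => by
    simp only [hP]
    ring
  have hD : ∀ τ ∈ U, HasDerivAt (fun τ => R τ ^ 2 - 4 * P τ ^ 3)
      (6 * γ τ * (R τ ^ 2 - 4 * P τ ^ 3)) τ := fun τ hτ => by
    refine (((hd τ hτ).2.fun_pow 2).fun_sub (((hd τ hτ).1.fun_pow 3).const_mul 4)).congr_deriv ?_
    push_cast
    ring
  have hD0 := ne_zero_of_hasDerivAt_mul hU hc (hγ.const_mul 6) hD (by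
    obtain ⟨τ, hτ, h⟩ := hne
    exact ⟨τ, hτ, sub_ne_zero.2 h⟩)
  obtain ⟨V, hVU, hV, hτV, Δ, hΔ, hΔ2⟩ := exists_local_root hU
    (fun τ hτ => (hD τ hτ).differentiableAt.differentiableWithinAt) hτ₀ (hD0 τ₀ hτ₀) two_ne_zero
  have hΔd : ∀ τ ∈ V, HasDerivAt Δ (3 * γ τ * Δ τ) τ := fun τ hτ => by
    have h1 := hasDerivAt_of_mem hV hΔ hτ
    have h2 := hasDerivAt_unique_of_mem hV (fun τ hτ => (hΔ2 τ hτ).2) hτ (h1.fun_pow 2)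
      (hD τ (hVU hτ))
    rw [← (hΔ2 τ hτ).2] at h2
    push_cast at h2
    refine h1.congr_deriv (mul_left_cancel₀ (mul_ne_zero two_ne_zero (hΔ2 τ hτ).1) ?_)
    linear_combination h2
  have hX : ∀ τ ∈ V, HasDerivAt (fun τ => (R τ + Δ τ) / 2)
      (3 * γ τ * ((R τ + Δ τ) / 2) + 72 * P τ ^ 2) τ := fun τ hτ =>
    (((hd τ (hVU hτ)).2.fun_add (hΔd τ hτ)).div_const 2).congr_deriv (by ring)
  have hY : ∀ τ ∈ V, HasDerivAt (fun τ => (R τ - Δ τ) / 2)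
      (3 * γ τ * ((R τ - Δ τ) / 2) + 72 * P τ ^ 2) τ := fun τ hτ =>
    (((hd τ (hVU hτ)).2.fun_sub (hΔd τ hτ)).div_const 2).congr_deriv (by ring)
  have hXY : ∀ τ ∈ V, (R τ + Δ τ) / 2 * ((R τ - Δ τ) / 2) = P τ ^ 3 := fun τ hτ => by
    linear_combination -1 / 4 * (hΔ2 τ hτ).2
  -- The two roots differ by Δ(τ₀) ≠ 0, so at least one is non-zero at τ₀. Its cube root is taken,
  -- and the other function is P divided by it.
  by_cases h0 : (R τ₀ - Δ τ₀) / 2 = 0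
  · have h0' : (R τ₀ + Δ τ₀) / 2 ≠ 0 := fun h => (hΔ2 τ₀ hτV).1 (by linear_combination h - h0)
    obtain ⟨W, hWV, hW, hτW, g₄, g₁, h₄, h₁, hII, hg⟩ := exists_caseII_aux (γ := γ)
      (X := fun τ => (R τ - Δ τ) / 2) (Y := fun τ => (R τ + Δ τ) / 2) hV
      (inv_ne_zero hL) (fun τ hτ => hγP τ (hVU hτ))
      (fun τ hτ => (hd τ (hVU hτ)).1.congr_deriv (by ring)) hX
      (fun τ hτ => by rw [mul_comm, hXY τ hτ]) hτV h0'
    refine ⟨W, hW, hτW, hWV.trans hVU, g₁, g₄, h₁, h₄, hII.swap, fun τ hτ => ?_⟩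
    obtain ⟨e₄, e₁⟩ := hg τ hτ
    rw [inv_inv] at e₄
    rw [NondegenerateII, e₁, e₄]
    exact fun h => (hΔ2 τ (hWV hτ)).1 (by linear_combination h)
  · obtain ⟨W, hWV, hW, hτW, g₁, g₄, h₁, h₄, hII, hg⟩ := exists_caseII_aux (γ := γ)
      (X := fun τ => (R τ + Δ τ) / 2) (Y := fun τ => (R τ - Δ τ) / 2) hV
      hL (fun τ hτ => hγP τ (hVU hτ))
      (fun τ hτ => (hd τ (hVU hτ)).1.congr_deriv (by ring)) hY hXY hτV h0
    refine ⟨W, hW, hτW, hWV.trans hVU, g₁, g₄, h₁, h₄, hII, fun τ hτ => ?_⟩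
    obtain ⟨e₁, e₄⟩ := hg τ hτ
    rw [NondegenerateII, e₁, e₄]
    exact fun h => (hΔ2 τ (hWV hτ)).1 (by linear_combination h)

end Chazy

/-! ## Triangle functions -/

section Triangle

variable {T : Set ℂ} {n m : ℂ} {u y : ℂ → ℂ}

/-- The inverse function theorem, with V and N adjusted so that x maps V into N and the formula for
x' holds on all of V. -/
theorem exists_local_inverse (hT : IsOpen T) (hy : DifferentiableOn ℂ y T)
    (hy' : ∀ t ∈ T, deriv y t ≠ 0) {t₀ : ℂ} (ht₀ : t₀ ∈ T) :
    ∃ (V N : Set ℂ) (x : ℂ → ℂ), IsOpen V ∧ IsOpen N ∧ N ⊆ T ∧ t₀ ∈ N ∧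
      (∀ t ∈ N, y t ∈ V ∧ x (y t) = t) ∧
      ∀ z ∈ V, x z ∈ N ∧ y (x z) = z ∧ HasDerivAt x (deriv y (x z))⁻¹ z := by
  have hs := (hy.analyticAt (hT.mem_nhds ht₀)).hasStrictDerivAt
  have hs' := hs.hasStrictFDerivAt_equiv (hy' t₀ ht₀)
  have hmem := hs'.mem_toOpenPartialHomeomorph_source
  set e := hs'.toOpenPartialHomeomorph y with he
  have hcoe : ⇑e = y := hs'.toOpenPartialHomeomorph_coe
  refine ⟨e.target ∩ e.symm ⁻¹' T, e.source ∩ T, e.symm, e.isOpen_inter_preimage_symm hT,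
    e.open_source.inter hT, inter_subset_right, ⟨hmem, ht₀⟩, fun t ht => ?_, fun z hz => ?_⟩
  · rw [← hcoe]
    have h1 := e.left_inv ht.1
    exact ⟨⟨e.map_source ht.1, by rw [mem_preimage, h1]; exact ht.2⟩, h1⟩
  · refine ⟨⟨e.map_target hz.1, hz.2⟩, by rw [← hcoe]; exact e.right_inv hz.1, ?_⟩
    refine e.hasDerivAt_symm hz.1 (hy' _ hz.2) ?_
    rw [hcoe]
    exact hasDerivAt_of_mem hT hy hz.2

/-- Under the two hypotheses on u, the hypergeometric equation with a = b = (1−n−m)/2 becomes (d/dt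
− u)² f = 0 in the variable t. Hence φ and tφ with φ' = uφ, transported by the local inverse x of y,
are two solutions whose ratio at y(t) is t. -/
theorem isTriangleFunction_of_bureauFormula (hT : IsOpen T) (hy : DifferentiableOn ℂ y T)
    (hu : DifferentiableOn ℂ u T)
    (h0 : ∀ t ∈ T, y t ≠ 0 ∧ y t ≠ 1 ∧ deriv y t ≠ 0) (hB : ∀ t ∈ T, BureauFormula n m u y t)
    (hS : ∀ t ∈ T, (deriv u t - u t ^ 2) * (y t * (1 - y t)) =
      ((1 - n - m) / 2) ^ 2 * deriv y t ^ 2) : IsTriangleFunction n m 0 T y := by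
  refine ⟨hy, fun t₀ ht₀ => ⟨(h0 t₀ ht₀).1, (h0 t₀ ht₀).2.1, ?_⟩⟩
  obtain ⟨T', hT'T, hT', -, ht₀', φ, -, hφ⟩ := exists_local_exp hT hu ht₀
  obtain ⟨V, N, x, hV, hN, hNT, ht₀N, hyx, hxy⟩ := exists_local_inverse hT' (hy.mono hT'T)
    (fun t ht => (h0 t (hT'T ht)).2.2) ht₀'
  have hd₂ : ∀ z ∈ V, HasDerivAt (fun z => φ (x z))
      (u (x z) * φ (x z) / deriv y (x z)) z := fun z hz => by
    obtain ⟨h1, h2, h3⟩ := hxy z hz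
    exact ((hφ (x z) (hNT h1)).2.comp z h3).congr_deriv (by rw [div_eq_mul_inv])
  have hd₁ : ∀ z ∈ V, HasDerivAt (fun z => x z * φ (x z))
      ((φ (x z) + x z * (u (x z) * φ (x z))) / deriv y (x z)) z := fun z hz =>
    ((hxy z hz).2.2.fun_mul (hd₂ z hz)).congr_deriv (by ring)
  have hyd : ∀ z ∈ V, HasDerivAt (fun z => deriv y (x z))
      (deriv (deriv y) (x z) / deriv y (x z)) z := fun z hz => by
    obtain ⟨h1, h2, h3⟩ := hxy z hz
    exact ((hasDerivAt_of_mem hT (hy.deriv hT) (hT'T (hNT h1))).comp z h3).congr_deriv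
      (by rw [div_eq_mul_inv])
  have hud : ∀ z ∈ V, HasDerivAt (fun z => u (x z))
      (deriv u (x z) / deriv y (x z)) z := fun z hz => by
    obtain ⟨h1, h2, h3⟩ := hxy z hz
    exact ((hasDerivAt_of_mem hT hu (hT'T (hNT h1))).comp z h3).congr_deriv
      (by rw [div_eq_mul_inv])
  have hyy : ∀ z ∈ V, z ≠ 0 ∧ z ≠ 1 ∧ deriv y (x z) ≠ 0 ∧
      deriv (deriv y) (x z) = deriv y (x z) * (2 * u (x z) +
        ((1 - n) / z + (1 - m) / (z - 1)) * deriv y (x z)) ∧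
      (deriv u (x z) - u (x z) ^ 2) * (z * (1 - z)) =
        ((1 - n - m) / 2) ^ 2 * deriv y (x z) ^ 2 := fun z hz => by
    obtain ⟨h1, h2, h3⟩ := hxy z hz
    have h4 := hT'T (hNT h1)
    obtain ⟨h5, h6, h7⟩ := h0 _ h4
    have h8 := hB _ h4
    have h9 := hS _ h4
    rw [BureauFormula] at h8
    rw [h2] at h5 h6 h8 h9
    refine ⟨h5, h6, h7, ?_, h9⟩
    rw [h8]
    field_simp
    ring
  -- The Wronskian of the pair is −φ²/y', which is non-zero; φ is an exponential and so has no
  -- zeros, as needed for the denominator.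
  refine ⟨V, N, fun z => x z * φ (x z), fun z => φ (x z), hV, hN, (hyx t₀ ht₀N).1, ht₀N,
    ⟨fun z hz => (hd₁ z hz).differentiableAt.differentiableWithinAt, fun z hz => ?_⟩,
    ⟨fun z hz => (hd₂ z hz).differentiableAt.differentiableWithinAt, fun z hz => ?_⟩,
    fun z hz => ?_, fun t ht => ?_⟩
  · obtain ⟨k0, k1, k2, k3, k4⟩ := hyy z hz
    have k1' : z - 1 ≠ 0 := sub_ne_zero.2 k1
    rw [(hd₁ z hz).deriv, deriv_deriv_of_mem hV hd₁ hz (((hd₂ z hz).fun_add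
      ((hxy z hz).2.2.fun_mul ((hud z hz).fun_mul (hd₂ z hz)))).fun_div (hyd z hz) k2), k3]
    field_simp
    linear_combination 4 * φ (x z) * x z * (z - 1) * k4
  · obtain ⟨k0, k1, k2, k3, k4⟩ := hyy z hz
    have k1' : z - 1 ≠ 0 := sub_ne_zero.2 k1
    rw [(hd₂ z hz).deriv, deriv_deriv_of_mem hV hd₂ hz
      (((hud z hz).fun_mul (hd₂ z hz)).fun_div (hyd z hz) k2), k3]
    field_simp
    linear_combination 4 * φ (x z) * (z - 1) * k4
  · obtain ⟨k0, k1, k2, -⟩ := hyy z hz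
    have h3 := (hφ (x z) (hNT (hxy z hz).1)).1
    refine ⟨?_, h3⟩
    rw [(hd₁ z hz).deriv, (hd₂ z hz).deriv]
    have : x z * φ (x z) * (u (x z) * φ (x z) / deriv y (x z)) -
      (φ (x z) + x z * (u (x z) * φ (x z))) / deriv y (x z) * φ (x z) =
      -(φ (x z) ^ 2 / deriv y (x z)) := by ring
    rw [this]
    exact neg_ne_zero.2 (div_ne_zero (pow_ne_zero 2 h3) k2)
  · obtain ⟨h1, h2⟩ := hyx t ht
    refine ⟨h1, ?_⟩
    simp only [h2]
    exact mul_div_cancel_right₀ _ (hφ t (hNT ht)).1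

/-- The relation w₁(y) = t w₂(y) is differentiated repeatedly. This identifies u as the logarithmic
derivative of w₂(y(t)), and the hypergeometric equation for w₂ then becomes an equation for u. -/
theorem bureauFormula_of_isTriangleFunction (hT : IsOpen T) (hu : DifferentiableOn ℂ u T)
    (hy : IsTriangleFunction n m 0 T y) (hB : ∀ t ∈ T, BureauFormula n m u y t)
    {t : ℂ} (ht : t ∈ T) : deriv y t ≠ 0 ∧
      (deriv u t - u t ^ 2) * (y t * (1 - y t)) = ((1 - n - m) / 2) ^ 2 * deriv y t ^ 2 := by
  obtain ⟨hyd, h⟩ := hy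
  obtain ⟨h0, h1, V, N, w₁, w₂, hV, hN, hyV, htN, ⟨hw₁, e₁⟩, ⟨hw₂, e₂⟩, hW, hyN⟩ := h t ht
  set M := N ∩ T with hM
  have hMo : IsOpen M := hN.inter hT
  have hydd : ∀ s ∈ M, HasDerivAt y (deriv y s) s := fun s hs => hasDerivAt_of_mem hT hyd hs.2
  have hyddd : ∀ s ∈ M, HasDerivAt (deriv y) (deriv (deriv y) s) s := fun s hs =>
    hasDerivAt_of_mem hT (hyd.deriv hT) hs.2
  have hcomp : ∀ {w : ℂ → ℂ}, DifferentiableOn ℂ w V → ∀ s ∈ M,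
      HasDerivAt (fun s => w (y s)) (deriv w (y s) * deriv y s) s := fun hw s hs =>
    (hasDerivAt_of_mem hV hw (hyN s hs.1).1).comp s (hydd s hs)
  have hrel : ∀ s ∈ M, w₁ (y s) = s * w₂ (y s) := fun s hs => by
    obtain ⟨hs1, hs2⟩ := hyN s hs.1
    rw [div_eq_iff (hW _ hs1).2] at hs2
    exact hs2
  -- One differentiation: y' times the Wronskian is −w₂². As w₂ has no zeros, neither has y'.
  have hrel1 : ∀ s ∈ M, deriv y s * (w₁ (y s) * deriv w₂ (y s) - deriv w₁ (y s) * w₂ (y s)) =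
      -(w₂ (y s)) ^ 2 := fun s hs => by
    have := hasDerivAt_unique_of_mem hMo hrel hs (hcomp hw₁ s hs)
      ((hasDerivAt_id s).fun_mul (hcomp hw₂ s hs))
    simp only [id] at this
    linear_combination deriv w₂ (y s) * deriv y s * hrel s hs - w₂ (y s) * this
  have hne : ∀ s ∈ M, deriv y s ≠ 0 := fun s hs h => by
    have := hrel1 s hs
    rw [h, zero_mul, eq_comm, neg_eq_zero] at this
    exact (hW _ (hyN s hs.1).1).2 (pow_eq_zero_iff two_ne_zero |>.1 this)
  have hrel2 : ∀ s ∈ M, u s * w₂ (y s) = deriv y s * deriv w₂ (y s) := fun s hs => by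
    have hyV' := (hyN s hs.1).1
    have d2 := hasDerivAt_unique_of_mem hMo hrel1 hs ((hyddd s hs).fun_mul
      (((hcomp hw₁ s hs).fun_mul (hcomp (hw₂.deriv hV) s hs)).fun_sub
        ((hcomp (hw₁.deriv hV) s hs).fun_mul (hcomp hw₂ s hs))))
      ((hcomp hw₂ s hs).fun_pow 2).fun_neg
    have r1 := hrel1 s hs
    have E₁ := e₁ _ hyV'
    have E₂ := e₂ _ hyV'
    have b := hB s hs.2
    obtain ⟨y0, y1, -⟩ := h s hs.2
    have y1' : y s - 1 ≠ 0 := sub_ne_zero.2 y1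
    have y2' : 1 - y s ≠ 0 := sub_ne_zero.2 y1.symm
    have hn := hne s hs
    have w0 := (hW _ hyV').2
    rw [BureauFormula] at b
    rw [b]
    set Y := deriv y s
    set W := w₁ (y s) * deriv w₂ (y s) - deriv w₁ (y s) * w₂ (y s) with hWd
    -- Abel's identity for the derivative of the Wronskian, from the two hypergeometric equations.
    -- It removes the second derivatives of w₁ and w₂.
    have dW : y s * (1 - y s) * (w₁ (y s) * deriv (deriv w₂) (y s)
        - deriv (deriv w₁) (y s) * w₂ (y s)) = -((1 - n) - (2 - n - m) * y s) * W := by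
      rw [hWd]
      linear_combination w₁ (y s) * E₂ - w₂ (y s) * E₁
    push_cast at d2
    have d3 : deriv (deriv y) s * W + Y ^ 2 * (w₁ (y s) * deriv (deriv w₂) (y s)
        - deriv (deriv w₁) (y s) * w₂ (y s)) = -2 * w₂ (y s) * deriv w₂ (y s) * Y := by
      rw [hWd]
      linear_combination d2
    have d4 : deriv (deriv y) s * W * (y s * (1 - y s)) =
        Y ^ 2 * ((1 - n) - (2 - n - m) * y s) * W
          - 2 * w₂ (y s) * deriv w₂ (y s) * Y * (y s * (1 - y s)) := by
      linear_combination y s * (1 - y s) * d3 - Y ^ 2 * dW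
    have hW0 : W ≠ 0 := (hW _ hyV').1
    clear_value W
    have d5 : deriv (deriv y) s / Y - ((1 - n) / y s + (1 - m) / (y s - 1)) * Y =
        2 * (Y * deriv w₂ (y s) / w₂ (y s)) := by
      have : w₂ (y s) ^ 2 = -(Y * W) := by linear_combination r1
      refine mul_right_cancel₀ (mul_ne_zero hW0 (mul_ne_zero y0 y2')) ?_
      have e : ((1 - n) / y s + (1 - m) / (y s - 1)) * (y s * (1 - y s)) =
          (1 - n) - (2 - n - m) * y s := by
        field_simp
        ring
      have e' : deriv (deriv y) s / Y * (W * (y s * (1 - y s))) =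
          Y * ((1 - n) - (2 - n - m) * y s) * W
            - 2 * w₂ (y s) * deriv w₂ (y s) * (y s * (1 - y s)) := by
        rw [div_mul_eq_mul_div, div_eq_iff hn]
        linear_combination d4
      rw [sub_mul, e']
      have e'' : 2 * (Y * deriv w₂ (y s) / w₂ (y s)) * (W * (y s * (1 - y s))) =
          -2 * w₂ (y s) * deriv w₂ (y s) * (y s * (1 - y s)) := by
        field_simp
        linear_combination deriv w₂ (y s) * this
      rw [e'']
      linear_combination -Y * W * e
    rw [d5]
    field_simp
  have htM : t ∈ M := ⟨htN, ht⟩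
  refine ⟨hne t htM, ?_⟩
  -- Differentiating u w₂(y) = y' w₂'(y) and replacing y'' by Bureau's formula and w₂'' by the
  -- hypergeometric equation leaves the claim multiplied by w₂(y).
  have d := hasDerivAt_unique_of_mem hMo hrel2 htM
    ((hasDerivAt_of_mem hT hu ht).fun_mul (hcomp hw₂ t htM))
    ((hyddd t htM).fun_mul (hcomp (hw₂.deriv hV) t htM))
  have r := hrel2 t htM
  have E₂ := e₂ _ hyV
  have b := hB t ht
  have y1' : y t - 1 ≠ 0 := sub_ne_zero.2 h1
  have hn := hne t htM
  have w0 := (hW _ hyV).2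
  rw [BureauFormula] at b
  have hdd : deriv (deriv y) t * (y t * (1 - y t)) = deriv y t * (2 * u t * (y t * (1 - y t)) +
      ((1 - n) - (2 - n - m) * y t) * deriv y t) := by
    rw [b]
    field_simp
    ring
  refine mul_right_cancel₀ w0 ?_
  linear_combination (y t * (1 - y t)) * d + deriv w₂ (y t) * hdd + deriv y t ^ 2 * E₂ -
    u t * (y t * (1 - y t)) * r

end Triangle

/-! ### Cases I and III in terms of triangle functions -/

section TriangleSolutions

/-- The logarithmic derivatives A of y and q of y − 1, together with u, form a closed quadratic
system. The later verifications are polynomial identities in u, A, q. -/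
theorem hasDerivAt_of_isTriangleFunction {T : Set ℂ} {n m : ℂ} {u y : ℂ → ℂ} (hT : IsOpen T)
    (hu : DifferentiableOn ℂ u T) (hy : IsTriangleFunction n m 0 T y)
    (hB : ∀ t ∈ T, BureauFormula n m u y t) {A q : ℂ → ℂ} (hA : ∀ t, A t = deriv y t / y t)
    (hq : ∀ t, q t = deriv y t / (y t - 1)) {t : ℂ} (ht : t ∈ T) :
    (A t ≠ 0 ∧ q t ≠ 0 ∧ q t - A t ≠ 0) ∧
      HasDerivAt u (u t ^ 2 - ((1 - n - m) / 2) ^ 2 * (A t * q t)) t ∧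
      HasDerivAt A (2 * u t * A t + (1 - m) * (A t * q t) - n * A t ^ 2) t ∧
      HasDerivAt q (2 * u t * q t + (1 - n) * (A t * q t) - m * q t ^ 2) t := by
  obtain ⟨hne, hS⟩ := bureauFormula_of_isTriangleFunction hT hu hy hB ht
  obtain ⟨h0, h1, -⟩ := hy.2 t ht
  have h1' : y t - 1 ≠ 0 := sub_ne_zero.2 h1
  have d1 := hasDerivAt_of_mem hT hy.1 ht
  have d2 := hasDerivAt_of_mem hT (hy.1.deriv hT) ht
  have eA : A = fun t => deriv y t / y t := funext hA
  have eq : q = fun t => deriv y t / (y t - 1) := funext hq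
  have hdd : deriv (deriv y) t = deriv y t * (2 * u t + (1 - n) * A t + (1 - m) * q t) := by
    rw [hB t ht, hA, hq]
    field_simp
    ring
  refine ⟨⟨?_, ?_, ?_⟩, ?_, ?_, ?_⟩
  · rw [hA]
    exact div_ne_zero hne h0
  · rw [hq]
    exact div_ne_zero hne h1'
  · have : q t - A t = deriv y t / (y t * (y t - 1)) := by
      rw [hA, hq]
      field_simp
      ring
    rw [this]
    exact div_ne_zero hne (mul_ne_zero h0 h1')
  · refine (hasDerivAt_of_mem hT hu ht).congr_deriv ?_
    rw [hA, hq]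
    field_simp
    linear_combination -4 * hS
  · rw [eA]
    refine (d2.fun_div d1 h0).congr_deriv ?_
    rw [hdd, hA, hq]
    field_simp
    ring
  · rw [eq]
    refine (d2.fun_div (d1.sub_const 1) h1').congr_deriv ?_
    rw [hdd, hA, hq]
    field_simp
    ring

variable {U : Set ℂ} {γ g₁ y : ℂ → ℂ}

/-- The logarithmic derivative of Aq is 4u + (1−2m)q + (1−2n)A. Here n = 1/2 removes A and m = 1/4
leaves 4u + ½q, half of which belongs to g₁. -/
theorem TriangleSolutionI.hasDerivAt {μ : ℂ} (hU : IsOpen U) (hμ : μ ≠ 0)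
    (hγ : DifferentiableOn ℂ γ U) (hg : DifferentiableOn ℂ g₁ U)
    (h : TriangleSolutionI μ (halfDomain U) (rescale γ) (rescale g₁) y) {A q : ℂ → ℂ}
    (hA : ∀ t, A t = deriv y t / y t) (hq : ∀ t, q t = deriv y t / (y t - 1)) {t : ℂ}
    (ht : t ∈ halfDomain U) :
    36864 * μ * rescale g₁ t ^ 2 = A t * q t ∧ rescale g₁ t ≠ 0 ∧
      HasDerivAt (rescale g₁) (rescale g₁ t * (2 * rescale γ t + 1 / 4 * q t)) t := by
  obtain ⟨hy, hB, s, -, hs⟩ := h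
  have hT := isOpen_halfDomain hU
  have hrel : ∀ t ∈ halfDomain U, 36864 * μ * rescale g₁ t ^ 2 = A t * q t := fun t ht => by
    obtain ⟨h0, h1, -⟩ := hy.2 t ht
    have h1' : y t - 1 ≠ 0 := sub_ne_zero.2 h1
    obtain ⟨hs1, hs2⟩ := hs t ht
    rw [hs2, mul_pow, div_pow, div_pow, hs1, hA, hq]
    field_simp
    norm_num
  obtain ⟨⟨hA0, hq0, -⟩, -, dA, dq⟩ :=
    hasDerivAt_of_isTriangleFunction hT (differentiableOn_rescale hγ) hy hB hA hq ht
  have hr := hrel t ht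
  have hG : rescale g₁ t ≠ 0 := fun h => by
    rw [h] at hr
    exact mul_ne_zero hA0 hq0 (by rw [← hr]; ring)
  refine ⟨hr, hG, ?_⟩
  have dG := hasDerivAt_of_mem hT (differentiableOn_rescale hg) ht
  have := hasDerivAt_unique_of_mem hT hrel ht ((dG.fun_pow 2).const_mul (36864 * μ))
    (dA.fun_mul dq)
  push_cast at this
  refine dG.congr_deriv (mul_left_cancel₀ (mul_ne_zero hμ hG) ?_)
  linear_combination 1 / 73728 * this -
    (4 * rescale γ t + 1 / 2 * q t) / 73728 * hr

theorem caseI_of_triangleSolutionI {μ : ℂ} (hU : IsOpen U) (hne : U.Nonempty) (hμ : μ ≠ 0)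
    (hγ : DifferentiableOn ℂ γ U) (hg : DifferentiableOn ℂ g₁ U)
    (h : TriangleSolutionI μ (halfDomain U) (rescale γ) (rescale g₁) y) :
    CaseI U μ γ g₁ ∧ ∃ τ ∈ U, NondegenerateI μ γ g₁ τ := by
  set A : ℂ → ℂ := fun t => deriv y t / y t with hA
  set q : ℂ → ℂ := fun t => deriv y t / (y t - 1) with hq
  have hT := isOpen_halfDomain hU
  have key := fun {t : ℂ} (ht : t ∈ halfDomain U) =>
    h.hasDerivAt hU hμ hγ hg (A := A) (q := q) (fun _ => rfl) (fun _ => rfl) ht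
  have hdt := fun {t : ℂ} (ht : t ∈ halfDomain U) =>
    hasDerivAt_of_isTriangleFunction hT (differentiableOn_rescale hγ) h.1 h.2.1
      (A := A) (q := q) (fun _ => rfl) (fun _ => rfl) ht
  have hg' : ∀ t ∈ halfDomain U, rescale (deriv g₁) t =
      rescale g₁ t * (rescale γ t + 1 / 8 * q t) := fun t ht => by
    have := (hasDerivAt_rescale hU hg ht).unique (key ht).2.2
    simp only [rescale] at this ⊢
    linear_combination 1 / 2 * this
  constructor
  · refine forall_halfDomain.1 fun t ht => ?_
    obtain ⟨hr, hG, dG⟩ := key ht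
    obtain ⟨-, du, -, dq⟩ := hdt ht
    have e1 := (hasDerivAt_rescale hU hγ ht).unique du
    have e2 := hasDerivAt_unique_of_mem hT hg' ht (hasDerivAt_rescale hU (hg.deriv hU) ht)
      (dG.fun_mul (du.fun_add (dq.const_mul (1 / 8))))
    have e3 := hg' t ht
    simp only [rescale] at hr e1 e2 e3
    have e4 : deriv γ (2 * t) = 1 / 2 * γ (2 * t) ^ 2 - 288 * μ * g₁ (2 * t) ^ 2 := by
      linear_combination 1 / 2 * e1 + 1 / 128 * hr
    refine ⟨e4, ?_⟩
    rw [e3, e4]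
    linear_combination 1 / 2 * e2 - 3 / 128 * g₁ (2 * t) * hr
  · obtain ⟨τ, hτ⟩ := hne
    obtain ⟨t, ht, rfl⟩ : ∃ t ∈ halfDomain U, 2 * t = τ :=
      ⟨τ / 2, by simpa [halfDomain, mul_div_cancel₀] using hτ, by simp [mul_div_cancel₀]⟩
    refine ⟨2 * t, hτ, ?_⟩
    obtain ⟨hr, hG, -⟩ := key ht
    obtain ⟨⟨-, hq0, hqA⟩, -⟩ := hdt ht
    have e3 := hg' t ht
    simp only [rescale] at e3 hr hG
    rw [NondegenerateI, ← sub_ne_zero, e3]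
    -- The non-degeneracy quantity becomes g₁²q(q − A)/64, and q − A = y'/(y(y−1)) has no zeros.
    have : (g₁ (2 * t) * (γ (2 * t) + 1 / 8 * q t) - γ (2 * t) * g₁ (2 * t)) ^ 2 -
        576 * μ * g₁ (2 * t) ^ 4 = 1 / 64 * (g₁ (2 * t) ^ 2 * (q t * (q t - A t))) := by
      linear_combination -1 / 64 * g₁ (2 * t) ^ 2 * hr
    rw [this]
    exact mul_ne_zero (by norm_num) (mul_ne_zero (pow_ne_zero 2 hG) (mul_ne_zero hq0 hqA))

/-- As in case I, with m = 1/6: the logarithmic derivative of Aq is 4u + (2/3)q, and g₁ takes a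
quarter of it. -/
theorem TriangleSolutionIII.hasDerivAt {K : ℂ} (hU : IsOpen U) (hK : K ≠ 0)
    (hγ : DifferentiableOn ℂ γ U) (hg : DifferentiableOn ℂ g₁ U)
    (h : TriangleSolutionIII K (halfDomain U) (rescale γ) (rescale g₁) y) {A q : ℂ → ℂ}
    (hA : ∀ t, A t = deriv y t / y t) (hq : ∀ t, q t = deriv y t / (y t - 1)) {t : ℂ}
    (ht : t ∈ halfDomain U) :
    5184 * K * rescale g₁ t ^ 4 = A t * q t ∧ rescale g₁ t ≠ 0 ∧
      HasDerivAt (rescale g₁) (rescale g₁ t * (rescale γ t + 1 / 6 * q t)) t := by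
  obtain ⟨hy, hB, hs⟩ := h
  have hT := isOpen_halfDomain hU
  have hrel : ∀ t ∈ halfDomain U, 5184 * K * rescale g₁ t ^ 4 = A t * q t := fun t ht => by
    obtain ⟨h0, h1, -⟩ := hy.2 t ht
    have h1' : y t - 1 ≠ 0 := sub_ne_zero.2 h1
    rw [hs t ht, hA, hq]
    field_simp
  obtain ⟨⟨hA0, hq0, -⟩, -, dA, dq⟩ :=
    hasDerivAt_of_isTriangleFunction hT (differentiableOn_rescale hγ) hy hB hA hq ht
  have hr := hrel t ht
  have hG : rescale g₁ t ≠ 0 := fun h => by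
    rw [h] at hr
    exact mul_ne_zero hA0 hq0 (by rw [← hr]; ring)
  refine ⟨hr, hG, ?_⟩
  have dG := hasDerivAt_of_mem hT (differentiableOn_rescale hg) ht
  have := hasDerivAt_unique_of_mem hT hrel ht ((dG.fun_pow 4).const_mul (5184 * K))
    (dA.fun_mul dq)
  push_cast at this
  refine dG.congr_deriv (mul_left_cancel₀ (mul_ne_zero hK (pow_ne_zero 3 hG)) ?_)
  linear_combination 1 / 20736 * this -
    (4 * rescale γ t + 2 / 3 * q t) / 20736 * hr

theorem TriangleSolutionIII.rescale_deriv {K : ℂ} (hU : IsOpen U) (hK : K ≠ 0)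
    (hγ : DifferentiableOn ℂ γ U) (hg : DifferentiableOn ℂ g₁ U)
    (h : TriangleSolutionIII K (halfDomain U) (rescale γ) (rescale g₁) y) {t : ℂ}
    (ht : t ∈ halfDomain U) : rescale (deriv g₁) t =
      rescale g₁ t * (1 / 2 * rescale γ t + 1 / 12 * (deriv y t / (y t - 1))) := by
  have := (hasDerivAt_rescale hU hg ht).unique
    (h.hasDerivAt hU hK hγ hg (fun _ => rfl) (fun _ => rfl) ht).2.2
  simp only [rescale] at this ⊢
  linear_combination 1 / 2 * this

theorem caseIII_of_triangleSolutionIII {K : ℂ} (hU : IsOpen U) (hne : U.Nonempty) (hK : K ≠ 0)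
    (hγ : DifferentiableOn ℂ γ U) (hg : DifferentiableOn ℂ g₁ U)
    (h : TriangleSolutionIII K (halfDomain U) (rescale γ) (rescale g₁) y) :
    CaseIII U K γ g₁ ∧ ∃ τ ∈ U, NondegenerateIII K γ g₁ τ := by
  set A : ℂ → ℂ := fun t => deriv y t / y t with hA
  set q : ℂ → ℂ := fun t => deriv y t / (y t - 1) with hq
  have hT := isOpen_halfDomain hU
  have key := fun {t : ℂ} (ht : t ∈ halfDomain U) =>
    h.hasDerivAt hU hK hγ hg (A := A) (q := q) (fun _ => rfl) (fun _ => rfl) ht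
  have hdt := fun {t : ℂ} (ht : t ∈ halfDomain U) =>
    hasDerivAt_of_isTriangleFunction hT (differentiableOn_rescale hγ) h.1 h.2.1
      (A := A) (q := q) (fun _ => rfl) (fun _ => rfl) ht
  have hg' : ∀ t ∈ halfDomain U, rescale (deriv g₁) t =
      rescale g₁ t * (1 / 2 * rescale γ t + 1 / 12 * q t) := fun t ht =>
    h.rescale_deriv hU hK hγ hg ht
  constructor
  · refine forall_halfDomain.1 fun t ht => ?_
    obtain ⟨hr, hG, dG⟩ := key ht
    obtain ⟨-, du, -, dq⟩ := hdt ht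
    have e1 := (hasDerivAt_rescale hU hγ ht).unique du
    have e2 := hasDerivAt_unique_of_mem hT hg' ht (hasDerivAt_rescale hU (hg.deriv hU) ht)
      (dG.fun_mul ((du.const_mul (1 / 2)).fun_add (dq.const_mul (1 / 12))))
    have e3 := hg' t ht
    simp only [rescale] at hr e1 e2 e3
    have e4 : deriv γ (2 * t) = 1 / 2 * γ (2 * t) ^ 2 - 72 * K * g₁ (2 * t) ^ 4 := by
      linear_combination 1 / 2 * e1 + 1 / 72 * hr
    refine ⟨e4, ?_⟩
    rw [e3, e4]
    linear_combination 1 / 2 * e2 - 1 / 72 * g₁ (2 * t) * hr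
  · obtain ⟨τ, hτ⟩ := hne
    obtain ⟨t, ht, rfl⟩ : ∃ t ∈ halfDomain U, 2 * t = τ :=
      ⟨τ / 2, by simpa [halfDomain, mul_div_cancel₀] using hτ, by simp [mul_div_cancel₀]⟩
    refine ⟨2 * t, hτ, ?_⟩
    obtain ⟨hr, hG, -⟩ := key ht
    obtain ⟨⟨-, hq0, hqA⟩, -⟩ := hdt ht
    have e3 := hg' t ht
    simp only [rescale] at e3 hr hG
    rw [NondegenerateIII, ← sub_ne_zero, e3]
    have : (g₁ (2 * t) * (1 / 2 * γ (2 * t) + 1 / 12 * q t) - 1 / 2 * γ (2 * t) * g₁ (2 * t)) ^ 2 -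
        36 * K * g₁ (2 * t) ^ 6 = 1 / 144 * (g₁ (2 * t) ^ 2 * (q t * (q t - A t))) := by
      linear_combination -1 / 144 * g₁ (2 * t) ^ 2 * hr
    rw [this]
    exact mul_ne_zero (by norm_num) (mul_ne_zero (pow_ne_zero 2 hG) (mul_ne_zero hq0 hqA))

theorem dependentIII_of_triangleSolutionIII {K : ℂ} {g₃ g₄ : ℂ → ℂ} (hU : IsOpen U) (hK : K ≠ 0)
    (hγ : DifferentiableOn ℂ γ U) (hg : DifferentiableOn ℂ g₁ U)
    (hD : DependentIII U K γ g₁ g₃ g₄)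
    (h : TriangleSolutionIII K (halfDomain U) (rescale γ) (rescale g₁) y) {t : ℂ}
    (ht : t ∈ halfDomain U) :
    rescale g₃ t ^ 4 = K / 5184 ^ 3 * (deriv y t ^ 6 / (y t ^ 3 * (y t - 1) ^ 3)) ∧
      rescale g₄ t ^ 2 = K / 25920 ^ 2 * (deriv y t ^ 4 / (y t * (y t - 1) ^ 3)) ∧
      rescale g₄ t = K / 360 * (rescale g₁ t ^ 2 * deriv y t / (y t - 1)) := by
  obtain ⟨h3, h4⟩ := hD _ ht
  have e := h.rescale_deriv hU hK hγ hg ht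
  have e4 := h.2.2 t ht
  obtain ⟨h0, h1, -⟩ := h.1.2 t ht
  have h1' : y t - 1 ≠ 0 := sub_ne_zero.2 h1
  simp only [rescale] at e e4 ⊢
  have e5 : g₄ (2 * t) = K / 360 * (g₁ (2 * t) ^ 2 * deriv y t / (y t - 1)) := by
    rw [h4, e]
    ring
  refine ⟨?_, ?_, e5⟩
  · have : (K * g₁ (2 * t) ^ 3) ^ 4 = K ^ 4 * (g₁ (2 * t) ^ 4) ^ 3 := by ring
    rw [h3, this, e4]
    field_simp
  · have : (K / 360 * (g₁ (2 * t) ^ 2 * deriv y t / (y t - 1))) ^ 2 =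
      K ^ 2 / 360 ^ 2 * (g₁ (2 * t) ^ 4 * deriv y t ^ 2 / (y t - 1) ^ 2) := by
      field_simp
    rw [e5, this, e4]
    field_simp
    norm_num
    ring

/-- The formulas of the converse determine y: they give g₁' − γg₁ = g₁q/8, so that with A = g₁' −
γg₁ and N = A² − 576μg₁⁴ one finds A²/N = q/(q − y'/y) = y. Since N has no zeros, this y is
holomorphic everywhere; it equals 0 at the zeros of A and 1 at those of g₁. -/
theorem exists_triangleSolutionI {μ : ℂ} (hU : IsOpen U) (hc : IsPreconnected U) (hμ : μ ≠ 0)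
    (hγ : DifferentiableOn ℂ γ U) (hg : DifferentiableOn ℂ g₁ U) (h : CaseI U μ γ g₁)
    (hN : ∃ τ ∈ U, NondegenerateI μ γ g₁ τ) :
    ∃ y : ℂ → ℂ, DifferentiableOn ℂ y (halfDomain U) ∧
      halfDomain U ⊆ closure {t | t ∈ halfDomain U ∧ y t ≠ 0 ∧ y t ≠ 1} ∧
      TriangleSolutionI μ {t | t ∈ halfDomain U ∧ y t ≠ 0 ∧ y t ≠ 1}
        (rescale γ) (rescale g₁) y := by
  set A : ℂ → ℂ := fun τ => deriv g₁ τ - γ τ * g₁ τ with hA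
  set N : ℂ → ℂ := fun τ => A τ ^ 2 - 576 * μ * g₁ τ ^ 4 with hNd
  have dγ : ∀ τ ∈ U, HasDerivAt γ (1 / 2 * γ τ ^ 2 - 288 * μ * g₁ τ ^ 2) τ := fun τ hτ => by
    rw [← (h τ hτ).1]; exact hasDerivAt_of_mem hU hγ hτ
  have dg : ∀ τ ∈ U, HasDerivAt g₁ (A τ + γ τ * g₁ τ) τ := fun τ hτ =>
    (hasDerivAt_of_mem hU hg hτ).congr_deriv (by simp only [hA]; ring)
  have dA : ∀ τ ∈ U, HasDerivAt A (2 * γ τ * A τ + 1152 * μ * g₁ τ ^ 3) τ := fun τ hτ => by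
    refine ((hasDerivAt_of_mem hU (hg.deriv hU) hτ).fun_sub
      ((dγ τ hτ).fun_mul (hasDerivAt_of_mem hU hg hτ))).congr_deriv ?_
    rw [(h τ hτ).2, (h τ hτ).1]
    simp only [hA]
    ring
  have dN : ∀ τ ∈ U, HasDerivAt N (4 * γ τ * N τ) τ := fun τ hτ => by
    refine (((dA τ hτ).fun_pow 2).fun_sub
      (((dg τ hτ).fun_pow 4).const_mul (576 * μ))).congr_deriv ?_
    push_cast
    simp only [hNd]
    ring
  -- N' = 4γN, so N has no zeros once it is non-zero somewhere.
  have hN0 : ∀ τ ∈ U, N τ ≠ 0 := ne_zero_of_hasDerivAt_mul hU hc (hγ.const_mul 4) dN (by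
    obtain ⟨τ, hτ, h⟩ := hN
    exact ⟨τ, hτ, sub_ne_zero.2 h⟩)
  have DA : DifferentiableOn ℂ A U := fun τ hτ =>
    (dA τ hτ).differentiableAt.differentiableWithinAt
  have hg0 : ∃ τ ∈ U, g₁ τ ≠ 0 := by
    by_contra! h0
    obtain ⟨τ, hτ, -⟩ := hN
    refine hN0 τ hτ ?_
    have : deriv g₁ τ = 0 := by
      rw [deriv_eq_of_mem hU h0 hτ, deriv_const]
    simp only [hNd, hA, h0 τ hτ, this]
    ring
  -- If A vanished identically, A' = 2γA + 1152μg₁³ would force g₁ = 0.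
  have hA0 : ∃ τ ∈ U, A τ ≠ 0 := by
    by_contra! h0
    obtain ⟨τ, hτ, hgτ⟩ := hg0
    have := hasDerivAt_unique_of_mem hU h0 hτ (dA τ hτ) (hasDerivAt_const τ 0)
    rw [h0 τ hτ, mul_zero, zero_add] at this
    exact mul_ne_zero (mul_ne_zero (by norm_num) hμ) (pow_ne_zero 3 hgτ) this
  set T := halfDomain U with hT
  have hTo : IsOpen T := isOpen_halfDomain hU
  have h2 : ∀ {f : ℂ → ℂ} {f' : ℂ} {t : ℂ}, HasDerivAt f f' (2 * t) →
      HasDerivAt (fun t => f (2 * t)) (2 * f') t := fun {f f' t} hf => by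
    exact (hf.comp t ((hasDerivAt_id t).const_mul 2)).congr_deriv (by ring)
  set y : ℂ → ℂ := fun t => A (2 * t) ^ 2 / N (2 * t) with hy
  have dy : ∀ t ∈ T, HasDerivAt y (4608 * μ * (A (2 * t) * g₁ (2 * t) ^ 3) / N (2 * t)) t :=
    fun t ht => by
      have hn := hN0 _ ht
      refine (((h2 (dA _ ht)).fun_pow 2).fun_div (h2 (dN _ ht)) hn).congr_deriv ?_
      push_cast
      field_simp
      ring
  have ddy : ∀ t ∈ T, deriv (deriv y) t = 9216 * μ * g₁ (2 * t) ^ 2 *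
      (γ (2 * t) * A (2 * t) * g₁ (2 * t) + 1152 * μ * g₁ (2 * t) ^ 4 + 3 * A (2 * t) ^ 2)
        / N (2 * t) := fun t ht => by
    have hn := hN0 _ ht
    refine deriv_deriv_of_mem hTo dy ht (((((h2 (dA _ ht)).fun_mul
      ((h2 (dg _ ht)).fun_pow 3)).const_mul (4608 * μ)).fun_div (h2 (dN _ ht)) hn).congr_deriv ?_)
    push_cast
    field_simp
    ring
  have hy1 : ∀ t ∈ T, y t - 1 = 576 * μ * g₁ (2 * t) ^ 4 / N (2 * t) := fun t ht => by
    have hn := hN0 _ ht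
    rw [hy, div_sub_one hn]
    congr 1
    simp only [hNd]
    ring
  have Dy : DifferentiableOn ℂ y T := fun t ht =>
    (dy t ht).differentiableAt.differentiableWithinAt
  have hset : ∀ t, (t ∈ T ∧ y t ≠ 0 ∧ y t ≠ 1) ↔ t ∈ T ∧ A (2 * t) ≠ 0 ∧ g₁ (2 * t) ≠ 0 :=
    fun t => and_congr_right fun ht => by
      rw [← sub_ne_zero (a := y t) (b := 1), hy1 t ht, hy]
      simp [hN0 _ ht, hμ]
  set T' := {t | t ∈ T ∧ y t ≠ 0 ∧ y t ≠ 1} with hT'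
  have hT'o : IsOpen T' := by
    have := (Dy.continuousOn.isOpen_inter_preimage hTo isOpen_ne (t := {z | z ≠ (0 : ℂ)})).inter
      (Dy.continuousOn.isOpen_inter_preimage hTo isOpen_ne (t := {z | z ≠ (1 : ℂ)}))
    convert this using 1
    ext t
    simp only [hT', mem_ofPred_eq, mem_inter_iff, mem_preimage]
    tauto
  have hsub : T' ⊆ T := fun t ht => ht.1
  refine ⟨y, Dy, ?_, ?_⟩
  · obtain ⟨τ, hτ, h⟩ := exists_mul_ne_zero hU hc DA hg hA0 hg0
    have := subset_closure_ne_zero hTo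
      (by rw [hT, halfDomain_eq_image]; exact hc.image _ (by fun_prop))
      (f := fun t => A (2 * t) * g₁ (2 * t))
      ((differentiableOn_rescale DA).fun_mul (differentiableOn_rescale hg))
      ⟨τ / 2, by simpa [hT, halfDomain, mul_div_cancel₀] using hτ,
        by simpa [mul_div_cancel₀] using h⟩
    refine this.trans (closure_mono fun t ht => (hset t).2 ⟨ht.1, ?_⟩)
    simpa using ht.2
  · have hB : ∀ t ∈ T', BureauFormula (1 / 2) (1 / 4) (rescale γ) y t := fun t ht => by
      have hn := hN0 _ ht.1
      obtain ⟨h0, ha, hg⟩ := (hset t).1 ht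
      rw [BureauFormula, ddy t h0, (dy t h0).deriv, hy1 t h0]
      simp only [hy, rescale]
      field_simp
      ring
    refine ⟨isTriangleFunction_of_bureauFormula hT'o (Dy.mono hsub)
      ((differentiableOn_rescale hγ).mono hsub) (fun t ht => ⟨ht.2.1, ht.2.2, ?_⟩) hB
      (fun t ht => ?_), hB,
      -- This s is a branch of the root of μy(y−1), because y = A²/N and y − 1 = 576μg₁⁴/N.
      fun t => 24 * μ * (A (2 * t) * g₁ (2 * t) ^ 2) / N (2 * t), ?_, fun t ht => ⟨?_, ?_⟩⟩
    · have hn := hN0 _ ht.1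
      obtain ⟨h0, ha, hg⟩ := (hset t).1 ht
      rw [(dy t h0).deriv]
      exact div_ne_zero (mul_ne_zero (mul_ne_zero (by norm_num) hμ)
        (mul_ne_zero ha (pow_ne_zero 3 hg))) hn
    · have hn := hN0 _ ht.1
      rw [(hasDerivAt_rescale hU hγ ht.1).deriv, (dγ _ ht.1).deriv, (dy t ht.1).deriv,
        ← neg_sub (y t) 1, hy1 t ht.1]
      simp only [hy, rescale]
      field_simp
      ring
    · exact fun t ht => (((((h2 (dA _ ht.1)).fun_mul ((h2 (dg _ ht.1)).fun_pow 2)).const_mul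
        (24 * μ)).fun_div (h2 (dN _ ht.1)) (hN0 _ ht.1))).differentiableAt.differentiableWithinAt
    · have hn := hN0 _ ht.1
      rw [hy1 t ht.1]
      simp only [hy]
      ring
    · have hn := hN0 _ ht.1
      obtain ⟨h0, ha, hg⟩ := (hset t).1 ht
      rw [(dy t h0).deriv]
      simp only [rescale]
      field_simp
      norm_num

/-- The construction of case I with A = g₁' − ½γg₁ and N = A² − 36Kg₁⁶, where now N' = 3γN. Only g₁⁴
enters the formula, so no branch has to be chosen. -/
theorem exists_triangleSolutionIII {K : ℂ} (hU : IsOpen U) (hc : IsPreconnected U) (hK : K ≠ 0)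
    (hγ : DifferentiableOn ℂ γ U) (hg : DifferentiableOn ℂ g₁ U) (h : CaseIII U K γ g₁)
    (hN : ∃ τ ∈ U, NondegenerateIII K γ g₁ τ) :
    ∃ y : ℂ → ℂ, DifferentiableOn ℂ y (halfDomain U) ∧
      halfDomain U ⊆ closure {t | t ∈ halfDomain U ∧ y t ≠ 0 ∧ y t ≠ 1} ∧
      TriangleSolutionIII K {t | t ∈ halfDomain U ∧ y t ≠ 0 ∧ y t ≠ 1}
        (rescale γ) (rescale g₁) y := by
  set A : ℂ → ℂ := fun τ => deriv g₁ τ - 1 / 2 * γ τ * g₁ τ with hA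
  set N : ℂ → ℂ := fun τ => A τ ^ 2 - 36 * K * g₁ τ ^ 6 with hNd
  have dγ : ∀ τ ∈ U, HasDerivAt γ (1 / 2 * γ τ ^ 2 - 72 * K * g₁ τ ^ 4) τ := fun τ hτ => by
    rw [← (h τ hτ).1]; exact hasDerivAt_of_mem hU hγ hτ
  have dg : ∀ τ ∈ U, HasDerivAt g₁ (A τ + 1 / 2 * γ τ * g₁ τ) τ := fun τ hτ =>
    (hasDerivAt_of_mem hU hg hτ).congr_deriv (by simp only [hA]; ring)
  have dA : ∀ τ ∈ U, HasDerivAt A (3 / 2 * γ τ * A τ + 108 * K * g₁ τ ^ 5) τ := fun τ hτ => by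
    refine ((hasDerivAt_of_mem hU (hg.deriv hU) hτ).fun_sub
      (((dγ τ hτ).const_mul (1 / 2)).fun_mul (hasDerivAt_of_mem hU hg hτ))).congr_deriv ?_
    rw [(h τ hτ).2, (h τ hτ).1]
    simp only [hA]
    ring
  have dN : ∀ τ ∈ U, HasDerivAt N (3 * γ τ * N τ) τ := fun τ hτ => by
    refine (((dA τ hτ).fun_pow 2).fun_sub
      (((dg τ hτ).fun_pow 6).const_mul (36 * K))).congr_deriv ?_
    push_cast
    simp only [hNd]
    ring
  have hN0 : ∀ τ ∈ U, N τ ≠ 0 := ne_zero_of_hasDerivAt_mul hU hc (hγ.const_mul 3) dN (by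
    obtain ⟨τ, hτ, h⟩ := hN
    exact ⟨τ, hτ, sub_ne_zero.2 h⟩)
  have DA : DifferentiableOn ℂ A U := fun τ hτ =>
    (dA τ hτ).differentiableAt.differentiableWithinAt
  have hg0 : ∃ τ ∈ U, g₁ τ ≠ 0 := by
    by_contra! h0
    obtain ⟨τ, hτ, -⟩ := hN
    refine hN0 τ hτ ?_
    have : deriv g₁ τ = 0 := by
      rw [deriv_eq_of_mem hU h0 hτ, deriv_const]
    simp only [hNd, hA, h0 τ hτ, this]
    ring
  have hA0 : ∃ τ ∈ U, A τ ≠ 0 := by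
    by_contra! h0
    obtain ⟨τ, hτ, hgτ⟩ := hg0
    have := hasDerivAt_unique_of_mem hU h0 hτ (dA τ hτ) (hasDerivAt_const τ 0)
    rw [h0 τ hτ, mul_zero, zero_add] at this
    exact mul_ne_zero (mul_ne_zero (by norm_num) hK) (pow_ne_zero 5 hgτ) this
  set T := halfDomain U with hT
  have hTo : IsOpen T := isOpen_halfDomain hU
  have h2 : ∀ {f : ℂ → ℂ} {f' : ℂ} {t : ℂ}, HasDerivAt f f' (2 * t) →
      HasDerivAt (fun t => f (2 * t)) (2 * f') t := fun {f f' t} hf => by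
    exact (hf.comp t ((hasDerivAt_id t).const_mul 2)).congr_deriv (by ring)
  set y : ℂ → ℂ := fun t => A (2 * t) ^ 2 / N (2 * t) with hy
  have dy : ∀ t ∈ T, HasDerivAt y (432 * K * (A (2 * t) * g₁ (2 * t) ^ 5) / N (2 * t)) t :=
    fun t ht => by
      have hn := hN0 _ ht
      refine (((h2 (dA _ ht)).fun_pow 2).fun_div (h2 (dN _ ht)) hn).congr_deriv ?_
      push_cast
      field_simp
      ring
  have ddy : ∀ t ∈ T, deriv (deriv y) t = 864 * K * g₁ (2 * t) ^ 4 *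
      (γ (2 * t) * A (2 * t) * g₁ (2 * t) + 108 * K * g₁ (2 * t) ^ 6 + 5 * A (2 * t) ^ 2)
        / N (2 * t) := fun t ht => by
    have hn := hN0 _ ht
    refine deriv_deriv_of_mem hTo dy ht (((((h2 (dA _ ht)).fun_mul
      ((h2 (dg _ ht)).fun_pow 5)).const_mul (432 * K)).fun_div (h2 (dN _ ht)) hn).congr_deriv ?_)
    push_cast
    field_simp
    ring
  have hy1 : ∀ t ∈ T, y t - 1 = 36 * K * g₁ (2 * t) ^ 6 / N (2 * t) := fun t ht => by
    have hn := hN0 _ ht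
    rw [hy, div_sub_one hn]
    congr 1
    simp only [hNd]
    ring
  have Dy : DifferentiableOn ℂ y T := fun t ht =>
    (dy t ht).differentiableAt.differentiableWithinAt
  have hset : ∀ t, (t ∈ T ∧ y t ≠ 0 ∧ y t ≠ 1) ↔ t ∈ T ∧ A (2 * t) ≠ 0 ∧ g₁ (2 * t) ≠ 0 :=
    fun t => and_congr_right fun ht => by
      rw [← sub_ne_zero (a := y t) (b := 1), hy1 t ht, hy]
      simp [hN0 _ ht, hK]
  set T' := {t | t ∈ T ∧ y t ≠ 0 ∧ y t ≠ 1} with hT'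
  have hT'o : IsOpen T' := by
    have := (Dy.continuousOn.isOpen_inter_preimage hTo isOpen_ne (t := {z | z ≠ (0 : ℂ)})).inter
      (Dy.continuousOn.isOpen_inter_preimage hTo isOpen_ne (t := {z | z ≠ (1 : ℂ)}))
    convert this using 1
    ext t
    simp only [hT', mem_ofPred_eq, mem_inter_iff, mem_preimage]
    tauto
  have hsub : T' ⊆ T := fun t ht => ht.1
  refine ⟨y, Dy, ?_, ?_⟩
  · obtain ⟨τ, hτ, h⟩ := exists_mul_ne_zero hU hc DA hg hA0 hg0
    have := subset_closure_ne_zero hTo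
      (by rw [hT, halfDomain_eq_image]; exact hc.image _ (by fun_prop))
      (f := fun t => A (2 * t) * g₁ (2 * t))
      ((differentiableOn_rescale DA).fun_mul (differentiableOn_rescale hg))
      ⟨τ / 2, by simpa [hT, halfDomain, mul_div_cancel₀] using hτ,
        by simpa [mul_div_cancel₀] using h⟩
    refine this.trans (closure_mono fun t ht => (hset t).2 ⟨ht.1, ?_⟩)
    simpa using ht.2
  · have hB : ∀ t ∈ T', BureauFormula (1 / 2) (1 / 6) (rescale γ) y t := fun t ht => by
      have hn := hN0 _ ht.1
      obtain ⟨h0, ha, hg⟩ := (hset t).1 ht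
      rw [BureauFormula, ddy t h0, (dy t h0).deriv, hy1 t h0]
      simp only [hy, rescale]
      field_simp
      ring
    refine ⟨isTriangleFunction_of_bureauFormula hT'o (Dy.mono hsub)
      ((differentiableOn_rescale hγ).mono hsub) (fun t ht => ⟨ht.2.1, ht.2.2, ?_⟩) hB
      (fun t ht => ?_), hB,
      fun t ht => ?_⟩
    · have hn := hN0 _ ht.1
      obtain ⟨h0, ha, hg⟩ := (hset t).1 ht
      rw [(dy t h0).deriv]
      exact div_ne_zero (mul_ne_zero (mul_ne_zero (by norm_num) hK)
        (mul_ne_zero ha (pow_ne_zero 5 hg))) hn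
    · have hn := hN0 _ ht.1
      rw [(hasDerivAt_rescale hU hγ ht.1).deriv, (dγ _ ht.1).deriv, (dy t ht.1).deriv,
        ← neg_sub (y t) 1, hy1 t ht.1]
      simp only [hy, rescale]
      field_simp
      ring
    · have hn := hN0 _ ht.1
      obtain ⟨h0, ha, hg⟩ := (hset t).1 ht
      rw [(dy t h0).deriv, hy1 t h0]
      simp only [hy, rescale]
      field_simp
      norm_num

end TriangleSolutions

/-! ## Derivatives of polynomial prepotentials -/

section Derivatives

variable {U : Set ℂ} {F G : (Fin 4 → ℂ) → ℂ} {S : Finset (ℕ × ℕ)} {g : ℕ × ℕ → ℂ → ℂ}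

theorem isOpen_domain (hU : IsOpen U) : IsOpen (domain U) :=
  hU.preimage (continuous_apply 3)

theorem pd_congr (hU : IsOpen U) (h : ∀ t ∈ domain U, F t = G t) (i : Fin 4) {t : Fin 4 → ℂ}
    (ht : t ∈ domain U) : pd i F t = pd i G t := by
  refine Filter.EventuallyEq.deriv_eq ?_
  have hc : ContinuousAt (fun s => Function.update t i s) (t i) :=
    (continuous_const.update i continuous_id).continuousAt
  have : domain U ∈ 𝓝 (Function.update t i (t i)) := by
    rw [Function.update_eq_self]
    exact (isOpen_domain hU).mem_nhds ht
  filter_upwards [hc this] with s hs using h _ hs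

theorem c_congr (hU : IsOpen U) (h : ∀ t ∈ domain U, F t = G t) (i j k : Fin 4) {t : Fin 4 → ℂ}
    (ht : t ∈ domain U) : c F i j k t = c G i j k t :=
  pd_congr hU (fun _ hs => pd_congr hU (fun _ hr => pd_congr hU h k hr) j hs) i ht

theorem pd_add {t : Fin 4 → ℂ} (hF : DifferentiableAt ℂ F t) (hG : DifferentiableAt ℂ G t)
    (i : Fin 4) : pd i (fun s => F s + G s) t = pd i F t + pd i G t := by
  have h := (hasDerivAt_update t i (t i)).differentiableAt
  have e : Function.update t i (t i) = t := Function.update_eq_self i t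
  refine deriv_fun_add (f := fun s => F (Function.update t i s))
    (g := fun s => G (Function.update t i s)) ?_ ?_
  · exact DifferentiableAt.comp (t i) (by rwa [e]) h
  · exact DifferentiableAt.comp (t i) (by rwa [e]) h

/-- The derivative `∂₂ᵃ ∂₃ᵇ ∂₄ⁿ` of `∑_{p ∈ S} (t²)^{p₁} (t³)^{p₂} g_p(t⁴)`. -/
noncomputable def coeffSum (S : Finset (ℕ × ℕ)) (g : ℕ × ℕ → ℂ → ℂ) (a b n : ℕ)
    (t : Fin 4 → ℂ) : ℂ :=
  ∑ p ∈ S, (p.1.descFactorial a * t 1 ^ (p.1 - a)) * (p.2.descFactorial b * t 2 ^ (p.2 - b)) *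
    iteratedDeriv n (g p) (t 3)

theorem differentiableOn_iteratedDeriv (hU : IsOpen U) {f : ℂ → ℂ} (hf : DifferentiableOn ℂ f U)
    (n : ℕ) : DifferentiableOn ℂ (iteratedDeriv n f) U := by
  induction n with
  | zero => simpa using hf
  | succ n ih =>
    rw [iteratedDeriv_succ]
    exact ih.deriv hU

theorem differentiableAt_coeffSum (hU : IsOpen U) (hg : ∀ p ∈ S, DifferentiableOn ℂ (g p) U)
    (a b n : ℕ) {t : Fin 4 → ℂ} (ht : t ∈ domain U) :
    DifferentiableAt ℂ (coeffSum S g a b n) t := by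
  refine DifferentiableAt.fun_sum fun p hp => DifferentiableAt.fun_mul (by fun_prop) ?_
  exact DifferentiableAt.comp t ((differentiableOn_iteratedDeriv hU (hg p hp) n).differentiableAt
    (hU.mem_nhds ht)) (by fun_prop)

theorem pd_zero_coeffSum (a b n : ℕ) (t : Fin 4 → ℂ) : pd 0 (coeffSum S g a b n) t = 0 := by
  simp [pd, coeffSum]

theorem hasDerivAt_descFactorial_pow (n a : ℕ) (x : ℂ) :
    HasDerivAt (fun x : ℂ => (n.descFactorial a : ℂ) * x ^ (n - a))
      (n.descFactorial (a + 1) * x ^ (n - (a + 1))) x := by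
  refine ((hasDerivAt_pow (n - a) x).const_mul _).congr_deriv ?_
  rw [Nat.descFactorial_succ, Nat.sub_sub]
  push_cast
  ring

theorem pd_one_coeffSum (a b n : ℕ) (t : Fin 4 → ℂ) :
    pd 1 (coeffSum S g a b n) t = coeffSum S g (a + 1) b n t := by
  simp only [pd, coeffSum, Function.update_self, ne_eq, Fin.reduceEq, not_false_eq_true,
    Function.update_of_ne]
  exact (HasDerivAt.fun_sum fun p _ =>
    ((hasDerivAt_descFactorial_pow p.1 a (t 1)).mul_const _).mul_const _).deriv

theorem pd_two_coeffSum (a b n : ℕ) (t : Fin 4 → ℂ) :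
    pd 2 (coeffSum S g a b n) t = coeffSum S g a (b + 1) n t := by
  simp only [pd, coeffSum, Function.update_self, ne_eq, Fin.reduceEq, not_false_eq_true,
    Function.update_of_ne]
  exact (HasDerivAt.fun_sum fun p _ =>
    ((hasDerivAt_descFactorial_pow p.2 b (t 2)).const_mul _).mul_const _).deriv

theorem pd_three_coeffSum (hU : IsOpen U) (hg : ∀ p ∈ S, DifferentiableOn ℂ (g p) U)
    (a b n : ℕ) {t : Fin 4 → ℂ} (ht : t ∈ domain U) :
    pd 3 (coeffSum S g a b n) t = coeffSum S g a b (n + 1) t := by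
  simp only [pd, coeffSum, Function.update_self, ne_eq, Fin.reduceEq, not_false_eq_true,
    Function.update_of_ne]
  refine (HasDerivAt.fun_sum fun p hp => ?_).deriv
  rw [iteratedDeriv_succ]
  exact (hasDerivAt_of_mem hU (differentiableOn_iteratedDeriv hU (hg p hp) n) ht).const_mul _

theorem pd_coeffSum (hU : IsOpen U) (hg : ∀ p ∈ S, DifferentiableOn ℂ (g p) U) (i : Fin 4)
    (a b n : ℕ) {t : Fin 4 → ℂ} (ht : t ∈ domain U) :
    pd i (coeffSum S g a b n) t = if i = 0 then 0 else
      coeffSum S g (a + if i = 1 then 1 else 0) (b + if i = 2 then 1 else 0)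
        (n + if i = 3 then 1 else 0) t := by
  fin_cases i
  · exact pd_zero_coeffSum a b n t
  · exact pd_one_coeffSum a b n t
  · exact pd_two_coeffSum a b n t
  · exact pd_three_coeffSum hU hg a b n ht

/-- The part `½ (t¹)² t⁴ + t¹ t² t³` of a prepotential. -/
noncomputable def unityPart (t : Fin 4 → ℂ) : ℂ := 1 / 2 * t 0 ^ 2 * t 3 + t 0 * t 1 * t 2

theorem polyPrepotential_eq (S : Finset (ℕ × ℕ)) (g : ℕ × ℕ → ℂ → ℂ) :
    polyPrepotential S g = fun t => unityPart t + coeffSum S g 0 0 0 t := by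
  funext t
  simp [polyPrepotential, unityPart, coeffSum]

theorem pd_unityPart (i : Fin 4) : pd i unityPart = fun t =>
    ![t 0 * t 3 + t 1 * t 2, t 0 * t 2, t 0 * t 1, 1 / 2 * t 0 ^ 2] i := by
  funext t
  fin_cases i
  · exact (((((hasDerivAt_pow 2 (t 0)).const_mul (1 / 2)).mul_const (t 3)).fun_add
      (((hasDerivAt_id (t 0)).mul_const (t 1)).mul_const (t 2))).congr_deriv
        (by simp)).deriv
  · exact ((((hasDerivAt_id (t 1)).const_mul (t 0)).mul_const (t 2)).const_add
      (1 / 2 * t 0 ^ 2 * t 3)).congr_deriv (by simp) |>.deriv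
  · exact (((hasDerivAt_id (t 2)).const_mul (t 0 * t 1)).const_add
      (1 / 2 * t 0 ^ 2 * t 3)).congr_deriv (by simp) |>.deriv
  · exact (((hasDerivAt_id (t 3)).const_mul (1 / 2 * t 0 ^ 2)).add_const
      (t 0 * t 1 * t 2)).congr_deriv (by simp) |>.deriv

theorem pd_pd_unityPart (j k : Fin 4) : pd j (pd k unityPart) = fun t =>
    !![t 3, t 2, t 1, t 0; t 2, 0, t 0, 0; t 1, t 0, 0, 0; t 0, 0, 0, 0] j k := by
  rw [pd_unityPart]
  funext t
  fin_cases k <;> fin_cases j <;> simp [pd]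

/-- The third derivatives of a prepotential, in terms of those of its non-trivial part. -/
noncomputable def tensor (M : ℕ → ℕ → ℕ → ℂ) (i j k : Fin 4) : ℂ :=
  if i = 0 then eta j k else if j = 0 then eta i k else if k = 0 then eta i j else
    M ((if i = 1 then 1 else 0) + (if j = 1 then 1 else 0) + if k = 1 then 1 else 0)
      ((if i = 2 then 1 else 0) + (if j = 2 then 1 else 0) + if k = 2 then 1 else 0)
      ((if i = 3 then 1 else 0) + (if j = 3 then 1 else 0) + if k = 3 then 1 else 0)

theorem c_unityPart (i j k : Fin 4) (t : Fin 4 → ℂ) :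
    c unityPart i j k t = tensor (fun _ _ _ => 0) i j k := by
  rw [c, pd_pd_unityPart]
  fin_cases i <;> fin_cases j <;> fin_cases k <;> simp [pd, tensor, eta, Fin.rev, Fin.ext_iff]

theorem differentiable_unityPart : Differentiable ℂ unityPart := by
  unfold unityPart
  fun_prop

theorem differentiable_pd_unityPart (k : Fin 4) : Differentiable ℂ (pd k unityPart) := by
  rw [pd_unityPart]
  fin_cases k <;> simp <;> fun_prop

theorem differentiable_pd_pd_unityPart (j k : Fin 4) :
    Differentiable ℂ (pd j (pd k unityPart)) := by
  rw [pd_pd_unityPart]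
  fin_cases j <;> fin_cases k <;> simp <;> fun_prop

theorem c_polyPrepotential (hU : IsOpen U) (hg : ∀ p ∈ S, DifferentiableOn ℂ (g p) U)
    (i j k : Fin 4) {t : Fin 4 → ℂ} (ht : t ∈ domain U) :
    c (polyPrepotential S g) i j k t = tensor (fun a b n => coeffSum S g a b n t) i j k := by
  set M : Fin 4 → Fin 4 → (Fin 4 → ℂ) → ℂ := fun j k t => if j = 0 then 0 else if k = 0 then 0 else
    coeffSum S g ((if k = 1 then 1 else 0) + if j = 1 then 1 else 0)
      ((if k = 2 then 1 else 0) + if j = 2 then 1 else 0)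
      ((if k = 3 then 1 else 0) + if j = 3 then 1 else 0) t with hM
  have h1 : ∀ t ∈ domain U, pd k (polyPrepotential S g) t = pd k unityPart t +
      if k = 0 then 0 else coeffSum S g (if k = 1 then 1 else 0) (if k = 2 then 1 else 0)
        (if k = 3 then 1 else 0) t := fun t ht => by
    rw [polyPrepotential_eq, pd_add (differentiable_unityPart t)
      (differentiableAt_coeffSum hU hg 0 0 0 ht), pd_coeffSum hU hg k 0 0 0 ht]
    simp only [zero_add]
  have h2 : ∀ t ∈ domain U, pd j (pd k (polyPrepotential S g)) t =
      pd j (pd k unityPart) t + M j k t := fun t ht => by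
    rw [pd_congr hU h1 j ht]
    by_cases hk : k = 0
    · simp only [hk, if_true, add_zero, hM, ite_self]
    · simp only [hk, if_false]
      rw [pd_add (differentiable_pd_unityPart k t) (differentiableAt_coeffSum hU hg _ _ _ ht),
        pd_coeffSum hU hg j _ _ _ ht]
      simp only [hM, hk, if_false]
  rw [c, pd_congr hU h2 i ht]
  have h3 := c_unityPart i j k t
  rw [c] at h3
  by_cases hj : j = 0
  · simp only [hM, hj, if_true, add_zero]
    rw [← hj, h3]
    simp [tensor, hj]
  · by_cases hk : k = 0
    · simp only [hM, hk, if_true, add_zero, ite_self]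
      rw [← hk, h3]
      simp [tensor, hk]
    · simp only [hM, hk, hj, if_false]
      rw [pd_add (differentiable_pd_pd_unityPart j k t)
        (differentiableAt_coeffSum hU hg _ _ _ ht), pd_coeffSum hU hg i _ _ _ ht, h3]
      simp only [tensor, hk, hj, if_false]
      by_cases hi : i = 0
      · simp [hi]
      · simp only [hi, if_false, zero_add]
        congr 1 <;> ring

end Derivatives

/-! ## Quasi-homogeneity -/

section Quasihomogeneity

variable {U : Set ℂ} {F : (Fin 4 → ℂ) → ℂ} {S : Finset (ℕ × ℕ)} {g : ℕ × ℕ → ℂ → ℂ}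

theorem sum_ite_eq_zero_of_forall {ι : Type*} {S : Finset ι} {e : ι → ℕ} {a : ι → ℂ}
    (h : ∀ x : ℂ, ∑ p ∈ S, x ^ e p * a p = 0) (n : ℕ) :
    ∑ p ∈ S, (if e p = n then a p else 0) = 0 := by
  have h0 : ∑ p ∈ S, Polynomial.monomial (e p) (a p) = 0 := by
    refine Polynomial.funext fun x => ?_
    rw [Polynomial.eval_finsetSum, Polynomial.eval_zero, ← h x]
    exact Finset.sum_congr rfl fun p _ => by rw [Polynomial.eval_monomial, mul_comm]
  have := congrArg (fun q => Polynomial.coeff q n) h0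
  simpa [Polynomial.finsetSum_coeff, Polynomial.coeff_monomial] using this

/-- Coefficients are compared first in x, then in y; the exponent pair determines the index, so a
single term survives. -/
theorem eq_zero_of_forall_sum {S : Finset (ℕ × ℕ)} {a : ℕ × ℕ → ℂ}
    (h : ∀ x y : ℂ, ∑ p ∈ S, x ^ p.1 * (y ^ p.2 * a p) = 0) : ∀ p ∈ S, a p = 0 := by
  intro q hq
  have h1 : ∀ y : ℂ, ∑ p ∈ S, y ^ p.2 * (if p.1 = q.1 then a p else 0) = 0 := fun y =>
    (Finset.sum_congr rfl fun p _ => by split_ifs <;> simp).trans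
      (sum_ite_eq_zero_of_forall (e := Prod.fst) (fun x => h x y) q.1)
  have h2 := sum_ite_eq_zero_of_forall (e := Prod.snd) h1 q.2
  rw [Finset.sum_eq_single q] at h2
  · simpa using h2
  · intro p _ hp
    rw [ite_eq_right_iff, ite_eq_right_iff]
    exact fun h1 h2 => absurd (Prod.ext h2 h1) hp
  · exact fun h => absurd hq h

theorem pd_polyPrepotential (hU : IsOpen U) (hg : ∀ p ∈ S, DifferentiableOn ℂ (g p) U)
    (k : Fin 4) {t : Fin 4 → ℂ} (ht : t ∈ domain U) :
    pd k (polyPrepotential S g) t = pd k unityPart t +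
      if k = 0 then 0 else coeffSum S g (if k = 1 then 1 else 0) (if k = 2 then 1 else 0)
        (if k = 3 then 1 else 0) t := by
  rw [polyPrepotential_eq, pd_add (differentiable_unityPart t)
    (differentiableAt_coeffSum hU hg 0 0 0 ht), pd_coeffSum hU hg k 0 0 0 ht]
  simp only [zero_add]

theorem quasihomogeneous_polyPrepotential_iff (hU : IsOpen U)
    (hg : ∀ p ∈ S, DifferentiableOn ℂ (g p) U) (σ : ℝ) {t : Fin 4 → ℂ} (ht : t ∈ domain U) :
    Quasihomogeneous σ (polyPrepotential S g) t ↔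
      ∑ p ∈ S, t 1 ^ p.1 * (t 2 ^ p.2 * (((1 - σ) * p.1 + σ * p.2 - 2) * g p (t 3))) = 0 := by
  have e1 : t 1 * coeffSum S g 1 0 0 t =
      ∑ p ∈ S, t 1 ^ p.1 * (t 2 ^ p.2 * (p.1 * g p (t 3))) := by
    rw [coeffSum, Finset.mul_sum]
    refine Finset.sum_congr rfl fun p _ => ?_
    -- For p.1 = 0 the truncated exponent p.1 − 1 would be wrong, but the factor p.1 vanishes.
    rcases Nat.eq_zero_or_pos p.1 with h | h
    · simp [h]
    · rw [Nat.descFactorial_one, iteratedDeriv_zero, ← pow_sub_one_mul h.ne' (t 1)]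
      simp
      ring
  have e2 : t 2 * coeffSum S g 0 1 0 t =
      ∑ p ∈ S, t 1 ^ p.1 * (t 2 ^ p.2 * (p.2 * g p (t 3))) := by
    rw [coeffSum, Finset.mul_sum]
    refine Finset.sum_congr rfl fun p _ => ?_
    rcases Nat.eq_zero_or_pos p.2 with h | h
    · simp [h]
    · rw [Nat.descFactorial_one, iteratedDeriv_zero, ← pow_sub_one_mul h.ne' (t 2)]
      simp
      ring
  have e0 : coeffSum S g 0 0 0 t = ∑ p ∈ S, t 1 ^ p.1 * (t 2 ^ p.2 * g p (t 3)) := by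
    simp [coeffSum, mul_assoc]
  have e3 : ∑ p ∈ S, t 1 ^ p.1 * (t 2 ^ p.2 * (((1 - σ) * p.1 + σ * p.2 - 2) * g p (t 3))) =
      (1 - σ) * (t 1 * coeffSum S g 1 0 0 t) + σ * (t 2 * coeffSum S g 0 1 0 t)
        - 2 * coeffSum S g 0 0 0 t := by
    rw [e0, e1, e2, Finset.mul_sum, Finset.mul_sum, Finset.mul_sum, ← Finset.sum_add_distrib,
      ← Finset.sum_sub_distrib]
    exact Finset.sum_congr rfl fun p _ => by ring
  rw [e3, Quasihomogeneous, Fin.sum_univ_four]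
  simp only [pd_polyPrepotential hU hg _ ht]
  rw [polyPrepotential_eq, ← sub_eq_zero]
  simp [pd_unityPart, deg, unityPart]
  constructor <;> intro h <;> linear_combination h

theorem quasihomogeneous_polyPrepotential_iff_monomials (hU : IsOpen U)
    (hg : ∀ p ∈ S, DifferentiableOn ℂ (g p) U) (σ : ℝ) :
    (∀ t ∈ domain U, Quasihomogeneous σ (polyPrepotential S g) t) ↔
      ∀ p ∈ S, (∃ τ ∈ U, g p τ ≠ 0) → p = (2, 2) ∨ p ∈ nonPivotSolutions σ := by
  have hw : ∀ p : ℕ × ℕ, ((1 - σ : ℂ) * p.1 + σ * p.2 - 2 = 0) ↔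
      p = (2, 2) ∨ p ∈ nonPivotSolutions σ := fun p => by
    have h1 : ((1 - σ : ℂ) * p.1 + σ * p.2 - 2 = 0) ↔
        (1 - σ) * (p.1 : ℝ) + σ * (p.2 : ℝ) = 2 := by
      rw [sub_eq_zero]
      exact_mod_cast Iff.rfl
    rw [h1, nonPivotSolutions, mem_ofPred_eq]
    constructor
    · intro h
      by_cases hp : p = (2, 2)
      · exact Or.inl hp
      · exact Or.inr ⟨hp, h⟩
    · rintro (rfl | h)
      · push_cast
        ring
      · exact h.2
  constructor
  · rintro h p hp ⟨τ, hτ, hne⟩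
    rw [← hw]
    have := eq_zero_of_forall_sum
      (a := fun p => ((1 - σ : ℂ) * p.1 + σ * p.2 - 2) * g p τ) (fun x y => by
        have ht : ![0, x, y, τ] ∈ domain U := by simpa [domain] using hτ
        simpa using (quasihomogeneous_polyPrepotential_iff hU hg σ ht).1 (h _ ht)) p hp
    exact (mul_eq_zero.1 this).resolve_right hne
  · intro h t ht
    rw [quasihomogeneous_polyPrepotential_iff hU hg σ ht]
    refine Finset.sum_eq_zero fun p hp => ?_
    by_cases h0 : g p (t 3) = 0
    · simp [h0]
    · rw [(hw p).2 (h p hp ⟨t 3, ht, h0⟩)]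
      simp

theorem Quasihomogeneous.congr (hU : IsOpen U) {G : (Fin 4 → ℂ) → ℂ} {σ : ℝ}
    (h : ∀ t ∈ domain U, F t = G t) {t : Fin 4 → ℂ} (ht : t ∈ domain U)
    (hF : Quasihomogeneous σ F t) : Quasihomogeneous σ G t := by
  rw [Quasihomogeneous] at hF ⊢
  rw [← h t ht, ← hF]
  exact Finset.sum_congr rfl fun i _ => by rw [pd_congr hU h i ht]

/-- A polynomial Frobenius manifold only involves quasi-homogeneous monomials. -/
theorem IsPolynomialFrobenius.exists_eq (hU : IsOpen U) {σ : ℝ}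
    (hF : IsPolynomialFrobenius σ U F) : ∃ (S : Finset (ℕ × ℕ)) (g : ℕ × ℕ → ℂ → ℂ),
      (∀ p, DifferentiableOn ℂ (g p) U) ∧ (∀ p ∈ S, p = (2, 2) ∨ p ∈ nonPivotSolutions σ) ∧
      (∀ p ∉ S, g p = 0) ∧ ∀ t ∈ domain U, F t = polyPrepotential S g t := by
  classical
  obtain ⟨S, g, hg, h⟩ := hF.polynomial
  have hm := (quasihomogeneous_polyPrepotential_iff_monomials hU hg σ).1
    fun t ht => (hF.euler t ht).congr hU h ht
  -- Only monomials whose coefficient is not identically zero on U are constrained, so the others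
  -- are dropped. Their coefficients are redefined as 0 everywhere, which permits enlarging S to a
  -- fixed list of monomials.
  refine ⟨S.filter fun p => ∃ τ ∈ U, g p τ ≠ 0,
    fun p => if p ∈ S.filter (fun p => ∃ τ ∈ U, g p τ ≠ 0) then g p else 0, fun p => ?_,
    fun p hp => ?_, fun p hp => if_neg hp, fun t ht => ?_⟩
  · by_cases hp : p ∈ S.filter (fun p => ∃ τ ∈ U, g p τ ≠ 0)
    · simp only [if_pos hp]
      exact hg p (Finset.mem_filter.1 hp).1
    · simp only [if_neg hp]
      exact differentiableOn_const 0
  · rw [Finset.mem_filter] at hp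
    exact hm p hp.1 hp.2
  · rw [h t ht, polyPrepotential, polyPrepotential, Finset.sum_filter]
    congr 1
    refine Finset.sum_congr rfl fun p hp => ?_
    by_cases hne : ∃ τ ∈ U, g p τ ≠ 0
    · simp only [if_pos hne, Finset.mem_filter, hp, true_and]
    · rw [if_neg hne]
      push Not at hne
      rw [hne _ ht, mul_zero]

theorem polyPrepotential_of_subset {L : Finset (ℕ × ℕ)} (hSL : S ⊆ L) (h0 : ∀ p ∉ S, g p = 0) :
    polyPrepotential S g = polyPrepotential L g := by
  funext t
  rw [polyPrepotential, polyPrepotential, Finset.sum_subset hSL]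
  intro p _ hp
  simp [h0 p hp]

end Quasihomogeneity

/-! ## The WDVV equations -/

section WDVV

variable {F : (Fin 4 → ℂ) → ℂ} {t : Fin 4 → ℂ} {M : ℕ → ℕ → ℕ → ℂ}

theorem eta_inv : eta⁻¹ = eta := by
  refine Matrix.inv_eq_right_inv ?_
  ext i j
  simp only [Matrix.mul_apply, eta, Matrix.of_apply, ite_mul, one_mul, zero_mul,
    Finset.sum_ite_eq', Finset.mem_univ, if_true, Fin.rev_rev, Matrix.one_apply]
  exact if_congr eq_comm rfl rfl

theorem sum_eta_inv_mul (f : Fin 4 → ℂ) (l : Fin 4) : ∑ m, eta⁻¹ l m * f m = f l.rev := by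
  rw [eta_inv]
  simp [eta]

theorem mul_apply (F : (Fin 4 → ℂ) → ℂ) (t X Y : Fin 4 → ℂ) (α : Fin 4) :
    mul F t X Y α = ∑ β, ∑ γ, c F α.rev β γ t * X β * Y γ := by
  simp only [mul, sum_eta_inv_mul (fun ε => c F ε _ _ t)]

/-- The associativity equations for the non-trivial part of a prepotential. -/
structure Associative (M : ℕ → ℕ → ℕ → ℂ) : Prop where
  e₁ : 2 * M 1 1 1 + M 2 1 0 * M 1 2 0 = M 3 0 0 * M 0 3 0
  e₂ : M 1 0 2 = M 3 0 0 * M 0 2 1 - M 1 2 0 * M 2 0 1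
  e₃ : M 0 1 2 = M 0 3 0 * M 2 0 1 - M 2 1 0 * M 0 2 1
  e₄ : M 3 0 0 * M 0 1 2 + M 2 1 0 * M 1 0 2 = 2 * M 2 0 1 * M 1 1 1
  e₅ : M 0 3 0 * M 1 0 2 + M 1 2 0 * M 0 1 2 = 2 * M 0 2 1 * M 1 1 1
  e₆ : M 0 0 3 + M 2 1 0 * M 0 1 2 + M 1 2 0 * M 1 0 2 = M 2 0 1 * M 0 2 1 + M 1 1 1 ^ 2

theorem tensor_comm₁₂ (M : ℕ → ℕ → ℕ → ℂ) (i j k : Fin 4) : tensor M i j k = tensor M j i k := by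
  fin_cases i <;> fin_cases j <;> fin_cases k <;> simp [tensor, eta, Fin.rev, Fin.ext_iff]

theorem tensor_comm₂₃ (M : ℕ → ℕ → ℕ → ℂ) (i j k : Fin 4) : tensor M i j k = tensor M i k j := by
  fin_cases i <;> fin_cases j <;> fin_cases k <;> simp [tensor, eta, Fin.rev, Fin.ext_iff]

theorem wdvv_iff_tensor (hc : ∀ i j k, c F i j k t = tensor M i j k) : WDVV F t ↔
    ∀ α β γ δ, ∑ l, tensor M α β l * tensor M l.rev δ γ =
      ∑ l, tensor M δ β l * tensor M l.rev α γ := by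
  have h : ∀ α β γ δ, ∑ l, ∑ m, c F α β l t * eta⁻¹ l m * c F m δ γ t =
      ∑ l, tensor M α β l * tensor M l.rev δ γ := fun α β γ δ =>
    Finset.sum_congr rfl fun l _ => by
      simp only [mul_assoc, ← Finset.mul_sum, hc]
      rw [sum_eta_inv_mul (fun m => tensor M m δ γ)]
  simp only [WDVV, h]

theorem tensor_zero₁ (M : ℕ → ℕ → ℕ → ℂ) (j k : Fin 4) : tensor M 0 j k = eta j k := by
  simp [tensor]

theorem tensor_zero₂ (M : ℕ → ℕ → ℕ → ℂ) (i k : Fin 4) : tensor M i 0 k = eta i k := by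
  rw [tensor_comm₁₂, tensor_zero₁]

theorem tensor_zero₃ (M : ℕ → ℕ → ℕ → ℂ) (i j : Fin 4) : tensor M i j 0 = eta i j := by
  rw [tensor_comm₂₃, tensor_zero₂]

/-- The components of `tensor M` without an index `0`. -/
theorem tensor_values (M : ℕ → ℕ → ℕ → ℂ) :
    (tensor M 1 1 1 = M 3 0 0 ∧ tensor M 1 1 2 = M 2 1 0 ∧ tensor M 1 1 3 = M 2 0 1) ∧
    (tensor M 1 2 1 = M 2 1 0 ∧ tensor M 1 2 2 = M 1 2 0 ∧ tensor M 1 2 3 = M 1 1 1) ∧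
    (tensor M 1 3 1 = M 2 0 1 ∧ tensor M 1 3 2 = M 1 1 1 ∧ tensor M 1 3 3 = M 1 0 2) ∧
    (tensor M 2 1 1 = M 2 1 0 ∧ tensor M 2 1 2 = M 1 2 0 ∧ tensor M 2 1 3 = M 1 1 1) ∧
    (tensor M 2 2 1 = M 1 2 0 ∧ tensor M 2 2 2 = M 0 3 0 ∧ tensor M 2 2 3 = M 0 2 1) ∧
    (tensor M 2 3 1 = M 1 1 1 ∧ tensor M 2 3 2 = M 0 2 1 ∧ tensor M 2 3 3 = M 0 1 2) ∧
    (tensor M 3 1 1 = M 2 0 1 ∧ tensor M 3 1 2 = M 1 1 1 ∧ tensor M 3 1 3 = M 1 0 2) ∧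
    (tensor M 3 2 1 = M 1 1 1 ∧ tensor M 3 2 2 = M 0 2 1 ∧ tensor M 3 2 3 = M 0 1 2) ∧
    (tensor M 3 3 1 = M 1 0 2 ∧ tensor M 3 3 2 = M 0 1 2 ∧ tensor M 3 3 3 = M 0 0 3) := by
  refine ⟨⟨?_, ?_, ?_⟩, ⟨?_, ?_, ?_⟩, ⟨?_, ?_, ?_⟩, ⟨?_, ?_, ?_⟩, ⟨?_, ?_, ?_⟩, ⟨?_, ?_, ?_⟩,
    ⟨?_, ?_, ?_⟩, ⟨?_, ?_, ?_⟩, ?_, ?_, ?_⟩ <;> rfl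

theorem eta_values : (eta 0 0 = 0 ∧ eta 0 1 = 0 ∧ eta 0 2 = 0 ∧ eta 0 3 = 1) ∧
    (eta 1 0 = 0 ∧ eta 1 1 = 0 ∧ eta 1 2 = 1 ∧ eta 1 3 = 0) ∧
    (eta 2 0 = 0 ∧ eta 2 1 = 1 ∧ eta 2 2 = 0 ∧ eta 2 3 = 0) ∧
    (eta 3 0 = 1 ∧ eta 3 1 = 0 ∧ eta 3 2 = 0 ∧ eta 3 3 = 0) := by
  refine ⟨⟨?_, ?_, ?_, ?_⟩, ⟨?_, ?_, ?_, ?_⟩, ⟨?_, ?_, ?_, ?_⟩, ?_, ?_, ?_, ?_⟩ <;>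
    simp [eta, Fin.ext_iff, Fin.rev]

theorem rev_values : (0 : Fin 4).rev = 3 ∧ (1 : Fin 4).rev = 2 ∧ (2 : Fin 4).rev = 1 ∧
    (3 : Fin 4).rev = 0 := by decide

/-- Components with α = δ are trivial, and so are those with an index 0, because ∂₁ is the unity.
Every remaining component is trivial or one of the six relations up to sign. -/
theorem wdvv_iff_associative (hc : ∀ i j k, c F i j k t = tensor M i j k) :
    WDVV F t ↔ Associative M := by
  rw [wdvv_iff_tensor hc]
  constructor
  · intro h
    have h1 := h 1 1 2 2
    have h2 := h 1 1 3 2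
    have h3 := h 2 2 3 1
    have h4 := h 1 1 3 3
    have h5 := h 2 2 3 3
    have h6 := h 1 2 3 3
    simp only [Fin.sum_univ_four, rev_values, tensor_zero₁, tensor_zero₃,
      tensor_values, eta_values, zero_mul, mul_zero, one_mul, mul_one, zero_add, add_zero]
      at h1 h2 h3 h4 h5 h6
    constructor
    · linear_combination -h1
    · linear_combination -h2
    · linear_combination -h3
    · linear_combination h4
    · linear_combination h5
    · linear_combination h6
  · rintro ⟨e1, e2, e3, e4, e5, e6⟩ α β γ δ
    fin_cases α <;> fin_cases δ <;> first | rfl | skip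
    all_goals
      fin_cases β <;> fin_cases γ <;>
        simp only [Fin.zero_eta, Fin.mk_one, Fin.reduceFinMk, Fin.sum_univ_four, rev_values,
          tensor_zero₁, tensor_zero₂, tensor_zero₃, tensor_values, eta_values, zero_mul,
          mul_zero, one_mul, mul_one, zero_add, add_zero]
    all_goals
      first
      | ring1
      | linear_combination e1 | linear_combination -e1 | linear_combination e2
      | linear_combination -e2 | linear_combination e3 | linear_combination -e3
      | linear_combination e4 | linear_combination -e4 | linear_combination e5
      | linear_combination -e5 | linear_combination e6 | linear_combination -e6

end WDVV

/-! ## Semi-simple algebras -/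

section Algebra

/-- A reduced Artinian ring is the product of its residue fields. Here these are finite over ℂ,
hence equal to ℂ, and the standard basis of the product consists of orthogonal idempotents. -/
theorem exists_basis_orthogonal_idempotents {A : Type*} [CommRing A] [Algebra ℂ A]
    [FiniteDimensional ℂ A] [IsReduced A] {n : ℕ} (hn : Module.finrank ℂ A = n) :
    ∃ b : Module.Basis (Fin n) ℂ A, ∀ i j, b i * b j = if i = j then b i else 0 := by
  have : IsArtinianRing A := IsArtinianRing.of_finite ℂ A
  have hb : ∀ I : MaximalSpectrum A, Function.Bijective (Algebra.ofId ℂ (A ⧸ I.asIdeal)) :=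
    fun I => IsAlgClosed.algebraMap_bijective_of_isIntegral
  let e : A ≃ₐ[ℂ] (MaximalSpectrum A → ℂ) :=
    ((IsArtinianRing.equivPi A).restrictScalars ℂ).trans
      (AlgEquiv.piCongrRight fun I => (AlgEquiv.ofBijective _ (hb I)).symm)
  have : Fintype (MaximalSpectrum A) := Fintype.ofFinite _
  classical
  let b₀ : Module.Basis (MaximalSpectrum A) ℂ A := Module.Basis.ofEquivFun e.toLinearEquiv
  have hb₀ : ∀ i, e (b₀ i) = Pi.single i 1 := fun i => by
    simp [b₀, Module.Basis.coe_ofEquivFun]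
  have hcard : Fintype.card (MaximalSpectrum A) = n := by
    rw [← hn, Module.finrank_eq_card_basis b₀]
  refine ⟨b₀.reindex (Fintype.equivFinOfCardEq hcard), fun i j => e.injective ?_⟩
  simp only [Module.Basis.reindex_apply, map_mul, hb₀]
  split_ifs with h
  · rw [h, ← Pi.single_mul, one_mul, hb₀]
  · rw [map_zero]
    funext k
    rw [Pi.mul_apply, Pi.single_apply, Pi.single_apply, Pi.zero_apply, ite_zero_mul_ite_zero,
      if_neg]
    rintro ⟨h1, h2⟩
    exact h ((Fintype.equivFinOfCardEq hcard).symm.injective (h1.symm.trans h2))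

variable {V : Type*} [AddCommGroup V] [Module ℂ V]

/-- Multiplication by v commutes with multiplication by w, so the composite squares to zero. Hence
nilpotents lie in the kernel of the trace form. -/
theorem trace_mul_eq_zero_of_sq_eq_zero (B : V →ₗ[ℂ] V →ₗ[ℂ] V) (hcomm : ∀ v w, B v w = B w v)
    (hassoc : ∀ u v w, B (B u v) w = B u (B v w)) {v : V} (hv : B v v = 0) (w : V) :
    LinearMap.trace ℂ V (B v ∘ₗ B w) = 0 := by
  refine (LinearMap.isNilpotent_trace_of_isNilpotent ⟨2, ?_⟩).eq_zero
  rw [pow_two]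
  ext u
  simp only [Module.End.mul_apply, LinearMap.comp_apply, LinearMap.zero_apply]
  rw [← hassoc w v, hcomm w v, hassoc v w, ← hassoc v v, hv, map_zero, LinearMap.zero_apply]

theorem exists_basis_of_bilinear [FiniteDimensional ℂ V] (B : V →ₗ[ℂ] V →ₗ[ℂ] V) (e : V)
    (hcomm : ∀ v w, B v w = B w v) (hassoc : ∀ u v w, B (B u v) w = B u (B v w)) (hone : ∀ v, B e v = v)
    (hred : ∀ v, B v v = 0 → v = 0) {n : ℕ} (hn : Module.finrank ℂ V = n) :
    ∃ b : Module.Basis (Fin n) ℂ V, ∀ i j, B (b i) (b j) = if i = j then b i else 0 := by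
  let _ : CommRing V :=
    { (inferInstance : AddCommGroup V) with
      mul := fun v w => B v w
      one := e
      left_distrib := fun u v w => map_add (B u) v w
      right_distrib := fun u v w => by
        change B (u + v) w = B u w + B v w
        rw [map_add, LinearMap.add_apply]
      zero_mul := fun v => by
        change B 0 v = 0
        rw [map_zero, LinearMap.zero_apply]
      mul_zero := fun v => map_zero (B v)
      mul_assoc := hassoc
      one_mul := hone
      mul_one := fun v => (hcomm v e).trans (hone v)
      mul_comm := hcomm }
  let _ : Algebra ℂ V := Algebra.ofModule
    (fun r v w => by
      change B (r • v) w = r • B v w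
      rw [map_smul, LinearMap.smul_apply])
    (fun r v w => map_smul (B v) r w)
  have : IsReduced V := (isReduced_iff_pow_one_lt 2 one_lt_two).2 fun v hv =>
    hred v (by rw [pow_two] at hv; exact hv)
  exact exists_basis_orthogonal_idempotents hn

end Algebra

/-! ### The tangent algebra and its trace form -/

section Tangent

variable {F : (Fin 4 → ℂ) → ℂ} {t : Fin 4 → ℂ} {M : ℕ → ℕ → ℕ → ℂ}

/-- The multiplication on the tangent space at `t`, as a bilinear map. -/
noncomputable def mulLin (F : (Fin 4 → ℂ) → ℂ) (t : Fin 4 → ℂ) :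
    (Fin 4 → ℂ) →ₗ[ℂ] (Fin 4 → ℂ) →ₗ[ℂ] Fin 4 → ℂ :=
  LinearMap.mk₂ ℂ (mul F t)
    (fun X Y Z => by
      funext α
      simp only [mul_apply, Pi.add_apply, ← Finset.sum_add_distrib]
      exact Finset.sum_congr rfl fun β _ => Finset.sum_congr rfl fun γ _ => by ring)
    (fun r X Y => by
      funext α
      simp only [mul_apply, Pi.smul_apply, smul_eq_mul, Finset.mul_sum]
      exact Finset.sum_congr rfl fun β _ => Finset.sum_congr rfl fun γ _ => by ring)
    (fun X Y Z => by
      funext α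
      simp only [mul_apply, Pi.add_apply, ← Finset.sum_add_distrib]
      exact Finset.sum_congr rfl fun β _ => Finset.sum_congr rfl fun γ _ => by ring)
    (fun r X Y => by
      funext α
      simp only [mul_apply, Pi.smul_apply, smul_eq_mul, Finset.mul_sum]
      exact Finset.sum_congr rfl fun β _ => Finset.sum_congr rfl fun γ _ => by ring)

theorem mulLin_apply (X Y : Fin 4 → ℂ) : mulLin F t X Y = mul F t X Y := rfl

theorem SemisimpleAt.eq_zero_of_mul_self (h : SemisimpleAt F t) {v : Fin 4 → ℂ}
    (hv : mul F t v v = 0) : v = 0 := by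
  obtain ⟨b, hb⟩ := h
  have h1 : mulLin F t v v = ∑ i, (b.repr v i) ^ 2 • b i := by
    conv_lhs => rw [← b.sum_repr v]
    simp only [map_sum, LinearMap.sum_apply, map_smul, LinearMap.smul_apply, mulLin_apply, hb,
      smul_ite, smul_zero, Finset.sum_ite_eq', Finset.mem_univ, if_true,
      smul_smul, pow_two]
  rw [mulLin_apply, hv] at h1
  have h2 := Fintype.linearIndependent_iff.1 b.linearIndependent _ h1.symm
  rw [← b.sum_repr v]
  exact Finset.sum_eq_zero fun i _ => by rw [pow_eq_zero_iff two_ne_zero |>.1 (h2 i), zero_smul]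

theorem NilpotentAt.not_semisimpleAt (h : NilpotentAt F t) : ¬ SemisimpleAt F t := by
  obtain ⟨v, hv0, hv⟩ := h
  exact fun hs => hv0 (hs.eq_zero_of_mul_self hv)

theorem mul_self_eq (hc : ∀ i j k, c F i j k t = tensor M i j k) (v : Fin 4 → ℂ) :
    mul F t v v =
      ![v 0 ^ 2 + M 2 0 1 * v 1 ^ 2 + 2 * M 1 1 1 * v 1 * v 2 + M 0 2 1 * v 2 ^ 2
          + 2 * M 1 0 2 * v 1 * v 3 + 2 * M 0 1 2 * v 2 * v 3 + M 0 0 3 * v 3 ^ 2,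
        2 * v 0 * v 1 + M 2 1 0 * v 1 ^ 2 + 2 * M 1 2 0 * v 1 * v 2 + M 0 3 0 * v 2 ^ 2
          + 2 * M 1 1 1 * v 1 * v 3 + 2 * M 0 2 1 * v 2 * v 3 + M 0 1 2 * v 3 ^ 2,
        2 * v 0 * v 2 + M 3 0 0 * v 1 ^ 2 + 2 * M 2 1 0 * v 1 * v 2 + M 1 2 0 * v 2 ^ 2
          + 2 * M 2 0 1 * v 1 * v 3 + 2 * M 1 1 1 * v 2 * v 3 + M 1 0 2 * v 3 ^ 2,
        2 * v 0 * v 3 + 2 * v 1 * v 2] := by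
  funext α
  rw [mul_apply]
  simp only [hc]
  fin_cases α <;>
    simp only [Fin.zero_eta, Fin.mk_one, Fin.reduceFinMk, Fin.sum_univ_four, rev_values,
      tensor_zero₁, tensor_zero₂, tensor_zero₃, tensor_values, eta_values, Matrix.cons_val] <;> ring

theorem mul_single_eq (F : (Fin 4 → ℂ) → ℂ) (t : Fin 4 → ℂ) (β γ : Fin 4) :
    mul F t (Pi.single β 1) (Pi.single γ 1) = fun α => c F α.rev β γ t := by
  funext α
  rw [mul_apply, Finset.sum_eq_single β _ (by simp), Finset.sum_eq_single γ _ (by simp)]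
  · simp
  · intro i _ hi
    simp [hi]
  · intro i _ hi
    simp [hi]

/-- The Gram matrix of the trace form of the tangent algebra. -/
noncomputable def gram (F : (Fin 4 → ℂ) → ℂ) (t : Fin 4 → ℂ) : Matrix (Fin 4) (Fin 4) ℂ :=
  Matrix.of fun β δ => ∑ i : Fin 4, ∑ j : Fin 4, c F i.rev β j t * c F j.rev δ i t

theorem trace_mulLin (v : Fin 4 → ℂ) (β : Fin 4) :
    LinearMap.trace ℂ (Fin 4 → ℂ) (mulLin F t (Pi.single β 1) ∘ₗ mulLin F t v) =
      (gram F t).mulVec v β := by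
  have h : ∀ δ, LinearMap.trace ℂ (Fin 4 → ℂ) (mulLin F t (Pi.single β 1) ∘ₗ
      mulLin F t (Pi.single δ 1)) = gram F t β δ := fun δ => by
    rw [LinearMap.trace_eq_matrix_trace ℂ (Pi.basisFun ℂ (Fin 4)), LinearMap.toMatrix_comp _
      (Pi.basisFun ℂ (Fin 4)), Matrix.trace]
    simp only [Matrix.diag_apply, Matrix.mul_apply, LinearMap.toMatrix_apply, Pi.basisFun_apply,
      mulLin_apply, mul_single_eq, Pi.basisFun_repr, gram, Matrix.of_apply]
  conv_lhs => rw [← (Pi.basisFun ℂ (Fin 4)).sum_repr v]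
  simp only [← Module.End.mul_eq_comp] at h ⊢
  simp only [map_sum, map_smul, Finset.mul_sum, mul_smul_comm, Pi.basisFun_apply, h,
    Pi.basisFun_repr, smul_eq_mul, Matrix.mulVec, dotProduct]
  exact Finset.sum_congr rfl fun i _ => mul_comm _ _

theorem mulLin_comm (hc : ∀ i j k, c F i j k t = tensor M i j k) (v w : Fin 4 → ℂ) :
    mulLin F t v w = mulLin F t w v := by
  funext α
  simp only [mulLin_apply, mul_apply, hc]
  rw [Finset.sum_comm]
  exact Finset.sum_congr rfl fun β _ => Finset.sum_congr rfl fun γ _ => by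
    rw [tensor_comm₂₃]
    ring

/-- WDVV in operator form: multiplications commute with each other. Together with commutativity of
the product this is associativity. -/
theorem mulLin_mulLin_comm (hc : ∀ i j k, c F i j k t = tensor M i j k) (hW : WDVV F t)
    (u v w : Fin 4 → ℂ) : mulLin F t u (mulLin F t v w) = mulLin F t v (mulLin F t u w) := by
  rw [wdvv_iff_tensor hc] at hW
  have hW' : ∀ α β γ δ, ∑ l, tensor M α β l * tensor M l.rev δ γ =
      ∑ l, tensor M α δ l * tensor M l.rev β γ := fun α β γ δ => by
    rw [hW α β γ δ, Finset.sum_congr rfl fun l _ => by rw [tensor_comm₁₂ M δ β], hW β δ γ α]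
  have key : ∀ (u v : Fin 4 → ℂ) (α : Fin 4), mulLin F t u (mulLin F t v w) α =
      ∑ β, ∑ δ, ∑ γ, (∑ l, tensor M α.rev β l * tensor M l.rev δ γ) * (u β * v δ * w γ) :=
    fun u v α => by
      simp only [mulLin_apply, mul_apply, hc, Finset.mul_sum, Finset.sum_mul]
      refine Finset.sum_congr rfl fun β _ => ?_
      rw [Finset.sum_comm]
      refine Finset.sum_congr rfl fun δ _ => ?_
      rw [Finset.sum_comm]
      exact Finset.sum_congr rfl fun γ _ => Finset.sum_congr rfl fun l _ => by ring
  funext α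
  rw [key, key, Finset.sum_comm]
  refine Finset.sum_congr rfl fun δ _ => Finset.sum_congr rfl fun β _ =>
    Finset.sum_congr rfl fun γ _ => ?_
  rw [hW', mul_comm (u β)]

theorem mulLin_assoc (hc : ∀ i j k, c F i j k t = tensor M i j k) (hW : WDVV F t)
    (u v w : Fin 4 → ℂ) : mulLin F t (mulLin F t u v) w = mulLin F t u (mulLin F t v w) := by
  rw [mulLin_comm hc _ w, mulLin_mulLin_comm hc hW, mulLin_comm hc w v]

theorem mulLin_one (hc : ∀ i j k, c F i j k t = tensor M i j k) (v : Fin 4 → ℂ) :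
    mulLin F t (Pi.single 0 1) v = v := by
  funext α
  simp only [mulLin_apply, mul_apply, hc]
  rw [Finset.sum_eq_single 0 (fun i _ hi => by simp [hi]) (by simp)]
  simp [tensor_zero₂, eta]

/-- An element of square zero is in the kernel of the Gram matrix; if that is invertible the algebra
is reduced. -/
theorem semisimpleAt_of_det_gram_ne_zero (hc : ∀ i j k, c F i j k t = tensor M i j k)
    (hW : WDVV F t) (hD : (gram F t).det ≠ 0) : SemisimpleAt F t := by
  refine exists_basis_of_bilinear (mulLin F t) (Pi.single 0 1) (mulLin_comm hc)
    (mulLin_assoc hc hW) (mulLin_one hc) (fun v hv => ?_) (by simp)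
  refine Matrix.eq_zero_of_mulVec_eq_zero hD (funext fun β => ?_)
  rw [← trace_mulLin, ← Module.End.mul_eq_comp, LinearMap.trace_mul_comm]
  exact trace_mul_eq_zero_of_sq_eq_zero _ (mulLin_comm hc) (mulLin_assoc hc hW) hv _

end Tangent

/-! ## Density of semi-simple points, and nilpotent algebras -/

section Density

variable {U : Set ℂ} {F G : (Fin 4 → ℂ) → ℂ} {S : Finset (ℕ × ℕ)} {g : ℕ × ℕ → ℂ → ℂ}

theorem mul_congr (hU : IsOpen U) (h : ∀ t ∈ domain U, F t = G t) {t : Fin 4 → ℂ}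
    (ht : t ∈ domain U) : mul F t = mul G t := by
  funext X Y α
  simp only [mul_apply, c_congr hU h _ _ _ ht]

theorem SemisimpleAt.congr (hU : IsOpen U) (h : ∀ t ∈ domain U, F t = G t) {t : Fin 4 → ℂ}
    (ht : t ∈ domain U) (hF : SemisimpleAt F t) : SemisimpleAt G t := by
  rwa [SemisimpleAt, ← mul_congr hU h ht]

theorem NilpotentAt.congr (hU : IsOpen U) (h : ∀ t ∈ domain U, F t = G t) {t : Fin 4 → ℂ}
    (ht : t ∈ domain U) (hF : NilpotentAt F t) : NilpotentAt G t := by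
  rwa [NilpotentAt, ← mul_congr hU h ht]

theorem WDVV.congr (hU : IsOpen U) (h : ∀ t ∈ domain U, F t = G t) {t : Fin 4 → ℂ}
    (ht : t ∈ domain U) (hF : WDVV F t) : WDVV G t := by
  intro α β γ δ
  simp only [← c_congr hU h _ _ _ ht]
  exact hF α β γ δ

theorem IsSemisimple.congr (hU : IsOpen U) (h : ∀ t ∈ domain U, F t = G t)
    (hF : IsSemisimple U F) : IsSemisimple U G :=
  hF.trans (closure_mono fun _ ht => ⟨ht.1, ht.2.congr hU h ht.1⟩)

theorem IsSemisimple.exists_semisimpleAt (hne : U.Nonempty) (hF : IsSemisimple U F) :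
    ∃ t ∈ domain U, SemisimpleAt F t := by
  obtain ⟨τ, hτ⟩ := hne
  have h : (fun _ => τ : Fin 4 → ℂ) ∈ closure {t | t ∈ domain U ∧ SemisimpleAt F t} := hF hτ
  obtain ⟨t, ht⟩ := closure_nonempty_iff.1 ⟨_, h⟩
  exact ⟨t, ht⟩

theorem differentiableOn_c (hU : IsOpen U) (hg : ∀ p ∈ S, DifferentiableOn ℂ (g p) U)
    (i j k : Fin 4) : DifferentiableOn ℂ (c (polyPrepotential S g) i j k) (domain U) := by
  refine DifferentiableOn.congr (f := fun t => tensor (fun a b n => coeffSum S g a b n t) i j k)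
    ?_ fun t ht => c_polyPrepotential hU hg i j k ht
  by_cases h : i = 0 ∨ j = 0 ∨ k = 0
  · rcases h with rfl | rfl | rfl
    · simp only [tensor_zero₁, differentiableOn_const]
    · simp only [tensor_zero₂, differentiableOn_const]
    · simp only [tensor_zero₃, differentiableOn_const]
  · push Not at h
    simp only [tensor, h, if_false]
    exact fun t ht => (differentiableAt_coeffSum hU hg _ _ _ ht).differentiableWithinAt

theorem differentiableOn_det_gram (hU : IsOpen U) (hg : ∀ p ∈ S, DifferentiableOn ℂ (g p) U) :
    DifferentiableOn ℂ (fun t => (gram (polyPrepotential S g) t).det) (domain U) := by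
  have h : ∀ i j, DifferentiableOn ℂ (fun t => gram (polyPrepotential S g) t i j) (domain U) :=
    fun i j => by
      simp only [gram, Matrix.of_apply]
      exact DifferentiableOn.fun_sum fun _ _ => DifferentiableOn.fun_sum fun _ _ =>
        (differentiableOn_c hU hg _ _ _).fun_mul (differentiableOn_c hU hg _ _ _)
  simp only [Matrix.det_apply, Fin.prod_univ_four]
  refine DifferentiableOn.fun_sum fun e _ => DifferentiableOn.const_smul ?_ _
  exact (((h _ _).mul (h _ _)).mul (h _ _)).mul (h _ _)

/-- A polynomial Frobenius manifold is semi-simple if the trace form is non-degenerate at one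
point. -/
theorem isSemisimple_of_det_gram_ne_zero (hU : IsOpen U) (hc : IsPreconnected U)
    (hg : ∀ p ∈ S, DifferentiableOn ℂ (g p) U)
    (hW : ∀ t ∈ domain U, WDVV (polyPrepotential S g) t) {a b d τ₀ : ℂ} (hτ₀ : τ₀ ∈ U)
    (h0 : (gram (polyPrepotential S g) ![a, b, d, τ₀]).det ≠ 0) :
    IsSemisimple U (polyPrepotential S g) := by
  set D : (Fin 4 → ℂ) → ℂ := fun t => (gram (polyPrepotential S g) t).det with hD
  have hdD : DifferentiableOn ℂ D (domain U) := differentiableOn_det_gram hU hg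
  have hsub : {t | t ∈ domain U ∧ D t ≠ 0} ⊆
      {t | t ∈ domain U ∧ SemisimpleAt (polyPrepotential S g) t} := fun t ht =>
    ⟨ht.1, semisimpleAt_of_det_gram_ne_zero (fun i j k => c_polyPrepotential hU hg i j k ht.1)
      (hW t ht.1) ht.2⟩
  refine Subset.trans ?_ (closure_mono hsub)
  -- Density within one fibre t₄ = τ: along the complex line from t to the base point, the
  -- determinant is an entire function that is non-zero at parameter 1, so its non-zeros accumulate
  -- at parameter 0.
  have h1 : ∀ τ ∈ U, D ![a, b, d, τ] ≠ 0 → ∀ t : Fin 4 → ℂ, t 3 = τ →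
      t ∈ closure {t | t ∈ domain U ∧ D t ≠ 0} := by
    intro τ hτ hne t ht
    let ℓ : ℂ → Fin 4 → ℂ := fun s => t + s • (![a, b, d, τ] - t)
    have hℓ : ∀ s, ℓ s ∈ domain U := fun s => by
      have : ℓ s 3 = τ := by
        change t 3 + s * (τ - t 3) = τ
        rw [ht, sub_self, mul_zero, add_zero]
      rwa [domain, mem_ofPred_eq, this]
    have h0 : ℓ 0 = t := by simp only [ℓ, zero_smul, add_zero]
    have h1 : ℓ 1 = ![a, b, d, τ] := by simp only [ℓ, one_smul, add_sub_cancel]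
    have hcl := subset_closure_ne_zero isOpen_univ isPreconnected_univ
      (f := fun s => D (ℓ s))
      (hdD.comp (by fun_prop) fun s _ => hℓ s) ⟨1, mem_univ _, by rwa [h1]⟩
      (mem_univ 0)
    have hcont : Continuous ℓ := by fun_prop
    have h2 := map_mem_closure hcont hcl
      (t := {t | t ∈ domain U ∧ D t ≠ 0}) fun s hs => ⟨hℓ s, hs.2⟩
    rwa [h0] at h2
  intro t ht
  rw [← closure_closure]
  -- Density in the direction of t₄, with the base point (a, b, d) fixed; this is where
  -- connectedness of U enters.
  have hcl := subset_closure_ne_zero hU hc (f := fun τ => D ![a, b, d, τ])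
    (hdD.comp (f := fun τ => ![a, b, d, τ])
      (differentiable_pi.2 (fun i => by fin_cases i <;> simp)).differentiableOn
      fun τ hτ => by simpa [domain] using hτ) ⟨τ₀, hτ₀, h0⟩ ht
  have hcont : Continuous fun τ : ℂ => ![t 0, t 1, t 2, τ] := by
    refine continuous_pi fun i => ?_
    fin_cases i <;> simp [continuous_const, continuous_id']
  have h3 := map_mem_closure hcont hcl (t := closure {t | t ∈ domain U ∧ D t ≠ 0})
    fun τ hτ => h1 τ hτ.1 hτ.2 _ (by simp)
  have e : ![t 0, t 1, t 2, t 3] = t := by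
    funext i
    fin_cases i <;> rfl
  rwa [e] at h3

end Density

/-! ### Nilpotent elements when one exponent is at most one -/

section Nilpotent

variable {U : Set ℂ} {F : (Fin 4 → ℂ) → ℂ} {S : Finset (ℕ × ℕ)} {g : ℕ × ℕ → ℂ → ℂ}
  {t : Fin 4 → ℂ} {M : ℕ → ℕ → ℕ → ℂ}

/-- The witness is ∂₂ minus the multiple of ∂₁ that cancels the ∂₂-component of its square. -/
theorem nilpotentAt_of_fst (hc : ∀ i j k, c F i j k t = tensor M i j k) (h₁ : M 3 0 0 = 0)
    (h₂ : M 2 1 0 ^ 2 + 4 * M 2 0 1 = 0) : NilpotentAt F t := by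
  refine ⟨![-(1 / 2) * M 2 1 0, 1, 0, 0], fun h => one_ne_zero (congrFun h 1), ?_⟩
  rw [mul_self_eq hc]
  funext i
  fin_cases i <;> simp [h₁]
  linear_combination 1 / 4 * h₂

theorem nilpotentAt_of_snd (hc : ∀ i j k, c F i j k t = tensor M i j k) (h₁ : M 0 3 0 = 0)
    (h₂ : M 1 2 0 ^ 2 + 4 * M 0 2 1 = 0) : NilpotentAt F t := by
  refine ⟨![-(1 / 2) * M 1 2 0, 0, 1, 0], fun h => one_ne_zero (congrFun h 2), ?_⟩
  rw [mul_self_eq hc]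
  funext i
  fin_cases i <;> simp [h₁]
  linear_combination 1 / 4 * h₂

theorem associative_coeffSum (hU : IsOpen U) (hg : ∀ p ∈ S, DifferentiableOn ℂ (g p) U)
    (ht : t ∈ domain U) : WDVV (polyPrepotential S g) t ↔
      Associative fun a b n => coeffSum S g a b n t :=
  wdvv_iff_associative fun i j k => c_polyPrepotential hU hg i j k ht

theorem coeffSum_eq_insert {q : ℕ × ℕ} (hq : q ∈ S) (a b n : ℕ) (t : Fin 4 → ℂ) :
    coeffSum S g a b n t = (q.1.descFactorial a * t 1 ^ (q.1 - a)) *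
      (q.2.descFactorial b * t 2 ^ (q.2 - b)) * iteratedDeriv n (g q) (t 3) +
        coeffSum (S.erase q) g a b n t := by
  rw [coeffSum, ← Finset.add_sum_erase S _ hq, coeffSum]

/-- A second t₂-derivative only sees the pivot, so ∂₂³ of the non-trivial part is zero, and the
remaining condition for ∂₂ to have a nilpotent translate is a Riccati equation for the pivot
coefficient. -/
theorem nilpotentAt_of_fst_le_one (hU : IsOpen U) (hg : ∀ p ∈ S, DifferentiableOn ℂ (g p) U)
    (h2 : (2, 2) ∈ S) (hS : ∀ p ∈ S, p = (2, 2) ∨ p.1 ≤ 1)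
    (hW : ∀ t ∈ domain U, WDVV (polyPrepotential S g) t) (ht : t ∈ domain U) :
    NilpotentAt (polyPrepotential S g) t := by
  have hE : ∀ p ∈ S.erase (2, 2), p.1 ≤ 1 := fun p hp =>
    (hS p (Finset.mem_of_mem_erase hp)).resolve_left (Finset.ne_of_mem_erase hp)
  have hz : ∀ a b n, 2 ≤ a → ∀ t, coeffSum (S.erase (2, 2)) g a b n t = 0 := fun a b n ha t =>
    Finset.sum_eq_zero fun p hp => by
      rw [Nat.descFactorial_of_lt (by have := hE p hp; omega)]
      simp
  have hind : ∀ b n (x x' y τ : ℂ), coeffSum (S.erase (2, 2)) g 1 b n ![0, x, y, τ] =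
      coeffSum (S.erase (2, 2)) g 1 b n ![0, x', y, τ] := fun b n x x' y τ =>
    Finset.sum_congr rfl fun p hp => by
      rw [Nat.sub_eq_zero_of_le (hE p hp)]
      simp
  have hM := fun a b n t => coeffSum_eq_insert (g := g) h2 a b n t
  -- In the relation `e₁` the other monomials contribute to ∂₂ of the non-trivial part only terms
  -- independent of t₂. The difference between t₂ = 1 and t₂ = 0 therefore isolates the pivot
  -- coefficient.
  have key : deriv (g (2, 2)) (t 3) = -2 * g (2, 2) (t 3) ^ 2 := by
    have e1 := ((associative_coeffSum hU hg (t := ![0, 1, 1, t 3])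
      (by simpa [domain] using ht)).1 (hW _ (by simpa [domain] using ht))).e₁
    have e0 := ((associative_coeffSum hU hg (t := ![0, 0, 1, t 3])
      (by simpa [domain] using ht)).1 (hW _ (by simpa [domain] using ht))).e₁
    simp only [hM, hz 2 _ _ le_rfl, hz 3 _ _ (by norm_num)] at e0 e1
    rw [hind _ _ 1 0, hind _ _ 1 0] at e1
    simp [Nat.descFactorial] at e0 e1
    linear_combination (1 / 8) * (e1 - e0)
  refine nilpotentAt_of_fst (fun i j k => c_polyPrepotential hU hg i j k ht) ?_ ?_
  · simp [hM, hz 3]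
  · simp only [hM, hz 2 _ _ le_rfl]
    simp [Nat.descFactorial]
    linear_combination 8 * t 2 ^ 2 * key

theorem nilpotentAt_of_snd_le_one (hU : IsOpen U) (hg : ∀ p ∈ S, DifferentiableOn ℂ (g p) U)
    (h2 : (2, 2) ∈ S) (hS : ∀ p ∈ S, p = (2, 2) ∨ p.2 ≤ 1)
    (hW : ∀ t ∈ domain U, WDVV (polyPrepotential S g) t) (ht : t ∈ domain U) :
    NilpotentAt (polyPrepotential S g) t := by
  have hE : ∀ p ∈ S.erase (2, 2), p.2 ≤ 1 := fun p hp =>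
    (hS p (Finset.mem_of_mem_erase hp)).resolve_left (Finset.ne_of_mem_erase hp)
  have hz : ∀ a b n, 2 ≤ b → ∀ t, coeffSum (S.erase (2, 2)) g a b n t = 0 := fun a b n ha t =>
    Finset.sum_eq_zero fun p hp => by
      rw [p.2.descFactorial_of_lt (by have := hE p hp; omega)]
      simp
  have hind : ∀ a n (x y y' τ : ℂ), coeffSum (S.erase (2, 2)) g a 1 n ![0, x, y, τ] =
      coeffSum (S.erase (2, 2)) g a 1 n ![0, x, y', τ] := fun a n x y y' τ =>
    Finset.sum_congr rfl fun p hp => by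
      rw [Nat.sub_eq_zero_of_le (hE p hp)]
      simp
  have hM := fun a b n t => coeffSum_eq_insert (g := g) h2 a b n t
  have key : deriv (g (2, 2)) (t 3) = -2 * g (2, 2) (t 3) ^ 2 := by
    have e1 := ((associative_coeffSum hU hg (t := ![0, 1, 1, t 3])
      (by simpa [domain] using ht)).1 (hW _ (by simpa [domain] using ht))).e₁
    have e0 := ((associative_coeffSum hU hg (t := ![0, 1, 0, t 3])
      (by simpa [domain] using ht)).1 (hW _ (by simpa [domain] using ht))).e₁
    simp only [hM, hz _ 2 _ le_rfl, hz _ 3 _ (by norm_num)] at e0 e1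
    rw [hind _ _ _ 1 0, hind _ _ _ 1 0] at e1
    simp [Nat.descFactorial] at e0 e1
    linear_combination (1 / 8) * (e1 - e0)
  refine nilpotentAt_of_snd (fun i j k => c_polyPrepotential hU hg i j k ht) ?_ ?_
  · simp [hM, hz _ 3]
  · simp only [hM, hz _ 2 _ le_rfl]
    simp [Nat.descFactorial]
    linear_combination 8 * t 1 ^ 2 * key

theorem fst_le_one_of_mem_nonPivotSolutions {σ : ℝ} (h0 : 0 < σ) (h1 : σ ≤ 1 / 2)
    (h2 : σ ≠ 1 / 2) (h3 : σ ≠ 1 / 3) {p : ℕ × ℕ} (hp : p ∈ nonPivotSolutions σ) : p.1 ≤ 1 := by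
  obtain ⟨hne, h⟩ := hp
  have hlt : σ < 1 / 2 := lt_of_le_of_ne h1 h2
  by_contra hcon
  push Not at hcon
  have hb : (0 : ℝ) ≤ p.2 := Nat.cast_nonneg _
  have h4 : p.1 < 4 := by
    by_contra h4
    have h4' : (4 : ℝ) ≤ p.1 := by exact_mod_cast not_lt.1 h4
    nlinarith
  obtain ⟨a, b⟩ := p
  simp only at *
  interval_cases a
  · have : (b : ℝ) = 2 := by
      have : σ * ((b : ℝ) - 2) = 0 := by push_cast at h; linarith
      rcases mul_eq_zero.1 this with h | h <;> linarith
    exact hne (by rw [show b = 2 by exact_mod_cast this])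
  · have hb3 : σ * (3 - (b : ℝ)) = 1 := by push_cast at h; linarith
    have hlt : b < 3 := by
      by_contra h5
      have : (3 : ℝ) ≤ b := by exact_mod_cast not_lt.1 h5
      nlinarith
    interval_cases b
    · exact h3 (by push_cast at hb3; linarith)
    · exact h2 (by push_cast at hb3; linarith)
    · push_cast at hb3
      linarith

theorem nilpotentAt_of_ne_half_of_ne_third {σ : ℝ} (h0 : 0 < σ) (h1 : σ ≤ 1 / 2)
    (h2 : σ ≠ 1 / 2) (h3 : σ ≠ 1 / 3) (hU : IsOpen U) (hF : IsPolynomialFrobenius σ U F)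
    (ht : t ∈ domain U) : NilpotentAt F t := by
  classical
  obtain ⟨S, g, hg, hS, hg0, h⟩ := hF.exists_eq hU
  rw [polyPrepotential_of_subset (Finset.subset_insert (2, 2) S) hg0] at h
  refine NilpotentAt.congr hU (fun t ht => (h t ht).symm) ht
    (nilpotentAt_of_fst_le_one hU (fun p _ => hg p) (Finset.mem_insert_self _ _) (fun p hp => ?_)
      (fun t ht => (hF.wdvv t ht).congr hU h ht) ht)
  rcases Finset.mem_insert.1 hp with hp | hp
  · exact Or.inl hp
  · exact (hS p hp).imp_right (fst_le_one_of_mem_nonPivotSolutions h0 h1 h2 h3)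

end Nilpotent

/-! ## The prepotentials for `σ = 1/2` and `σ = 1/3` as polynomial prepotentials -/

section Coefficients

variable {U : Set ℂ}

/-- The monomials for `σ = 1/2`. -/
def monomialsHalf : Finset (ℕ × ℕ) := {(2, 2), (0, 4), (1, 3), (3, 1), (4, 0)}

/-- The monomials for `σ = 1/3`. -/
def monomialsThird : Finset (ℕ × ℕ) := {(2, 2), (0, 6), (1, 4), (3, 0)}

/-- The coefficients of the prepotential for `σ = 1/2`. -/
noncomputable def coeffHalf (γ g₁ g₂ g₃ g₄ : ℂ → ℂ) : ℕ × ℕ → ℂ → ℂ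
  | (2, 2) => fun τ => -1 / 4 * γ τ
  | (0, 4) => g₁
  | (1, 3) => g₂
  | (3, 1) => g₃
  | (4, 0) => g₄
  | _ => fun _ => 0

/-- The coefficients of the prepotential for `σ = 1/3`. -/
noncomputable def coeffThird (γ g₁ g₃ g₄ : ℂ → ℂ) : ℕ × ℕ → ℂ → ℂ
  | (2, 2) => fun τ => -1 / 4 * γ τ
  | (0, 6) => g₄
  | (1, 4) => g₃
  | (3, 0) => g₁
  | _ => fun _ => 0

theorem sum_monomialsHalf (f : ℕ × ℕ → ℂ) : ∑ p ∈ monomialsHalf, f p =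
    f (2, 2) + (f (0, 4) + (f (1, 3) + (f (3, 1) + f (4, 0)))) := by
  rw [monomialsHalf, Finset.sum_insert (by decide), Finset.sum_insert (by decide),
    Finset.sum_insert (by decide), Finset.sum_insert (by decide), Finset.sum_singleton]

theorem sum_monomialsThird (f : ℕ × ℕ → ℂ) : ∑ p ∈ monomialsThird, f p =
    f (2, 2) + (f (0, 6) + (f (1, 4) + f (3, 0))) := by
  rw [monomialsThird, Finset.sum_insert (by decide), Finset.sum_insert (by decide),
    Finset.sum_insert (by decide), Finset.sum_singleton]

theorem prepotentialHalf_eq (γ g₁ g₂ g₃ g₄ : ℂ → ℂ) : prepotentialHalf γ g₁ g₂ g₃ g₄ =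
    polyPrepotential monomialsHalf (coeffHalf γ g₁ g₂ g₃ g₄) := by
  funext t
  rw [polyPrepotential, sum_monomialsHalf, prepotentialHalf]
  simp only [coeffHalf]
  ring

theorem prepotentialThird_eq (γ g₁ g₃ g₄ : ℂ → ℂ) : prepotentialThird γ g₁ g₃ g₄ =
    polyPrepotential monomialsThird (coeffThird γ g₁ g₃ g₄) := by
  funext t
  rw [polyPrepotential, sum_monomialsThird, prepotentialThird]
  simp only [coeffThird]
  ring

theorem differentiableOn_coeffHalf {γ g₁ g₂ g₃ g₄ : ℂ → ℂ} (hγ : DifferentiableOn ℂ γ U)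
    (h₁ : DifferentiableOn ℂ g₁ U) (h₂ : DifferentiableOn ℂ g₂ U) (h₃ : DifferentiableOn ℂ g₃ U)
    (h₄ : DifferentiableOn ℂ g₄ U) (p : ℕ × ℕ) :
    DifferentiableOn ℂ (coeffHalf γ g₁ g₂ g₃ g₄ p) U := by
  unfold coeffHalf
  split <;> first | assumption | fun_prop

theorem differentiableOn_coeffThird {γ g₁ g₃ g₄ : ℂ → ℂ} (hγ : DifferentiableOn ℂ γ U)
    (h₁ : DifferentiableOn ℂ g₁ U) (h₃ : DifferentiableOn ℂ g₃ U)
    (h₄ : DifferentiableOn ℂ g₄ U) (p : ℕ × ℕ) :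
    DifferentiableOn ℂ (coeffThird γ g₁ g₃ g₄ p) U := by
  unfold coeffThird
  split <;> first | assumption | fun_prop

/-- The derivatives of the non-trivial part of the prepotential for `σ = 1/2`, in terms of the
derivatives of its coefficients. -/
noncomputable def jetHalf (x y : ℂ) (γ g₁ g₂ g₃ g₄ : ℕ → ℂ) (a b n : ℕ) : ℂ :=
  (Nat.descFactorial 2 a * x ^ (2 - a)) * (Nat.descFactorial 2 b * y ^ (2 - b)) * (-1 / 4 * γ n)
    + (Nat.descFactorial 0 a * x ^ (0 - a)) * (Nat.descFactorial 4 b * y ^ (4 - b)) * g₁ n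
    + (Nat.descFactorial 1 a * x ^ (1 - a)) * (Nat.descFactorial 3 b * y ^ (3 - b)) * g₂ n
    + (Nat.descFactorial 3 a * x ^ (3 - a)) * (Nat.descFactorial 1 b * y ^ (1 - b)) * g₃ n
    + (Nat.descFactorial 4 a * x ^ (4 - a)) * (Nat.descFactorial 0 b * y ^ (0 - b)) * g₄ n

/-- The derivatives of the non-trivial part of the prepotential for `σ = 1/3`, in terms of the
derivatives of its coefficients. -/
noncomputable def jetThird (x y : ℂ) (γ g₁ g₃ g₄ : ℕ → ℂ) (a b n : ℕ) : ℂ :=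
  (Nat.descFactorial 2 a * x ^ (2 - a)) * (Nat.descFactorial 2 b * y ^ (2 - b)) * (-1 / 4 * γ n)
    + (Nat.descFactorial 0 a * x ^ (0 - a)) * (Nat.descFactorial 6 b * y ^ (6 - b)) * g₄ n
    + (Nat.descFactorial 1 a * x ^ (1 - a)) * (Nat.descFactorial 4 b * y ^ (4 - b)) * g₃ n
    + (Nat.descFactorial 3 a * x ^ (3 - a)) * (Nat.descFactorial 0 b * y ^ (0 - b)) * g₁ n

theorem coeffSum_half (γ g₁ g₂ g₃ g₄ : ℂ → ℂ) (t : Fin 4 → ℂ) :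
    (fun a b n => coeffSum monomialsHalf (coeffHalf γ g₁ g₂ g₃ g₄) a b n t) =
      jetHalf (t 1) (t 2) (iteratedDeriv · γ (t 3)) (iteratedDeriv · g₁ (t 3))
        (iteratedDeriv · g₂ (t 3)) (iteratedDeriv · g₃ (t 3)) (iteratedDeriv · g₄ (t 3)) := by
  funext a b n
  rw [coeffSum, sum_monomialsHalf, jetHalf]
  simp only [coeffHalf, iteratedDeriv_const_mul_field]
  ring

theorem coeffSum_third (γ g₁ g₃ g₄ : ℂ → ℂ) (t : Fin 4 → ℂ) :
    (fun a b n => coeffSum monomialsThird (coeffThird γ g₁ g₃ g₄) a b n t) =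
      jetThird (t 1) (t 2) (iteratedDeriv · γ (t 3)) (iteratedDeriv · g₁ (t 3))
        (iteratedDeriv · g₃ (t 3)) (iteratedDeriv · g₄ (t 3)) := by
  funext a b n
  rw [coeffSum, sum_monomialsThird, jetThird]
  simp only [coeffThird, iteratedDeriv_const_mul_field]
  ring

theorem wdvv_prepotentialHalf_iff (hU : IsOpen U) {γ g₁ g₂ g₃ g₄ : ℂ → ℂ}
    (hγ : DifferentiableOn ℂ γ U) (h₁ : DifferentiableOn ℂ g₁ U) (h₂ : DifferentiableOn ℂ g₂ U)
    (h₃ : DifferentiableOn ℂ g₃ U) (h₄ : DifferentiableOn ℂ g₄ U) {t : Fin 4 → ℂ}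
    (ht : t ∈ domain U) : WDVV (prepotentialHalf γ g₁ g₂ g₃ g₄) t ↔
      Associative (jetHalf (t 1) (t 2) (iteratedDeriv · γ (t 3)) (iteratedDeriv · g₁ (t 3))
        (iteratedDeriv · g₂ (t 3)) (iteratedDeriv · g₃ (t 3)) (iteratedDeriv · g₄ (t 3))) := by
  rw [prepotentialHalf_eq, associative_coeffSum hU
    (fun p _ => differentiableOn_coeffHalf hγ h₁ h₂ h₃ h₄ p) ht, coeffSum_half]

theorem wdvv_prepotentialThird_iff (hU : IsOpen U) {γ g₁ g₃ g₄ : ℂ → ℂ}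
    (hγ : DifferentiableOn ℂ γ U) (h₁ : DifferentiableOn ℂ g₁ U)
    (h₃ : DifferentiableOn ℂ g₃ U) (h₄ : DifferentiableOn ℂ g₄ U) {t : Fin 4 → ℂ}
    (ht : t ∈ domain U) : WDVV (prepotentialThird γ g₁ g₃ g₄) t ↔
      Associative (jetThird (t 1) (t 2) (iteratedDeriv · γ (t 3)) (iteratedDeriv · g₁ (t 3))
        (iteratedDeriv · g₃ (t 3)) (iteratedDeriv · g₄ (t 3))) := by
  rw [prepotentialThird_eq, associative_coeffSum hU
    (fun p _ => differentiableOn_coeffThird hγ h₁ h₃ h₄ p) ht, coeffSum_third]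

theorem c_prepotentialHalf (hU : IsOpen U) {γ g₁ g₂ g₃ g₄ : ℂ → ℂ}
    (hγ : DifferentiableOn ℂ γ U) (h₁ : DifferentiableOn ℂ g₁ U) (h₂ : DifferentiableOn ℂ g₂ U)
    (h₃ : DifferentiableOn ℂ g₃ U) (h₄ : DifferentiableOn ℂ g₄ U) {t : Fin 4 → ℂ}
    (ht : t ∈ domain U) (i j k : Fin 4) : c (prepotentialHalf γ g₁ g₂ g₃ g₄) i j k t =
      tensor (jetHalf (t 1) (t 2) (iteratedDeriv · γ (t 3)) (iteratedDeriv · g₁ (t 3))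
        (iteratedDeriv · g₂ (t 3)) (iteratedDeriv · g₃ (t 3)) (iteratedDeriv · g₄ (t 3))) i j k := by
  rw [prepotentialHalf_eq, c_polyPrepotential hU
    (fun p _ => differentiableOn_coeffHalf hγ h₁ h₂ h₃ h₄ p) _ _ _ ht, coeffSum_half]

theorem c_prepotentialThird (hU : IsOpen U) {γ g₁ g₃ g₄ : ℂ → ℂ}
    (hγ : DifferentiableOn ℂ γ U) (h₁ : DifferentiableOn ℂ g₁ U)
    (h₃ : DifferentiableOn ℂ g₃ U) (h₄ : DifferentiableOn ℂ g₄ U) {t : Fin 4 → ℂ}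
    (ht : t ∈ domain U) (i j k : Fin 4) : c (prepotentialThird γ g₁ g₃ g₄) i j k t =
      tensor (jetThird (t 1) (t 2) (iteratedDeriv · γ (t 3)) (iteratedDeriv · g₁ (t 3))
        (iteratedDeriv · g₃ (t 3)) (iteratedDeriv · g₄ (t 3))) i j k := by
  rw [prepotentialThird_eq, c_polyPrepotential hU
    (fun p _ => differentiableOn_coeffThird hγ h₁ h₃ h₄ p) _ _ _ ht, coeffSum_third]

theorem iteratedDeriv_two' (f : ℂ → ℂ) : iteratedDeriv 2 f = deriv (deriv f) := by
  rw [iteratedDeriv_succ, iteratedDeriv_one]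

theorem iteratedDeriv_three' (f : ℂ → ℂ) : iteratedDeriv 3 f = deriv (deriv (deriv f)) := by
  rw [iteratedDeriv_succ, iteratedDeriv_two']

/-- The sequence of derivatives of a function up to the third one. -/
theorem iteratedDeriv_eq_of_hasDerivAt (hU : IsOpen U) {f f₁ f₂ f₃ : ℂ → ℂ}
    (h₁ : ∀ τ ∈ U, HasDerivAt f (f₁ τ) τ) (h₂ : ∀ τ ∈ U, HasDerivAt f₁ (f₂ τ) τ)
    (h₃ : ∀ τ ∈ U, HasDerivAt f₂ (f₃ τ) τ) {τ : ℂ} (hτ : τ ∈ U) :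
    iteratedDeriv 1 f τ = f₁ τ ∧ iteratedDeriv 2 f τ = f₂ τ ∧ iteratedDeriv 3 f τ = f₃ τ := by
  have e1 : ∀ τ ∈ U, deriv f τ = f₁ τ := fun τ hτ => (h₁ τ hτ).deriv
  have e2 : ∀ τ ∈ U, deriv (deriv f) τ = f₂ τ := fun τ hτ => by
    rw [deriv_eq_of_mem hU e1 hτ, (h₂ τ hτ).deriv]
  refine ⟨?_, ?_, ?_⟩
  · rw [iteratedDeriv_one, e1 τ hτ]
  · rw [iteratedDeriv_two', e2 τ hτ]
  · rw [iteratedDeriv_three', deriv_eq_of_mem hU e2 hτ, (h₃ τ hτ).deriv]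

/-- A polynomial Frobenius manifold with `σ = 1/2`. -/
theorem IsPolynomialFrobenius.exists_prepotentialHalf (hU : IsOpen U) {F : (Fin 4 → ℂ) → ℂ}
    (hF : IsPolynomialFrobenius (1 / 2) U F) : ∃ γ g₁ g₂ g₃ g₄ : ℂ → ℂ,
      DifferentiableOn ℂ γ U ∧ DifferentiableOn ℂ g₁ U ∧ DifferentiableOn ℂ g₂ U ∧
      DifferentiableOn ℂ g₃ U ∧ DifferentiableOn ℂ g₄ U ∧
      ∀ t ∈ domain U, F t = prepotentialHalf γ g₁ g₂ g₃ g₄ t := by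
  obtain ⟨S, g, hg, hS, hg0, h⟩ := hF.exists_eq hU
  have hsub : S ⊆ monomialsHalf := fun p hp => by
    rcases hS p hp with rfl | h
    · decide
    · rw [nonPivotSolutions_half] at h
      rcases h with rfl | rfl | rfl | rfl <;> decide
  refine ⟨fun τ => -4 * g (2, 2) τ, g (0, 4), g (1, 3), g (3, 1), g (4, 0), (hg _).const_mul _,
    hg _, hg _, hg _, hg _, fun t ht => ?_⟩
  rw [h t ht, polyPrepotential_of_subset hsub hg0, polyPrepotential, sum_monomialsHalf,
    prepotentialHalf]
  ring

/-- A polynomial Frobenius manifold with `σ = 1/3`. -/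
theorem IsPolynomialFrobenius.exists_prepotentialThird (hU : IsOpen U) {F : (Fin 4 → ℂ) → ℂ}
    (hF : IsPolynomialFrobenius (1 / 3) U F) : ∃ γ g₁ g₃ g₄ : ℂ → ℂ,
      DifferentiableOn ℂ γ U ∧ DifferentiableOn ℂ g₁ U ∧
      DifferentiableOn ℂ g₃ U ∧ DifferentiableOn ℂ g₄ U ∧
      ∀ t ∈ domain U, F t = prepotentialThird γ g₁ g₃ g₄ t := by
  obtain ⟨S, g, hg, hS, hg0, h⟩ := hF.exists_eq hU
  have hsub : S ⊆ monomialsThird := fun p hp => by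
    rcases hS p hp with rfl | h
    · decide
    · rw [nonPivotSolutions_third] at h
      rcases h with rfl | rfl | rfl <;> decide
  refine ⟨fun τ => -4 * g (2, 2) τ, g (3, 0), g (1, 4), g (0, 6), (hg _).const_mul _,
    hg _, hg _, hg _, fun t ht => ?_⟩
  rw [h t ht, polyPrepotential_of_subset hsub hg0, polyPrepotential, sum_monomialsThird,
    prepotentialThird]
  ring

theorem IsPolynomialFrobenius.of_eq (hU : IsOpen U) {σ : ℝ} {F : (Fin 4 → ℂ) → ℂ}
    {S : Finset (ℕ × ℕ)} {g : ℕ × ℕ → ℂ → ℂ} (hg : ∀ p ∈ S, DifferentiableOn ℂ (g p) U)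
    (h : ∀ t ∈ domain U, F t = polyPrepotential S g t)
    (hS : ∀ p ∈ S, p = (2, 2) ∨ p ∈ nonPivotSolutions σ)
    (hW : ∀ t ∈ domain U, WDVV (polyPrepotential S g) t) : IsPolynomialFrobenius σ U F where
  polynomial := ⟨S, g, hg, h⟩
  metric t ht i j := by
    rw [c_congr hU h _ _ _ ht, c_polyPrepotential hU hg _ _ _ ht, tensor_zero₁]
  wdvv t ht := (hW t ht).congr hU (fun t ht => (h t ht).symm) ht
  euler t ht := ((quasihomogeneous_polyPrepotential_iff_monomials hU hg σ).2
    (fun p hp _ => hS p hp) t ht).congr hU (fun t ht => (h t ht).symm) ht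

theorem isPolynomialFrobenius_half (hU : IsOpen U) {F : (Fin 4 → ℂ) → ℂ} {γ g₁ g₂ g₃ g₄ : ℂ → ℂ}
    (hγ : DifferentiableOn ℂ γ U) (h₁ : DifferentiableOn ℂ g₁ U) (h₂ : DifferentiableOn ℂ g₂ U)
    (h₃ : DifferentiableOn ℂ g₃ U) (h₄ : DifferentiableOn ℂ g₄ U)
    (h : ∀ t ∈ domain U, F t = prepotentialHalf γ g₁ g₂ g₃ g₄ t)
    (hW : ∀ t ∈ domain U, WDVV (prepotentialHalf γ g₁ g₂ g₃ g₄) t) :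
    IsPolynomialFrobenius (1 / 2) U F := by
  rw [prepotentialHalf_eq] at h hW
  refine .of_eq hU (fun p _ => differentiableOn_coeffHalf hγ h₁ h₂ h₃ h₄ p) h (fun p hp => ?_) hW
  rw [nonPivotSolutions_half]
  simpa [monomialsHalf, or_comm, or_left_comm, or_assoc] using hp

theorem isPolynomialFrobenius_third (hU : IsOpen U) {F : (Fin 4 → ℂ) → ℂ} {γ g₁ g₃ g₄ : ℂ → ℂ}
    (hγ : DifferentiableOn ℂ γ U) (h₁ : DifferentiableOn ℂ g₁ U)
    (h₃ : DifferentiableOn ℂ g₃ U) (h₄ : DifferentiableOn ℂ g₄ U)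
    (h : ∀ t ∈ domain U, F t = prepotentialThird γ g₁ g₃ g₄ t)
    (hW : ∀ t ∈ domain U, WDVV (prepotentialThird γ g₁ g₃ g₄) t) :
    IsPolynomialFrobenius (1 / 3) U F := by
  rw [prepotentialThird_eq] at h hW
  refine .of_eq hU (fun p _ => differentiableOn_coeffThird hγ h₁ h₃ h₄ p) h (fun p hp => ?_) hW
  rw [nonPivotSolutions_third]
  simpa [monomialsThird, or_comm, or_left_comm, or_assoc] using hp

theorem gram_eq {F : (Fin 4 → ℂ) → ℂ} {t : Fin 4 → ℂ} {M : ℕ → ℕ → ℕ → ℂ}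
    (hc : ∀ i j k, c F i j k t = tensor M i j k) : gram F t =
      !![4, 2 * M 2 1 0, 2 * M 1 2 0, 2 * M 1 1 1;
        2 * M 2 1 0, 2 * M 1 2 0 * M 3 0 0 + 2 * M 2 1 0 ^ 2 + 4 * M 2 0 1,
          M 0 3 0 * M 3 0 0 + 3 * M 1 2 0 * M 2 1 0 + 4 * M 1 1 1,
          M 0 2 1 * M 3 0 0 + 2 * M 1 1 1 * M 2 1 0 + M 1 2 0 * M 2 0 1 + 3 * M 1 0 2;
        2 * M 1 2 0, M 0 3 0 * M 3 0 0 + 3 * M 1 2 0 * M 2 1 0 + 4 * M 1 1 1,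
          2 * M 0 3 0 * M 2 1 0 + 2 * M 1 2 0 ^ 2 + 4 * M 0 2 1,
          M 0 2 1 * M 2 1 0 + M 0 3 0 * M 2 0 1 + 2 * M 1 1 1 * M 1 2 0 + 3 * M 0 1 2;
        2 * M 1 1 1, M 0 2 1 * M 3 0 0 + 2 * M 1 1 1 * M 2 1 0 + M 1 2 0 * M 2 0 1 + 3 * M 1 0 2,
          M 0 2 1 * M 2 1 0 + M 0 3 0 * M 2 0 1 + 2 * M 1 1 1 * M 1 2 0 + 3 * M 0 1 2,
          2 * M 0 2 1 * M 2 0 1 + 2 * M 1 1 1 ^ 2 + 2 * M 0 0 3] := by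
  ext β δ
  simp only [gram, Matrix.of_apply, hc]
  fin_cases β <;> fin_cases δ <;>
    simp only [Fin.zero_eta, Fin.mk_one, Fin.reduceFinMk, Fin.sum_univ_four, rev_values,
      tensor_zero₁, tensor_zero₂, tensor_zero₃, tensor_values, eta_values, Matrix.cons_val] <;> ring

/-- The determinant of a symmetric matrix of size `4`. -/
theorem det_symm_fin_four (a b c d e f g h i j : ℂ) :
    Matrix.det !![a, b, c, d; b, e, f, g; c, f, h, i; d, g, i, j] =
      a * (e * (h * j - i ^ 2) - f * (f * j - i * g) + g * (f * i - h * g))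
      - b * (b * (h * j - i ^ 2) - f * (c * j - i * d) + g * (c * i - h * d))
      + c * (b * (f * j - i * g) - e * (c * j - i * d) + g * (c * g - f * d))
      - d * (b * (f * i - h * g) - e * (c * i - h * d) + f * (c * g - f * d)) := by
  rw [Matrix.det_succ_row_zero]
  simp [Fin.sum_univ_succ, Matrix.det_fin_three, Fin.succAbove]
  ring

end Coefficients

/-! ## The systems of differential equations imply associativity -/

section Sufficiency

variable {U : Set ℂ}

theorem jetHalf_values (x y : ℂ) (γ g₁ g₂ g₃ g₄ : ℕ → ℂ) :
    let M := jetHalf x y γ g₁ g₂ g₃ g₄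
    M 3 0 0 = 6 * y * g₃ 0 + 24 * x * g₄ 0 ∧
    M 2 1 0 = -y * γ 0 + 6 * x * g₃ 0 ∧
    M 1 2 0 = -x * γ 0 + 6 * y * g₂ 0 ∧
    M 0 3 0 = 24 * y * g₁ 0 + 6 * x * g₂ 0 ∧
    M 2 0 1 = -1 / 2 * y ^ 2 * γ 1 + 6 * x * y * g₃ 1 + 12 * x ^ 2 * g₄ 1 ∧
    M 1 1 1 = -x * y * γ 1 + 3 * y ^ 2 * g₂ 1 + 3 * x ^ 2 * g₃ 1 ∧
    M 0 2 1 = -1 / 2 * x ^ 2 * γ 1 + 12 * y ^ 2 * g₁ 1 + 6 * x * y * g₂ 1 ∧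
    M 1 0 2 = -1 / 2 * x * y ^ 2 * γ 2 + y ^ 3 * g₂ 2 + 3 * x ^ 2 * y * g₃ 2 + 4 * x ^ 3 * g₄ 2 ∧
    M 0 1 2 = -1 / 2 * x ^ 2 * y * γ 2 + 4 * y ^ 3 * g₁ 2 + 3 * x * y ^ 2 * g₂ 2 + x ^ 3 * g₃ 2 ∧
    M 0 0 3 = -1 / 4 * x ^ 2 * y ^ 2 * γ 3 + y ^ 4 * g₁ 3 + x * y ^ 3 * g₂ 3 + x ^ 3 * y * g₃ 3
      + x ^ 4 * g₄ 3 := by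
  refine ⟨?_, ?_, ?_, ?_, ?_, ?_, ?_, ?_, ?_, ?_⟩ <;> norm_num [jetHalf, Nat.descFactorial] <;>
    first | ring1 | exact Or.inl (by ring1)

theorem jetThird_values (x y : ℂ) (γ g₁ g₃ g₄ : ℕ → ℂ) :
    let M := jetThird x y γ g₁ g₃ g₄
    M 3 0 0 = 6 * g₁ 0 ∧
    M 2 1 0 = -y * γ 0 ∧
    M 1 2 0 = -x * γ 0 + 12 * y ^ 2 * g₃ 0 ∧
    M 0 3 0 = 120 * y ^ 3 * g₄ 0 + 24 * x * y * g₃ 0 ∧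
    M 2 0 1 = -1 / 2 * y ^ 2 * γ 1 + 6 * x * g₁ 1 ∧
    M 1 1 1 = -x * y * γ 1 + 4 * y ^ 3 * g₃ 1 ∧
    M 0 2 1 = -1 / 2 * x ^ 2 * γ 1 + 30 * y ^ 4 * g₄ 1 + 12 * x * y ^ 2 * g₃ 1 ∧
    M 1 0 2 = -1 / 2 * x * y ^ 2 * γ 2 + y ^ 4 * g₃ 2 + 3 * x ^ 2 * g₁ 2 ∧
    M 0 1 2 = -1 / 2 * x ^ 2 * y * γ 2 + 6 * y ^ 5 * g₄ 2 + 4 * x * y ^ 3 * g₃ 2 ∧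
    M 0 0 3 = -1 / 4 * x ^ 2 * y ^ 2 * γ 3 + y ^ 6 * g₄ 3 + x * y ^ 4 * g₃ 3 + x ^ 3 * g₁ 3 := by
  refine ⟨?_, ?_, ?_, ?_, ?_, ?_, ?_, ?_, ?_, ?_⟩ <;>
    norm_num [jetThird, Nat.descFactorial] <;> first | ring1 | exact Or.inl (by ring1)

theorem iteratedDeriv_zero_fun (n : ℕ) (τ : ℂ) : iteratedDeriv n (fun _ : ℂ => (0 : ℂ)) τ = 0 := by
  rw [iteratedDeriv_const]
  split_ifs <;> rfl

/-- All derivatives up to order three become polynomials in γ, g₁ and g₁', which reduces WDVV and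
the determinant of the trace form to polynomial identities. -/
theorem CaseI.jets (hU : IsOpen U) {μ : ℂ} {γ g₁ : ℂ → ℂ} (hγ : DifferentiableOn ℂ γ U)
    (hg : DifferentiableOn ℂ g₁ U) (h : CaseI U μ γ g₁) {τ : ℂ} (hτ : τ ∈ U) :
    ∃ γ' γ'' γ''' g' g'' g''', (iteratedDeriv 1 γ τ = γ' ∧ iteratedDeriv 2 γ τ = γ'' ∧
      iteratedDeriv 3 γ τ = γ''') ∧ (iteratedDeriv 1 g₁ τ = g' ∧ iteratedDeriv 2 g₁ τ = g'' ∧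
      iteratedDeriv 3 g₁ τ = g''') ∧ g' = deriv g₁ τ ∧
      γ' = 1 / 2 * γ τ ^ 2 - 288 * μ * g₁ τ ^ 2 ∧
      g'' = 3 * γ τ * g' - 3 * g₁ τ * γ' ∧ γ'' = γ τ * γ' - 576 * μ * g₁ τ * g' ∧
      γ''' = γ' ^ 2 + γ τ * γ'' - 576 * μ * (g' ^ 2 + g₁ τ * g'') ∧
      g''' = 3 * γ τ * g'' - 3 * g₁ τ * γ'' := by
  obtain ⟨p, hp⟩ : ∃ p, p = deriv g₁ := ⟨_, rfl⟩
  obtain ⟨γ₁, e1⟩ : ∃ f, f = fun τ => 1 / 2 * γ τ ^ 2 - 288 * μ * g₁ τ ^ 2 := ⟨_, rfl⟩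
  obtain ⟨q, eq⟩ : ∃ f, f = fun τ => 3 * γ τ * p τ - 3 * g₁ τ * γ₁ τ := ⟨_, rfl⟩
  obtain ⟨γ₂, e2⟩ : ∃ f, f = fun τ => γ τ * γ₁ τ - 576 * μ * g₁ τ * p τ := ⟨_, rfl⟩
  have a1 : ∀ τ ∈ U, HasDerivAt γ (γ₁ τ) τ := fun τ hτ => by
    have := hasDerivAt_of_mem hU hγ hτ
    rwa [(h τ hτ).1, ← congrFun e1 τ] at this
  have b1 : ∀ τ ∈ U, HasDerivAt g₁ (p τ) τ := fun τ hτ => hp ▸ hasDerivAt_of_mem hU hg hτ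
  have b2 : ∀ τ ∈ U, HasDerivAt p (q τ) τ := fun τ hτ => by
    have := hasDerivAt_of_mem hU (hg.deriv hU) hτ
    rwa [(h τ hτ).2, (a1 τ hτ).deriv, ← hp, ← congrFun eq τ] at this
  have a2 : ∀ τ ∈ U, HasDerivAt γ₁ (γ₂ τ) τ := fun τ hτ => by
    rw [e1, e2]
    exact ((((a1 τ hτ).fun_pow 2).const_mul (1 / 2)).fun_sub
      (((b1 τ hτ).fun_pow 2).const_mul (288 * μ))).congr_deriv (by ring)
  have a3 : ∀ τ ∈ U, HasDerivAt γ₂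
      (γ₁ τ ^ 2 + γ τ * γ₂ τ - 576 * μ * (p τ ^ 2 + g₁ τ * q τ)) τ := fun τ hτ => by
    rw [e2]
    exact (((a1 τ hτ).fun_mul (a2 τ hτ)).fun_sub
      (((b1 τ hτ).const_mul (576 * μ)).fun_mul (b2 τ hτ))).congr_deriv (by rw [e2]; ring)
  have b3 : ∀ τ ∈ U, HasDerivAt q (3 * γ τ * q τ - 3 * g₁ τ * γ₂ τ) τ := fun τ hτ => by
    rw [eq]
    exact ((((a1 τ hτ).const_mul 3).fun_mul (b2 τ hτ)).fun_sub
      (((b1 τ hτ).const_mul 3).fun_mul (a2 τ hτ))).congr_deriv (by rw [eq]; ring)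
  exact ⟨_, _, _, _, _, _, iteratedDeriv_eq_of_hasDerivAt hU a1 a2 a3 hτ,
    iteratedDeriv_eq_of_hasDerivAt hU b1 b2 b3 hτ, congrFun hp τ, congrFun e1 τ, congrFun eq τ,
    congrFun e2 τ, rfl, rfl⟩

theorem CaseI.wdvv (hU : IsOpen U) {μ : ℂ} {γ g₁ : ℂ → ℂ} (hγ : DifferentiableOn ℂ γ U)
    (hg : DifferentiableOn ℂ g₁ U) (h : CaseI U μ γ g₁) {t : Fin 4 → ℂ} (ht : t ∈ domain U) :
    WDVV (prepotentialHalf γ g₁ (fun _ => 0) (fun _ => 0) fun τ => μ * g₁ τ) t := by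
  rw [wdvv_prepotentialHalf_iff hU hγ hg (differentiableOn_const 0) (differentiableOn_const 0)
    (hg.const_mul μ) ht]
  obtain ⟨γ', γ'', γ''', g', g'', g''', ⟨h1, h2, h3⟩, ⟨k1, k2, k3⟩, -, r1, r2, r3, r4, r5⟩ :=
    h.jets hU hγ hg ht
  constructor <;>
    simp only [jetHalf_values, iteratedDeriv_const_mul_field, iteratedDeriv_zero_fun,
      iteratedDeriv_zero, h1, h2, h3, k1, k2, k3] <;>
    simp only [r5, r4, r3, r2, r1] <;> ring

/-- One point in a single fibre suffices for density. At t₁ = t₂ = 0, t₃ = 1 most derivatives vanish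
and the non-degeneracy quantity splits off. -/
theorem CaseI.det_gram (hU : IsOpen U) {μ : ℂ} {γ g₁ : ℂ → ℂ} (hγ : DifferentiableOn ℂ γ U)
    (hg : DifferentiableOn ℂ g₁ U) (h : CaseI U μ γ g₁) {τ : ℂ} (hτ : τ ∈ U) :
    (gram (prepotentialHalf γ g₁ (fun _ => 0) (fun _ => 0) fun τ => μ * g₁ τ) ![0, 0, 1, τ]).det =
      764411904 * μ ^ 2 * g₁ τ ^ 4 *
        ((deriv g₁ τ - γ τ * g₁ τ) ^ 2 - 576 * μ * g₁ τ ^ 4) := by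
  have ht : ![0, 0, 1, τ] ∈ domain U := hτ
  rw [gram_eq (c_prepotentialHalf hU hγ hg (differentiableOn_const 0) (differentiableOn_const 0)
    (hg.const_mul μ) ht), det_symm_fin_four]
  obtain ⟨γ', γ'', γ''', g', g'', g''', ⟨h1, h2, h3⟩, ⟨k1, k2, k3⟩, r0, r1, r2, r3, r4, r5⟩ :=
    h.jets hU hγ hg hτ
  simp only [jetHalf_values, iteratedDeriv_const_mul_field, iteratedDeriv_zero_fun,
      iteratedDeriv_zero, h1, h2, h3, k1, k2, k3, Matrix.cons_val]
  rw [← r0]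
  simp only [r5, r4, r3, r2, r1]
  ring

end Sufficiency

/-! ### Case II: associativity and trace form -/

section Sufficiency

variable {U : Set ℂ}

theorem CaseII.jets (hU : IsOpen U) {L : ℂ} {γ g₁ g₄ : ℂ → ℂ} (hγ : DifferentiableOn ℂ γ U)
    (hg₁ : DifferentiableOn ℂ g₁ U) (hg₄ : DifferentiableOn ℂ g₄ U) (h : CaseII U L γ g₁ g₄)
    {τ : ℂ} (hτ : τ ∈ U) :
    ∃ γ' γ'' γ''' a' a'' a''' b' b'' b''', (iteratedDeriv 1 γ τ = γ' ∧ iteratedDeriv 2 γ τ = γ'' ∧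
      iteratedDeriv 3 γ τ = γ''') ∧ (iteratedDeriv 1 g₁ τ = a' ∧ iteratedDeriv 2 g₁ τ = a'' ∧
      iteratedDeriv 3 g₁ τ = a''') ∧ (iteratedDeriv 1 g₄ τ = b' ∧ iteratedDeriv 2 g₄ τ = b'' ∧
      iteratedDeriv 3 g₄ τ = b''') ∧
      γ' = 1 / 2 * γ τ ^ 2 - 288 * g₁ τ * g₄ τ ∧
      a' = γ τ * g₁ τ + 24 * L * g₄ τ ^ 2 ∧ b' = γ τ * g₄ τ + 24 * L⁻¹ * g₁ τ ^ 2 ∧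
      γ'' = γ τ * γ' - 288 * (a' * g₄ τ + g₁ τ * b') ∧
      a'' = γ' * g₁ τ + γ τ * a' + 48 * L * g₄ τ * b' ∧
      b'' = γ' * g₄ τ + γ τ * b' + 48 * L⁻¹ * g₁ τ * a' ∧
      γ''' = γ' ^ 2 + γ τ * γ'' - 288 * (a'' * g₄ τ + 2 * a' * b' + g₁ τ * b'') ∧
      a''' = γ'' * g₁ τ + 2 * γ' * a' + γ τ * a'' + 48 * L * (b' ^ 2 + g₄ τ * b'') ∧
      b''' = γ'' * g₄ τ + 2 * γ' * b' + γ τ * b'' + 48 * L⁻¹ * (a' ^ 2 + g₁ τ * a'') := by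
  obtain ⟨γ₁, e1⟩ : ∃ f, f = fun τ => 1 / 2 * γ τ ^ 2 - 288 * g₁ τ * g₄ τ := ⟨_, rfl⟩
  obtain ⟨p, ep⟩ : ∃ f, f = fun τ => γ τ * g₁ τ + 24 * L * g₄ τ ^ 2 := ⟨_, rfl⟩
  obtain ⟨q, eq⟩ : ∃ f, f = fun τ => γ τ * g₄ τ + 24 * L⁻¹ * g₁ τ ^ 2 := ⟨_, rfl⟩
  obtain ⟨γ₂, e2⟩ : ∃ f, f = fun τ => γ τ * γ₁ τ - 288 * (p τ * g₄ τ + g₁ τ * q τ) := ⟨_, rfl⟩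
  obtain ⟨p₂, ep2⟩ : ∃ f, f = fun τ => γ₁ τ * g₁ τ + γ τ * p τ + 48 * L * g₄ τ * q τ := ⟨_, rfl⟩
  obtain ⟨q₂, eq2⟩ : ∃ f, f = fun τ => γ₁ τ * g₄ τ + γ τ * q τ + 48 * L⁻¹ * g₁ τ * p τ :=
    ⟨_, rfl⟩
  have a1 : ∀ τ ∈ U, HasDerivAt γ (γ₁ τ) τ := fun τ hτ =>
    e1 ▸ (h.hasDerivAt hU hγ hg₁ hg₄ hτ).1
  have b1 : ∀ τ ∈ U, HasDerivAt g₁ (p τ) τ := fun τ hτ =>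
    ep ▸ (h.hasDerivAt hU hγ hg₁ hg₄ hτ).2.1
  have c1 : ∀ τ ∈ U, HasDerivAt g₄ (q τ) τ := fun τ hτ =>
    eq ▸ (h.hasDerivAt hU hγ hg₁ hg₄ hτ).2.2
  have a2 : ∀ τ ∈ U, HasDerivAt γ₁ (γ₂ τ) τ := fun τ hτ => by
    rw [e1, e2]
    exact ((((a1 τ hτ).fun_pow 2).const_mul (1 / 2)).fun_sub
      (((b1 τ hτ).const_mul 288).fun_mul (c1 τ hτ))).congr_deriv (by ring)
  have b2 : ∀ τ ∈ U, HasDerivAt p (p₂ τ) τ := fun τ hτ => by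
    rw [ep, ep2]
    exact (((a1 τ hτ).fun_mul (b1 τ hτ)).fun_add
      (((c1 τ hτ).fun_pow 2).const_mul (24 * L))).congr_deriv (by ring)
  have c2 : ∀ τ ∈ U, HasDerivAt q (q₂ τ) τ := fun τ hτ => by
    rw [eq, eq2]
    exact (((a1 τ hτ).fun_mul (c1 τ hτ)).fun_add
      (((b1 τ hτ).fun_pow 2).const_mul (24 * L⁻¹))).congr_deriv (by ring)
  have a3 : ∀ τ ∈ U, HasDerivAt γ₂ (γ₁ τ ^ 2 + γ τ * γ₂ τ -
      288 * (p₂ τ * g₄ τ + 2 * p τ * q τ + g₁ τ * q₂ τ)) τ := fun τ hτ => by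
    rw [e2]
    exact (((a1 τ hτ).fun_mul (a2 τ hτ)).fun_sub
      ((((b2 τ hτ).fun_mul (c1 τ hτ)).fun_add ((b1 τ hτ).fun_mul (c2 τ hτ))).const_mul
        288)).congr_deriv (by rw [e2]; ring)
  have b3 : ∀ τ ∈ U, HasDerivAt p₂ (γ₂ τ * g₁ τ + 2 * γ₁ τ * p τ + γ τ * p₂ τ +
      48 * L * (q τ ^ 2 + g₄ τ * q₂ τ)) τ := fun τ hτ => by
    rw [ep2]
    exact ((((a2 τ hτ).fun_mul (b1 τ hτ)).fun_add ((a1 τ hτ).fun_mul (b2 τ hτ))).fun_add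
      (((c1 τ hτ).const_mul (48 * L)).fun_mul (c2 τ hτ))).congr_deriv (by rw [ep2]; ring)
  have c3 : ∀ τ ∈ U, HasDerivAt q₂ (γ₂ τ * g₄ τ + 2 * γ₁ τ * q τ + γ τ * q₂ τ +
      48 * L⁻¹ * (p τ ^ 2 + g₁ τ * p₂ τ)) τ := fun τ hτ => by
    rw [eq2]
    exact ((((a2 τ hτ).fun_mul (c1 τ hτ)).fun_add ((a1 τ hτ).fun_mul (c2 τ hτ))).fun_add
      (((b1 τ hτ).const_mul (48 * L⁻¹)).fun_mul (b2 τ hτ))).congr_deriv (by rw [eq2]; ring)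
  exact ⟨_, _, _, _, _, _, _, _, _, iteratedDeriv_eq_of_hasDerivAt hU a1 a2 a3 hτ,
    iteratedDeriv_eq_of_hasDerivAt hU b1 b2 b3 hτ, iteratedDeriv_eq_of_hasDerivAt hU c1 c2 c3 hτ,
    congrFun e1 τ, congrFun ep τ, congrFun eq τ, congrFun e2 τ, congrFun ep2 τ, congrFun eq2 τ,
    rfl, rfl, rfl⟩

theorem CaseII.wdvv (hU : IsOpen U) {K : ℂ} (hK : K ≠ 0) {γ g₁ g₄ : ℂ → ℂ}
    (hγ : DifferentiableOn ℂ γ U) (hg₁ : DifferentiableOn ℂ g₁ U) (hg₄ : DifferentiableOn ℂ g₄ U)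
    (h : CaseII U (4 / K ^ 2) γ g₁ g₄) {t : Fin 4 → ℂ} (ht : t ∈ domain U) :
    WDVV (prepotentialHalf γ g₁ (fun τ => 4 / K * g₄ τ) (fun τ => K * g₁ τ) g₄) t := by
  rw [wdvv_prepotentialHalf_iff hU hγ hg₁ (hg₄.const_mul _) (hg₁.const_mul K) hg₄ ht]
  obtain ⟨γ', γ'', γ''', a', a'', a''', b', b'', b''', ⟨h1, h2, h3⟩, ⟨k1, k2, k3⟩, ⟨l1, l2, l3⟩,
    r1, r2, r3, r4, r5, r6, r7, r8, r9⟩ := h.jets hU hγ hg₁ hg₄ ht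
  constructor <;>
    simp only [jetHalf_values, iteratedDeriv_const_mul_field, iteratedDeriv_zero, h1, h2, h3, k1,
      k2, k3, l1, l2, l3] <;>
    simp only [r9, r8, r7, r6, r5, r4, r3, r2, r1, inv_div] <;> field_simp <;> ring

theorem CaseII.det_gram (hU : IsOpen U) {K : ℂ} (hK : K ≠ 0) {γ g₁ g₄ : ℂ → ℂ}
    (hγ : DifferentiableOn ℂ γ U) (hg₁ : DifferentiableOn ℂ g₁ U) (hg₄ : DifferentiableOn ℂ g₄ U)
    (h : CaseII U (4 / K ^ 2) γ g₁ g₄) {τ : ℂ} (hτ : τ ∈ U) :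
    (gram (prepotentialHalf γ g₁ (fun τ => 4 / K * g₄ τ) (fun τ => K * g₁ τ) g₄)
      ![0, 0, 1, τ]).det = -46438023168 * K ^ 2 * g₁ τ ^ 5 *
        ((4 / K ^ 2)⁻¹ * g₁ τ ^ 3 - 4 / K ^ 2 * g₄ τ ^ 3) := by
  have ht : ![0, 0, 1, τ] ∈ domain U := hτ
  obtain ⟨γ', γ'', γ''', a', a'', a''', b', b'', b''', ⟨h1, h2, h3⟩, ⟨k1, k2, k3⟩, ⟨l1, l2, l3⟩,
    r1, r2, r3, r4, r5, r6, r7, r8, r9⟩ := h.jets hU hγ hg₁ hg₄ hτ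
  -- The entries are reduced to polynomials in g₁, g₄, γ, K and K⁻¹ before the determinant is
  -- expanded.
  have hG : gram (prepotentialHalf γ g₁ (fun τ => 4 / K * g₄ τ) (fun τ => K * g₁ τ) g₄)
      ![0, 0, 1, τ] =
    let a := g₁ τ; let b := g₄ τ; let u := γ τ; let w := K⁻¹
    !![4, -2 * u, 48 * b * w, 144 * K * a ^ 2 + 24 * b * u * w;
      -2 * u, 864 * a * b + u ^ 2, 432 * K * a ^ 2 - 24 * b * u * w,
        144 * K * a ^ 2 * u + 20736 * a * b ^ 2 * w - 12 * b * u ^ 2 * w;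
      48 * b * w, 432 * K * a ^ 2 - 24 * b * u * w, 5760 * b ^ 2 * w ^ 2,
        2880 * b ^ 2 * u * w ^ 2 + 17280 * a ^ 2 * b;
      144 * K * a ^ 2 + 24 * b * u * w,
        144 * K * a ^ 2 * u + 20736 * a * b ^ 2 * w - 12 * b * u ^ 2 * w,
        2880 * b ^ 2 * u * w ^ 2 + 17280 * a ^ 2 * b,
        20736 * K ^ 2 * a ^ 4 + 497664 * a * b ^ 3 * w ^ 2 + 1440 * b ^ 2 * u ^ 2 * w ^ 2
          + 17280 * a ^ 2 * b * u] := by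
    rw [gram_eq (c_prepotentialHalf hU hγ hg₁ (hg₄.const_mul _) (hg₁.const_mul K) hg₄ ht)]
    ext i j
    fin_cases i <;> fin_cases j <;>
      simp only [Fin.zero_eta, Fin.mk_one, Fin.reduceFinMk, Matrix.of_apply, Matrix.cons_val,
        jetHalf_values, iteratedDeriv_const_mul_field, iteratedDeriv_zero, h1, h2, h3, k1, k2, k3,
        l1, l2, l3] <;>
      (try simp only [r9, r8, r7, r6, r5, r4, r3, r2, r1, inv_div]) <;> field_simp <;> ring
  rw [hG, det_symm_fin_four]
  field_simp
  ring

end Sufficiency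

/-! ### Case III: associativity and trace form -/

section Sufficiency

variable {U : Set ℂ}

theorem CaseIII.jets (hU : IsOpen U) {K : ℂ} {γ g₁ : ℂ → ℂ} (hγ : DifferentiableOn ℂ γ U)
    (hg : DifferentiableOn ℂ g₁ U) (h : CaseIII U K γ g₁) {τ : ℂ} (hτ : τ ∈ U) :
    ∃ γ' γ'' γ''' g' g'' g''', (iteratedDeriv 1 γ τ = γ' ∧ iteratedDeriv 2 γ τ = γ'' ∧
      iteratedDeriv 3 γ τ = γ''') ∧ (iteratedDeriv 1 g₁ τ = g' ∧ iteratedDeriv 2 g₁ τ = g'' ∧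
      iteratedDeriv 3 g₁ τ = g''') ∧
      (iteratedDeriv 1 (fun τ => K * g₁ τ ^ 3) τ = K * (3 * g₁ τ ^ 2 * g') ∧
        iteratedDeriv 2 (fun τ => K * g₁ τ ^ 3) τ = K * (6 * g₁ τ * g' ^ 2 + 3 * g₁ τ ^ 2 * g'') ∧
        iteratedDeriv 3 (fun τ => K * g₁ τ ^ 3) τ =
          K * (6 * g' ^ 3 + 18 * g₁ τ * g' * g'' + 3 * g₁ τ ^ 2 * g''')) ∧
      (iteratedDeriv 1 (fun τ => K / 30 * (g₁ τ * deriv g₁ τ - 1 / 2 * g₁ τ ^ 2 * γ τ)) τ =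
          K / 30 * (g' ^ 2 + γ τ * g₁ τ * g' - 3 / 2 * γ' * g₁ τ ^ 2) ∧
        iteratedDeriv 2 (fun τ => K / 30 * (g₁ τ * deriv g₁ τ - 1 / 2 * g₁ τ ^ 2 * γ τ)) τ =
          K / 30 * (2 * g' * g'' + γ τ * (g' ^ 2 + g₁ τ * g'') - 2 * γ' * g₁ τ * g' -
            3 / 2 * γ'' * g₁ τ ^ 2) ∧
        iteratedDeriv 3 (fun τ => K / 30 * (g₁ τ * deriv g₁ τ - 1 / 2 * g₁ τ ^ 2 * γ τ)) τ =
          K / 30 * (2 * g'' ^ 2 + 2 * g' * g''' + γ τ * (3 * g' * g'' + g₁ τ * g''') -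
            γ' * (g' ^ 2 + g₁ τ * g'') - 5 * γ'' * g₁ τ * g' - 3 / 2 * γ''' * g₁ τ ^ 2)) ∧
      g' = deriv g₁ τ ∧
      γ' = 1 / 2 * γ τ ^ 2 - 72 * K * g₁ τ ^ 4 ∧
      g'' = 2 * γ τ * g' - g₁ τ * γ' ∧ γ'' = γ τ * γ' - 288 * K * g₁ τ ^ 3 * g' ∧
      γ''' = γ' ^ 2 + γ τ * γ'' - 288 * K * (3 * g₁ τ ^ 2 * g' ^ 2 + g₁ τ ^ 3 * g'') ∧
      g''' = γ' * g' + 2 * γ τ * g'' - g₁ τ * γ'' := by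
  obtain ⟨p, hp⟩ : ∃ p, p = deriv g₁ := ⟨_, rfl⟩
  obtain ⟨γ₁, e1⟩ : ∃ f, f = fun τ => 1 / 2 * γ τ ^ 2 - 72 * K * g₁ τ ^ 4 := ⟨_, rfl⟩
  obtain ⟨q, eq⟩ : ∃ f, f = fun τ => 2 * γ τ * p τ - g₁ τ * γ₁ τ := ⟨_, rfl⟩
  obtain ⟨γ₂, e2⟩ : ∃ f, f = fun τ => γ τ * γ₁ τ - 288 * K * g₁ τ ^ 3 * p τ := ⟨_, rfl⟩
  obtain ⟨γ₃, e3⟩ : ∃ f, f = fun τ => γ₁ τ ^ 2 + γ τ * γ₂ τ -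
    288 * K * (3 * g₁ τ ^ 2 * p τ ^ 2 + g₁ τ ^ 3 * q τ) := ⟨_, rfl⟩
  obtain ⟨r, er⟩ : ∃ f, f = fun τ => γ₁ τ * p τ + 2 * γ τ * q τ - g₁ τ * γ₂ τ := ⟨_, rfl⟩
  have a1 : ∀ τ ∈ U, HasDerivAt γ (γ₁ τ) τ := fun τ hτ => by
    have := hasDerivAt_of_mem hU hγ hτ
    rwa [(h τ hτ).1, ← congrFun e1 τ] at this
  have b1 : ∀ τ ∈ U, HasDerivAt g₁ (p τ) τ := fun τ hτ => hp ▸ hasDerivAt_of_mem hU hg hτ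
  have b2 : ∀ τ ∈ U, HasDerivAt p (q τ) τ := fun τ hτ => by
    have := hasDerivAt_of_mem hU (hg.deriv hU) hτ
    rwa [(h τ hτ).2, (a1 τ hτ).deriv, ← hp, ← congrFun eq τ] at this
  have a2 : ∀ τ ∈ U, HasDerivAt γ₁ (γ₂ τ) τ := fun τ hτ => by
    rw [e1, e2]
    exact ((((a1 τ hτ).fun_pow 2).const_mul (1 / 2)).fun_sub
      (((b1 τ hτ).fun_pow 4).const_mul (72 * K))).congr_deriv (by ring)
  have a3 : ∀ τ ∈ U, HasDerivAt γ₂ (γ₃ τ) τ := fun τ hτ => by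
    rw [e2]
    exact (((a1 τ hτ).fun_mul (a2 τ hτ)).fun_sub
      ((((b1 τ hτ).fun_pow 3).const_mul (288 * K)).fun_mul (b2 τ hτ))).congr_deriv (by
        rw [e3, e2]
        ring)
  have b3 : ∀ τ ∈ U, HasDerivAt q (r τ) τ := fun τ hτ => by
    rw [eq]
    exact ((((a1 τ hτ).const_mul 2).fun_mul (b2 τ hτ)).fun_sub
      ((b1 τ hτ).fun_mul (a2 τ hτ))).congr_deriv (by rw [er, eq]; ring)
  have c1 : ∀ τ ∈ U, HasDerivAt (fun τ => K * g₁ τ ^ 3) (K * (3 * g₁ τ ^ 2 * p τ)) τ :=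
    fun τ hτ => (((b1 τ hτ).fun_pow 3).const_mul K).congr_deriv (by ring)
  have c2 : ∀ τ ∈ U, HasDerivAt (fun τ => K * (3 * g₁ τ ^ 2 * p τ))
      (K * (6 * g₁ τ * p τ ^ 2 + 3 * g₁ τ ^ 2 * q τ)) τ := fun τ hτ =>
    (((((b1 τ hτ).fun_pow 2).const_mul 3).fun_mul (b2 τ hτ)).const_mul K).congr_deriv (by ring)
  have c3 : ∀ τ ∈ U, HasDerivAt (fun τ => K * (6 * g₁ τ * p τ ^ 2 + 3 * g₁ τ ^ 2 * q τ))
      (K * (6 * p τ ^ 3 + 18 * g₁ τ * p τ * q τ + 3 * g₁ τ ^ 2 * r τ)) τ := fun τ hτ =>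
    (((((b1 τ hτ).const_mul 6).fun_mul ((b2 τ hτ).fun_pow 2)).fun_add
      ((((b1 τ hτ).fun_pow 2).const_mul 3).fun_mul (b3 τ hτ))).const_mul K).congr_deriv (by ring)
  have d1 : ∀ τ ∈ U, HasDerivAt (fun τ => K / 30 * (g₁ τ * p τ - 1 / 2 * g₁ τ ^ 2 * γ τ))
      (K / 30 * (p τ ^ 2 + γ τ * g₁ τ * p τ - 3 / 2 * γ₁ τ * g₁ τ ^ 2)) τ := fun τ hτ =>
    ((((b1 τ hτ).fun_mul (b2 τ hτ)).fun_sub ((((b1 τ hτ).fun_pow 2).const_mul (1 / 2)).fun_mul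
      (a1 τ hτ))).const_mul (K / 30)).congr_deriv (by rw [eq]; ring)
  have d2 : ∀ τ ∈ U, HasDerivAt
      (fun τ => K / 30 * (p τ ^ 2 + γ τ * g₁ τ * p τ - 3 / 2 * γ₁ τ * g₁ τ ^ 2))
      (K / 30 * (2 * p τ * q τ + γ τ * (p τ ^ 2 + g₁ τ * q τ) - 2 * γ₁ τ * g₁ τ * p τ -
            3 / 2 * γ₂ τ * g₁ τ ^ 2)) τ := fun τ hτ =>
    (((((b2 τ hτ).fun_pow 2).fun_add (((a1 τ hτ).fun_mul (b1 τ hτ)).fun_mul (b2 τ hτ))).fun_sub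
      (((a2 τ hτ).const_mul (3 / 2)).fun_mul ((b1 τ hτ).fun_pow 2))).const_mul
        (K / 30)).congr_deriv (by ring)
  have d3 : ∀ τ ∈ U, HasDerivAt
      (fun τ => K / 30 * (2 * p τ * q τ + γ τ * (p τ ^ 2 + g₁ τ * q τ) - 2 * γ₁ τ * g₁ τ * p τ -
            3 / 2 * γ₂ τ * g₁ τ ^ 2))
      (K / 30 * (2 * q τ ^ 2 + 2 * p τ * r τ + γ τ * (3 * p τ * q τ + g₁ τ * r τ) -
            γ₁ τ * (p τ ^ 2 + g₁ τ * q τ) - 5 * γ₂ τ * g₁ τ * p τ -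
            3 / 2 * γ₃ τ * g₁ τ ^ 2)) τ := fun τ hτ =>
    ((((((b2 τ hτ).const_mul 2).fun_mul (b3 τ hτ)).fun_add ((a1 τ hτ).fun_mul
      (((b2 τ hτ).fun_pow 2).fun_add ((b1 τ hτ).fun_mul (b3 τ hτ))))).fun_sub
      ((((a2 τ hτ).const_mul 2).fun_mul (b1 τ hτ)).fun_mul (b2 τ hτ))).fun_sub
      (((a3 τ hτ).const_mul (3 / 2)).fun_mul ((b1 τ hτ).fun_pow 2))).const_mul
        (K / 30) |>.congr_deriv (by ring)
  rw [← hp]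
  exact ⟨_, _, _, _, _, _, iteratedDeriv_eq_of_hasDerivAt hU a1 a2 a3 hτ,
    iteratedDeriv_eq_of_hasDerivAt hU b1 b2 b3 hτ, iteratedDeriv_eq_of_hasDerivAt hU c1 c2 c3 hτ,
    iteratedDeriv_eq_of_hasDerivAt hU d1 d2 d3 hτ, rfl, congrFun e1 τ, congrFun eq τ,
    congrFun e2 τ, congrFun e3 τ, congrFun er τ⟩

theorem CaseIII.wdvv (hU : IsOpen U) {K : ℂ} {γ g₁ : ℂ → ℂ} (hγ : DifferentiableOn ℂ γ U)
    (hg : DifferentiableOn ℂ g₁ U) (h : CaseIII U K γ g₁) {t : Fin 4 → ℂ} (ht : t ∈ domain U) :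
    WDVV (prepotentialThird γ g₁ (fun τ => K * g₁ τ ^ 3)
      fun τ => K / 30 * (g₁ τ * deriv g₁ τ - 1 / 2 * g₁ τ ^ 2 * γ τ)) t := by
  rw [wdvv_prepotentialThird_iff hU hγ hg ((hg.fun_pow 3).const_mul K)
    (((hg.fun_mul (hg.deriv hU)).fun_sub (((hg.fun_pow 2).const_mul (1 / 2)).fun_mul hγ)).const_mul
      (K / 30)) ht]
  obtain ⟨γ', γ'', γ''', g', g'', g''', ⟨h1, h2, h3⟩, ⟨k1, k2, k3⟩, ⟨l1, l2, l3⟩, ⟨m1, m2, m3⟩,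
    r0, r1, r2, r3, r4, r5⟩ := h.jets hU hγ hg ht
  constructor <;>
    simp only [jetThird_values, iteratedDeriv_zero, h1, h2, h3, k1, k2, k3, l1, l2, l3, m1, m2,
      m3] <;>
    simp only [r5, r4, r3, r2, r1, r0] <;> ring

theorem CaseIII.det_gram (hU : IsOpen U) {K : ℂ} {γ g₁ : ℂ → ℂ} (hγ : DifferentiableOn ℂ γ U)
    (hg : DifferentiableOn ℂ g₁ U) (h : CaseIII U K γ g₁) {τ : ℂ} (hτ : τ ∈ U) :
    (gram (prepotentialThird γ g₁ (fun τ => K * g₁ τ ^ 3)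
      fun τ => K / 30 * (g₁ τ * deriv g₁ τ - 1 / 2 * g₁ τ ^ 2 * γ τ)) ![0, 1, 0, τ]).det =
        11943936 * K ^ 2 * g₁ τ ^ 8 *
          ((deriv g₁ τ - 1 / 2 * γ τ * g₁ τ) ^ 2 - 36 * K * g₁ τ ^ 6) := by
  have ht : ![0, 1, 0, τ] ∈ domain U := hτ
  rw [gram_eq (c_prepotentialThird hU hγ hg ((hg.fun_pow 3).const_mul K)
    (((hg.fun_mul (hg.deriv hU)).fun_sub (((hg.fun_pow 2).const_mul (1 / 2)).fun_mul hγ)).const_mul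
      (K / 30)) ht), det_symm_fin_four]
  obtain ⟨γ', γ'', γ''', g', g'', g''', ⟨h1, h2, h3⟩, ⟨k1, k2, k3⟩, ⟨l1, l2, l3⟩, ⟨m1, m2, m3⟩,
    r0, r1, r2, r3, r4, r5⟩ := h.jets hU hγ hg hτ
  simp only [jetThird_values, iteratedDeriv_zero, h1, h2, h3, k1, k2, k3, l1, l2, l3, m1, m2,
      m3, Matrix.cons_val]
  rw [← r0]
  simp only [r5, r4, r3, r2, r1]
  ring

end Sufficiency

/-! ## The classification for `σ = 1/2` -/

section Half

variable {U : Set ℂ}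

/-- Derivatives of solutions of `f' = c u f`, `u' = ½u²`. -/
theorem iteratedDeriv_of_weight (hU : IsOpen U) {u f : ℂ → ℂ} {k : ℂ}
    (hu : ∀ τ ∈ U, HasDerivAt u (1 / 2 * u τ ^ 2) τ)
    (hf : ∀ τ ∈ U, HasDerivAt f (k * u τ * f τ) τ) {τ : ℂ} (hτ : τ ∈ U) :
    iteratedDeriv 1 f τ = k * u τ * f τ ∧
      iteratedDeriv 2 f τ = k * (k + 1 / 2) * u τ ^ 2 * f τ ∧
      iteratedDeriv 3 f τ = k * (k + 1 / 2) * (k + 1) * u τ ^ 3 * f τ :=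
  iteratedDeriv_eq_of_hasDerivAt hU hf (f₂ := fun τ => k * (k + 1 / 2) * u τ ^ 2 * f τ)
    (f₃ := fun τ => k * (k + 1 / 2) * (k + 1) * u τ ^ 3 * f τ)
    (fun τ hτ => (((hu τ hτ).const_mul k).fun_mul (hf τ hτ)).congr_deriv (by ring))
    (fun τ hτ => ((((hu τ hτ).fun_pow 2).const_mul (k * (k + 1 / 2))).fun_mul
      (hf τ hτ)).congr_deriv (by ring)) hτ

/-- The hypothesis on γ says that γ − u solves f' = uf; the term u makes γ transform like a pivot
coefficient under inversion. -/
theorem iteratedDeriv_of_pivot (hU : IsOpen U) {u γ : ℂ → ℂ}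
    (hu : ∀ τ ∈ U, HasDerivAt u (1 / 2 * u τ ^ 2) τ)
    (hγ : ∀ τ ∈ U, HasDerivAt γ (u τ * γ τ - 1 / 2 * u τ ^ 2) τ) {τ : ℂ} (hτ : τ ∈ U) :
    iteratedDeriv 1 γ τ = u τ * γ τ - 1 / 2 * u τ ^ 2 ∧
      iteratedDeriv 2 γ τ = 3 / 2 * u τ ^ 2 * γ τ - u τ ^ 3 ∧
      iteratedDeriv 3 γ τ = 3 * u τ ^ 3 * γ τ - 9 / 4 * u τ ^ 4 :=
  iteratedDeriv_eq_of_hasDerivAt hU hγ (f₂ := fun τ => 3 / 2 * u τ ^ 2 * γ τ - u τ ^ 3)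
    (f₃ := fun τ => 3 * u τ ^ 3 * γ τ - 9 / 4 * u τ ^ 4)
    (fun τ hτ => (((hu τ hτ).fun_mul (hγ τ hτ)).fun_sub
      (((hu τ hτ).fun_pow 2).const_mul (1 / 2))).congr_deriv (by ring))
    (fun τ hτ => (((((hu τ hτ).fun_pow 2).const_mul (3 / 2)).fun_mul (hγ τ hτ)).fun_sub
      ((hu τ hτ).fun_pow 3)).congr_deriv (by ring)) hτ

variable {γ g₁ g₂ g₃ g₄ : ℂ → ℂ}

/-- For u = 0 all coefficients are constant and ∂₄∘∂₄ = 0. A non-zero u is locally −2/(τ − τ₀),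
which up to translation is the image of that situation under inversion; the witness is the
transported field ∂₄, normalised to have last component 1. -/
theorem nilpotentAt_half_of_weight (hU : IsOpen U) {u : ℂ → ℂ}
    (hu : ∀ τ ∈ U, HasDerivAt u (1 / 2 * u τ ^ 2) τ)
    (hγ : ∀ τ ∈ U, HasDerivAt γ (u τ * γ τ - 1 / 2 * u τ ^ 2) τ)
    (h₁ : ∀ τ ∈ U, HasDerivAt g₁ (1 * u τ * g₁ τ) τ)
    (h₂ : ∀ τ ∈ U, HasDerivAt g₂ (1 * u τ * g₂ τ) τ)
    (h₃ : ∀ τ ∈ U, HasDerivAt g₃ (1 * u τ * g₃ τ) τ)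
    (h₄ : ∀ τ ∈ U, HasDerivAt g₄ (1 * u τ * g₄ τ) τ)
    {t : Fin 4 → ℂ} (ht : t ∈ domain U) : NilpotentAt (prepotentialHalf γ g₁ g₂ g₃ g₄) t := by
  have hd : ∀ {f f' : ℂ → ℂ}, (∀ τ ∈ U, HasDerivAt f (f' τ) τ) → DifferentiableOn ℂ f U :=
    fun h τ hτ => (h τ hτ).differentiableAt.differentiableWithinAt
  obtain ⟨a1, a2, a3⟩ := iteratedDeriv_of_pivot hU hu hγ ht
  obtain ⟨b1, b2, b3⟩ := iteratedDeriv_of_weight hU hu h₁ ht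
  obtain ⟨c1, c2, c3⟩ := iteratedDeriv_of_weight hU hu h₂ ht
  obtain ⟨d1, d2, d3⟩ := iteratedDeriv_of_weight hU hu h₃ ht
  obtain ⟨e1, e2, e3⟩ := iteratedDeriv_of_weight hU hu h₄ ht
  refine ⟨![-1 / 4 * u (t 3) ^ 2 * t 1 * t 2, -1 / 2 * u (t 3) * t 1, -1 / 2 * u (t 3) * t 2, 1],
    fun h => one_ne_zero (congrFun h 3), ?_⟩
  rw [mul_self_eq (c_prepotentialHalf hU (hd hγ) (hd h₁) (hd h₂) (hd h₃) (hd h₄) ht)]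
  funext i
  fin_cases i <;>
    simp only [Fin.zero_eta, Fin.mk_one, Fin.reduceFinMk, Matrix.cons_val, Pi.zero_apply,
      jetHalf_values, iteratedDeriv_zero, a1, a2, a3, b1, b2, b3, c1, c2, c3, d1, d2, d3, e1, e2,
      e3] <;> ring

theorem nilpotentAt_half_of_fst (hU : IsOpen U) (hγ : DifferentiableOn ℂ γ U)
    (h₁ : DifferentiableOn ℂ g₁ U) (h₂ : DifferentiableOn ℂ g₂ U) (h₃ : DifferentiableOn ℂ g₃ U)
    (h₄ : DifferentiableOn ℂ g₄ U) (z₃ : ∀ τ ∈ U, g₃ τ = 0) (z₄ : ∀ τ ∈ U, g₄ τ = 0)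
    (hW : ∀ t ∈ domain U, WDVV (prepotentialHalf γ g₁ g₂ g₃ g₄) t) {t : Fin 4 → ℂ}
    (ht : t ∈ domain U) : NilpotentAt (prepotentialHalf γ g₁ g₂ g₃ g₄) t := by
  have h : ∀ t ∈ domain U, prepotentialHalf γ g₁ g₂ g₃ g₄ t =
      polyPrepotential {(2, 2), (0, 4), (1, 3)} (coeffHalf γ g₁ g₂ g₃ g₄) t := fun t ht => by
    rw [polyPrepotential, Finset.sum_insert (by decide), Finset.sum_insert (by decide),
      Finset.sum_singleton, prepotentialHalf, z₃ _ ht, z₄ _ ht]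
    simp only [coeffHalf]
    ring
  exact (nilpotentAt_of_fst_le_one hU
    (fun p _ => differentiableOn_coeffHalf hγ h₁ h₂ h₃ h₄ p) (by decide) (by decide)
    (fun t ht => (hW t ht).congr hU h ht) ht).congr hU (fun t ht => (h t ht).symm) ht

theorem nilpotentAt_half_of_snd (hU : IsOpen U) (hγ : DifferentiableOn ℂ γ U)
    (h₁ : DifferentiableOn ℂ g₁ U) (h₂ : DifferentiableOn ℂ g₂ U) (h₃ : DifferentiableOn ℂ g₃ U)
    (h₄ : DifferentiableOn ℂ g₄ U) (z₁ : ∀ τ ∈ U, g₁ τ = 0) (z₂ : ∀ τ ∈ U, g₂ τ = 0)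
    (hW : ∀ t ∈ domain U, WDVV (prepotentialHalf γ g₁ g₂ g₃ g₄) t) {t : Fin 4 → ℂ}
    (ht : t ∈ domain U) : NilpotentAt (prepotentialHalf γ g₁ g₂ g₃ g₄) t := by
  have h : ∀ t ∈ domain U, prepotentialHalf γ g₁ g₂ g₃ g₄ t =
      polyPrepotential {(2, 2), (3, 1), (4, 0)} (coeffHalf γ g₁ g₂ g₃ g₄) t := fun t ht => by
    rw [polyPrepotential, Finset.sum_insert (by decide), Finset.sum_insert (by decide),
      Finset.sum_singleton, prepotentialHalf, z₁ _ ht, z₂ _ ht]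
    simp only [coeffHalf]
    ring
  exact (nilpotentAt_of_snd_le_one hU
    (fun p _ => differentiableOn_coeffHalf hγ h₁ h₂ h₃ h₄ p) (by decide) (by decide)
    (fun t ht => (hW t ht).congr hU h ht) ht).congr hU (fun t ht => (h t ht).symm) ht

/-- The differential equations between the coefficients of a solution of the WDVV equations. -/
theorem equations_of_wdvv_half (hU : IsOpen U) (hγ : DifferentiableOn ℂ γ U)
    (h₁ : DifferentiableOn ℂ g₁ U) (h₂ : DifferentiableOn ℂ g₂ U) (h₃ : DifferentiableOn ℂ g₃ U)
    (h₄ : DifferentiableOn ℂ g₄ U)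
    (hW : ∀ t ∈ domain U, WDVV (prepotentialHalf γ g₁ g₂ g₃ g₄) t) :
    (∀ τ ∈ U, HasDerivAt γ (1 / 2 * γ τ ^ 2 - 288 * g₁ τ * g₄ τ) τ) ∧
    (∀ τ ∈ U, HasDerivAt g₂ (γ τ * g₂ τ + 24 * g₁ τ * g₃ τ) τ) ∧
    (∀ τ ∈ U, HasDerivAt g₃ (γ τ * g₃ τ + 24 * g₂ τ * g₄ τ) τ) ∧
    (∀ τ ∈ U, deriv (deriv g₁) τ = 3 * γ τ * deriv g₁ τ - 3 * g₁ τ * deriv γ τ) ∧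
    (∀ τ ∈ U, g₃ τ * deriv g₁ τ = g₁ τ * deriv g₃ τ) ∧
    (∀ τ ∈ U, g₂ τ * deriv g₄ τ = g₄ τ * deriv g₂ τ) ∧
    ∀ τ ∈ U, g₁ τ * deriv g₄ τ - g₄ τ * deriv g₁ τ =
      6 * (g₁ τ * g₃ τ ^ 2 - g₄ τ * g₂ τ ^ 2) := by
  have hA : ∀ τ ∈ U, ∀ x y : ℂ, Associative (jetHalf x y (iteratedDeriv · γ τ)
      (iteratedDeriv · g₁ τ) (iteratedDeriv · g₂ τ) (iteratedDeriv · g₃ τ)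
      (iteratedDeriv · g₄ τ)) := fun τ hτ x y => by
    have ht : ![0, x, y, τ] ∈ domain U := hτ
    exact (wdvv_prepotentialHalf_iff hU hγ h₁ h₂ h₃ h₄ ht).1 (hW _ ht)
  have E1 := fun τ hτ x y => (hA τ hτ x y).e₁
  have E2 := fun τ hτ x y => (hA τ hτ x y).e₂
  have E3 := fun τ hτ x y => (hA τ hτ x y).e₃
  simp only [jetHalf_values, iteratedDeriv_zero, iteratedDeriv_one, iteratedDeriv_two']
    at E1 E2 E3
  have dγ : ∀ τ ∈ U, HasDerivAt γ (1 / 2 * γ τ ^ 2 - 288 * g₁ τ * g₄ τ) τ := fun τ hτ => by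
    have := hasDerivAt_of_mem hU hγ hτ
    -- Evaluation of `e₁`, a quadratic form in (t₂, t₃), at (1,1), (1,0) and (0,1) isolates its
    -- mixed coefficient.
    rwa [show deriv γ τ = 1 / 2 * γ τ ^ 2 - 288 * g₁ τ * g₄ τ by
      linear_combination -1 / 2 * (E1 τ hτ 1 1 - E1 τ hτ 1 0 - E1 τ hτ 0 1)] at this
  have d2 : ∀ τ ∈ U, HasDerivAt g₂ (γ τ * g₂ τ + 24 * g₁ τ * g₃ τ) τ := fun τ hτ => by
    have := hasDerivAt_of_mem hU h₂ hτ
    rwa [show deriv g₂ τ = γ τ * g₂ τ + 24 * g₁ τ * g₃ τ by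
      linear_combination 1 / 6 * E1 τ hτ 0 1] at this
  have d3 : ∀ τ ∈ U, HasDerivAt g₃ (γ τ * g₃ τ + 24 * g₂ τ * g₄ τ) τ := fun τ hτ => by
    have := hasDerivAt_of_mem hU h₃ hτ
    rwa [show deriv g₃ τ = γ τ * g₃ τ + 24 * g₂ τ * g₄ τ by
      linear_combination 1 / 6 * E1 τ hτ 1 0] at this
  have d1 := fun τ hτ => hasDerivAt_of_mem hU h₁ (τ := τ) hτ
  have d4 := fun τ hτ => hasDerivAt_of_mem hU h₄ (τ := τ) hτ
  refine ⟨dγ, d2, d3, fun τ hτ => ?_, fun τ hτ => ?_, fun τ hτ => ?_, fun τ hτ => ?_⟩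
  · linear_combination 1 / 4 * E3 τ hτ 0 1
  -- `e₂` at (0,1) also gives g₂''. Comparison with the derivative of the first-order equation for
  -- g₂ yields the Wronskian relation; the next two relations arise in the same way from g₃'' and
  -- γ''.
  · have := deriv_deriv_of_mem hU d2 hτ (((dγ τ hτ).fun_mul (d2 τ hτ)).fun_add
      (((d1 τ hτ).const_mul 24).fun_mul (d3 τ hτ)))
    have e := E2 τ hτ 0 1
    rw [this, (dγ τ hτ).deriv] at e
    rw [(d3 τ hτ).deriv]
    linear_combination -1 / 48 * e
  · have := deriv_deriv_of_mem hU d3 hτ (((dγ τ hτ).fun_mul (d3 τ hτ)).fun_add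
      (((d2 τ hτ).const_mul 24).fun_mul (d4 τ hτ)))
    have e := E3 τ hτ 1 0
    rw [this, (dγ τ hτ).deriv] at e
    rw [(d2 τ hτ).deriv]
    linear_combination -1 / 48 * e
  · have := deriv_deriv_of_mem hU dγ hτ ((((dγ τ hτ).fun_pow 2).const_mul (1 / 2)).fun_sub
      (((d1 τ hτ).const_mul 288).fun_mul (d4 τ hτ)))
    have e := E2 τ hτ 1 1
    have e' := E2 τ hτ 1 (-1)
    have e'' := E2 τ hτ 1 0
    rw [this, (dγ τ hτ).deriv, (d2 τ hτ).deriv, (d3 τ hτ).deriv] at e e'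
    rw [(dγ τ hτ).deriv] at e''
    linear_combination 1 / 288 * (e + e') - 1 / 144 * e''

end Half

/-! ### Degenerate solutions and the case distinction for σ = 1/2 -/

section Half

variable {U : Set ℂ} {γ g₁ g₂ g₃ g₄ : ℂ → ℂ}

theorem hasDerivAt_congr_of_mem (hU : IsOpen U) {f g : ℂ → ℂ} (h : ∀ τ ∈ U, f τ = g τ)
    {τ a : ℂ} (hτ : τ ∈ U) (hg : HasDerivAt g a τ) : HasDerivAt f a τ :=
  hg.congr_of_eventuallyEq (eventuallyEq_of_mem hU h hτ)

/-- A² − r²B² factors, and on a connected set one factor vanishes identically; so the sign of the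
root is constant. -/
theorem exists_eq_const_mul_of_sq_eq (hU : IsOpen U) (hc : IsPreconnected U) {A B : ℂ → ℂ}
    (hA : DifferentiableOn ℂ A U) (hB : DifferentiableOn ℂ B U) {μ : ℂ}
    (h : ∀ τ ∈ U, A τ ^ 2 = μ * B τ ^ 2) : ∃ r : ℂ, r ^ 2 = μ ∧ ∀ τ ∈ U, A τ = r * B τ := by
  obtain ⟨r, hr⟩ := IsAlgClosed.exists_pow_nat_eq μ two_pos
  by_cases hne : ∃ τ ∈ U, A τ - r * B τ ≠ 0
  · refine ⟨-r, by rw [neg_sq, hr], fun τ hτ => ?_⟩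
    have := eq_zero_of_mul_eq_zero hU hc (hA.fun_sub (hB.const_mul r)) (hA.fun_add (hB.const_mul r))
      (fun τ hτ => by linear_combination h τ hτ - B τ ^ 2 * hr) hne τ hτ
    linear_combination this
  · push Not at hne
    exact ⟨r, hr, fun τ hτ => sub_eq_zero.1 (hne τ hτ)⟩

/-- The hypothesis `h` is the vanishing of the Wronskian of g₂ and g₃, so all of g₁, …, g₄ are
multiples of g₂. With g₂' = ug₂ for u = γ + 24kρ²g₂, the solution belongs to the degenerate family.
-/
theorem nilpotentAt_half_of_proportional (hU : IsOpen U) (hc : IsPreconnected U) {k l : ℂ}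
    (dγ : ∀ τ ∈ U, HasDerivAt γ (1 / 2 * γ τ ^ 2 - 288 * g₁ τ * g₄ τ) τ)
    (d₂ : ∀ τ ∈ U, HasDerivAt g₂ (γ τ * g₂ τ + 24 * g₁ τ * g₃ τ) τ)
    (d₃ : ∀ τ ∈ U, HasDerivAt g₃ (γ τ * g₃ τ + 24 * g₂ τ * g₄ τ) τ)
    (hk : ∀ τ ∈ U, g₁ τ = k * g₃ τ) (hl : ∀ τ ∈ U, g₄ τ = l * g₂ τ)
    (h : ∀ τ ∈ U, k * g₃ τ ^ 3 = l * g₂ τ ^ 3) (hne : ∃ τ ∈ U, g₂ τ ≠ 0)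
    {t : Fin 4 → ℂ} (ht : t ∈ domain U) : NilpotentAt (prepotentialHalf γ g₁ g₂ g₃ g₄) t := by
  obtain ⟨ρ, hρ⟩ := exists_eq_const_mul_of_wronskian hU hc
    (fun τ hτ => (d₂ τ hτ).differentiableAt.differentiableWithinAt)
    (fun τ hτ => (d₃ τ hτ).differentiableAt.differentiableWithinAt)
    (fun τ hτ => by
      rw [(d₂ τ hτ).deriv, (d₃ τ hτ).deriv, hk τ hτ, hl τ hτ]
      linear_combination -24 * h τ hτ) hne
  have hl' : l = k * ρ ^ 3 := by
    obtain ⟨τ, hτ, h0⟩ := hne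
    have := h τ hτ
    rw [hρ τ hτ] at this
    refine mul_right_cancel₀ (pow_ne_zero 3 h0) ?_
    linear_combination -this
  have e₁ : ∀ τ ∈ U, g₁ τ = k * ρ * g₂ τ := fun τ hτ => by rw [hk τ hτ, hρ τ hτ, mul_assoc]
  have e₄ : ∀ τ ∈ U, g₄ τ = k * ρ ^ 3 * g₂ τ := fun τ hτ => by rw [hl τ hτ, hl']
  have D : ∀ τ ∈ U, HasDerivAt g₂ (1 * (γ τ + 24 * k * ρ ^ 2 * g₂ τ) * g₂ τ) τ := fun τ hτ =>
    (d₂ τ hτ).congr_deriv (by rw [e₁ τ hτ, hρ τ hτ]; ring)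
  refine nilpotentAt_half_of_weight hU (u := fun τ => γ τ + 24 * k * ρ ^ 2 * g₂ τ)
    (fun τ hτ => ?_) (fun τ hτ => ?_) (fun τ hτ => ?_) D (fun τ hτ => ?_) (fun τ hτ => ?_) ht
  · exact ((dγ τ hτ).fun_add ((D τ hτ).const_mul (24 * k * ρ ^ 2))).congr_deriv (by
      rw [e₁ τ hτ, e₄ τ hτ]
      ring)
  · exact (dγ τ hτ).congr_deriv (by
      rw [e₁ τ hτ, e₄ τ hτ]
      ring)
  · exact (hasDerivAt_congr_of_mem hU e₁ hτ ((D τ hτ).const_mul (k * ρ))).congr_deriv (by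
      rw [e₁ τ hτ]
      ring)
  · exact (hasDerivAt_congr_of_mem hU hρ hτ ((D τ hτ).const_mul ρ)).congr_deriv (by
      rw [hρ τ hτ]
      ring)
  · exact (hasDerivAt_congr_of_mem hU e₄ hτ ((D τ hτ).const_mul (k * ρ ^ 3))).congr_deriv (by
      rw [e₄ τ hτ]
      ring)

/-- Taking the root gives g₁' − γg₁ = rg₁² with r² = 576μ, that is g₁' = ug₁ for u = γ + rg₁; this u
satisfies u' = ½u². -/
theorem nilpotentAt_half_of_caseI (hU : IsOpen U) (hc : IsPreconnected U) {μ : ℂ}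
    (dγ : ∀ τ ∈ U, HasDerivAt γ (1 / 2 * γ τ ^ 2 - 288 * g₁ τ * g₄ τ) τ)
    (h₁ : DifferentiableOn ℂ g₁ U)
    (z₂ : ∀ τ ∈ U, g₂ τ = 0) (z₃ : ∀ τ ∈ U, g₃ τ = 0) (h₄ : ∀ τ ∈ U, g₄ τ = μ * g₁ τ)
    (h : ∀ τ ∈ U, (deriv g₁ τ - γ τ * g₁ τ) ^ 2 = 576 * μ * g₁ τ ^ 4)
    {t : Fin 4 → ℂ} (ht : t ∈ domain U) : NilpotentAt (prepotentialHalf γ g₁ g₂ g₃ g₄) t := by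
  obtain ⟨r, hr, e⟩ := exists_eq_const_mul_of_sq_eq hU hc
    (A := fun τ => deriv g₁ τ - γ τ * g₁ τ) (B := fun τ => g₁ τ ^ 2) (μ := 576 * μ)
    ((h₁.deriv hU).fun_sub (DifferentiableOn.fun_mul
      (fun τ hτ => (dγ τ hτ).differentiableAt.differentiableWithinAt) h₁)) (h₁.fun_pow 2)
    (fun τ hτ => by
      rw [h τ hτ]
      ring)
  have D : ∀ τ ∈ U, HasDerivAt g₁ (1 * (γ τ + r * g₁ τ) * g₁ τ) τ := fun τ hτ =>
    (hasDerivAt_of_mem hU h₁ hτ).congr_deriv (by linear_combination e τ hτ)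
  have hz : ∀ {f : ℂ → ℂ}, (∀ τ ∈ U, f τ = 0) →
      ∀ τ ∈ U, HasDerivAt f (1 * (γ τ + r * g₁ τ) * f τ) τ := fun hf τ hτ => by
    rw [hf τ hτ, mul_zero]
    exact hasDerivAt_congr_of_mem hU hf hτ (hasDerivAt_const τ 0)
  refine nilpotentAt_half_of_weight hU (u := fun τ => γ τ + r * g₁ τ) (fun τ hτ => ?_)
    (fun τ hτ => ?_) D (hz z₂) (hz z₃) (fun τ hτ => ?_) ht
  · exact ((dγ τ hτ).fun_add ((D τ hτ).const_mul r)).congr_deriv (by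
      rw [h₄ τ hτ]
      linear_combination 1 / 2 * g₁ τ ^ 2 * hr)
  · exact (dγ τ hτ).congr_deriv (by
      rw [h₄ τ hτ]
      linear_combination 1 / 2 * g₁ τ ^ 2 * hr)
  · exact (hasDerivAt_congr_of_mem hU h₄ hτ ((D τ hτ).const_mul μ)).congr_deriv (by
      rw [h₄ τ hτ]
      ring)

/-- The alternative is whether g₂ and g₃ vanish identically. If both are non-zero, the Wronskians
give g₁ = kg₃ and g₄ = lg₂, leading to case II with K = 1/k. If both vanish, g₁ and g₄ are
proportional, which is case I. Mixed cases lose the monomials of one side and are nilpotent. -/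
theorem caseI_or_caseII_of_wdvv (hU : IsOpen U) (hc : IsPreconnected U)
    (hγ : DifferentiableOn ℂ γ U) (h₁ : DifferentiableOn ℂ g₁ U) (h₂ : DifferentiableOn ℂ g₂ U)
    (h₃ : DifferentiableOn ℂ g₃ U) (h₄ : DifferentiableOn ℂ g₄ U)
    (hW : ∀ t ∈ domain U, WDVV (prepotentialHalf γ g₁ g₂ g₃ g₄) t) {t : Fin 4 → ℂ}
    (ht : t ∈ domain U) (hN : ¬ NilpotentAt (prepotentialHalf γ g₁ g₂ g₃ g₄) t) :
    (∃ μ : ℂ, μ ≠ 0 ∧ (∀ τ ∈ U, g₂ τ = 0 ∧ g₃ τ = 0 ∧ g₄ τ = μ * g₁ τ) ∧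
        CaseI U μ γ g₁ ∧ ∃ τ ∈ U, NondegenerateI μ γ g₁ τ) ∨
      (∃ K : ℂ, K ≠ 0 ∧ (∀ τ ∈ U, g₂ τ = 4 / K * g₄ τ ∧ g₃ τ = K * g₁ τ) ∧
        CaseII U (4 / K ^ 2) γ g₁ g₄ ∧ ∃ τ ∈ U, NondegenerateII (4 / K ^ 2) g₁ g₄ τ) := by
  obtain ⟨dγ, d₂, d₃, dd₁, w₁, w₄, W⟩ := equations_of_wdvv_half hU hγ h₁ h₂ h₃ h₄ hW
  have hfst := fun z₃ z₄ => hN (nilpotentAt_half_of_fst hU hγ h₁ h₂ h₃ h₄ z₃ z₄ hW ht)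
  have hsnd := fun z₁ z₂ => hN (nilpotentAt_half_of_snd hU hγ h₁ h₂ h₃ h₄ z₁ z₂ hW ht)
  have hderiv0 : ∀ {f : ℂ → ℂ}, (∀ τ ∈ U, f τ = 0) → ∀ τ ∈ U, deriv f τ = 0 := fun hf τ hτ => by
    rw [deriv_eq_of_mem hU (g := fun _ => 0) hf hτ, deriv_const]
  by_cases n₂ : ∃ τ ∈ U, g₂ τ ≠ 0 <;> by_cases n₃ : ∃ τ ∈ U, g₃ τ ≠ 0
  · right
    obtain ⟨k, hk⟩ := exists_eq_const_mul_of_wronskian hU hc h₃ h₁ w₁ n₃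
    obtain ⟨l, hl⟩ := exists_eq_const_mul_of_wronskian hU hc h₂ h₄ w₄ n₂
    have hne : ¬ ∀ τ ∈ U, k * g₃ τ ^ 3 = l * g₂ τ ^ 3 := fun h =>
      hN (nilpotentAt_half_of_proportional hU hc dγ d₂ d₃ hk hl h n₂ ht)
    have d₁ : ∀ τ ∈ U, HasDerivAt g₁ (k * (γ τ * g₃ τ + 24 * g₂ τ * g₄ τ)) τ := fun τ hτ =>
      hasDerivAt_congr_of_mem hU hk hτ ((d₃ τ hτ).const_mul k)
    have d₄ : ∀ τ ∈ U, HasDerivAt g₄ (l * (γ τ * g₂ τ + 24 * g₁ τ * g₃ τ)) τ := fun τ hτ =>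
      hasDerivAt_congr_of_mem hU hl hτ ((d₂ τ hτ).const_mul l)
    -- The relation between g₁ and g₄ becomes a constant times a function that does not vanish
    -- identically, so 4kl = 1.
    have key : ∀ τ ∈ U, (4 * k * l - 1) * (k * g₃ τ ^ 3 - l * g₂ τ ^ 3) = 0 := fun τ hτ => by
      have := W τ hτ
      rw [(d₁ τ hτ).deriv, (d₄ τ hτ).deriv, hk τ hτ, hl τ hτ] at this
      linear_combination 1 / 6 * this
    have hkl : 4 * k * l = 1 := by
      push Not at hne
      obtain ⟨τ, hτ, h⟩ := hne
      exact sub_eq_zero.1 ((mul_eq_zero.1 (key τ hτ)).resolve_right (sub_ne_zero.2 h))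
    have hk0 : k ≠ 0 := by
      rintro rfl
      simp at hkl
    have hl' : l = 1 / (4 * k) := by
      field_simp
      linear_combination hkl
    refine ⟨1 / k, one_div_ne_zero hk0, fun τ hτ => ⟨?_, ?_⟩, fun τ hτ => ⟨(dγ τ hτ).deriv, ?_, ?_⟩,
      ?_⟩
    · rw [hl τ hτ, hl']
      field_simp
    · rw [hk τ hτ]
      field_simp
    · rw [(d₁ τ hτ).deriv, hk τ hτ, hl τ hτ, hl']
      field_simp
    · rw [(d₄ τ hτ).deriv, hk τ hτ, hl τ hτ, hl']
      field_simp
    · by_contra hcon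
      push Not at hcon
      refine hne fun τ hτ => ?_
      have := not_not.1 (hcon τ hτ)
      rw [hk τ hτ, hl τ hτ, hl'] at this
      rw [hl']
      field_simp at this ⊢
      linear_combination this
  · push Not at n₃
    -- With g₃ = 0 its equation reads g₂g₄ = 0, so g₄ vanishes too and no non-pivot monomial
    -- contains t₂².
    refine absurd (eq_zero_of_mul_eq_zero hU hc h₂ h₄ (fun τ hτ => ?_) n₂) (hfst n₃)
    have := (d₃ τ hτ).deriv
    rw [hderiv0 n₃ τ hτ, n₃ τ hτ] at this
    linear_combination -1 / 24 * this
  · push Not at n₂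
    refine absurd n₂ (hsnd (eq_zero_of_mul_eq_zero hU hc h₃ h₁ (fun τ hτ => ?_) n₃))
    have := (d₂ τ hτ).deriv
    rw [hderiv0 n₂ τ hτ, n₂ τ hτ] at this
    linear_combination -1 / 24 * this
  · left
    push Not at n₂ n₃
    have n₁ : ∃ τ ∈ U, g₁ τ ≠ 0 := by
      by_contra! h
      exact hsnd h n₂
    obtain ⟨μ, hμ⟩ := exists_eq_const_mul_of_wronskian hU hc h₁ h₄ (fun τ hτ => by
      have := W τ hτ
      rw [n₂ τ hτ, n₃ τ hτ] at this
      linear_combination this) n₁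
    refine ⟨μ, ?_, fun τ hτ => ⟨n₂ τ hτ, n₃ τ hτ, hμ τ hτ⟩, fun τ hτ => ⟨?_, dd₁ τ hτ⟩, ?_⟩
    · rintro rfl
      exact hfst n₃ fun τ hτ => by rw [hμ τ hτ, zero_mul]
    · rw [(dγ τ hτ).deriv, hμ τ hτ]
      ring
    · by_contra hcon
      push Not at hcon
      exact hN (nilpotentAt_half_of_caseI hU hc dγ h₁ n₂ n₃ hμ
        (fun τ hτ => not_not.1 (hcon τ hτ)) ht)

theorem classification_half {F : (Fin 4 → ℂ) → ℂ} (hU : IsOpen U) (hc : IsConnected U) :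
    (IsPolynomialFrobenius (1 / 2) U F ∧ IsSemisimple U F) ↔
      ∃ γ g₁ g₂ g₃ g₄ : ℂ → ℂ, DifferentiableOn ℂ γ U ∧ DifferentiableOn ℂ g₁ U ∧
        DifferentiableOn ℂ g₂ U ∧ DifferentiableOn ℂ g₃ U ∧ DifferentiableOn ℂ g₄ U ∧
        (∀ t ∈ domain U, F t = prepotentialHalf γ g₁ g₂ g₃ g₄ t) ∧
        ((∃ μ : ℂ, μ ≠ 0 ∧ (∀ τ ∈ U, g₂ τ = 0 ∧ g₃ τ = 0 ∧ g₄ τ = μ * g₁ τ) ∧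
            CaseI U μ γ g₁ ∧ ∃ τ ∈ U, NondegenerateI μ γ g₁ τ) ∨
          (∃ K : ℂ, K ≠ 0 ∧ (∀ τ ∈ U, g₂ τ = 4 / K * g₄ τ ∧ g₃ τ = K * g₁ τ) ∧
            CaseII U (4 / K ^ 2) γ g₁ g₄ ∧ ∃ τ ∈ U, NondegenerateII (4 / K ^ 2) g₁ g₄ τ)) := by
  constructor
  · rintro ⟨hF, hS⟩
    obtain ⟨γ, g₁, g₂, g₃, g₄, hγ, h₁, h₂, h₃, h₄, h⟩ := hF.exists_prepotentialHalf hU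
    obtain ⟨t, ht, hs⟩ := (hS.congr hU h).exists_semisimpleAt hc.nonempty
    exact ⟨γ, g₁, g₂, g₃, g₄, hγ, h₁, h₂, h₃, h₄, h,
      caseI_or_caseII_of_wdvv hU hc.isPreconnected hγ h₁ h₂ h₃ h₄
        (fun t ht => (hF.wdvv t ht).congr hU h ht) ht fun hN => hN.not_semisimpleAt hs⟩
  · rintro ⟨γ, g₁, g₂, g₃, g₄, hγ, h₁, h₂, h₃, h₄, h,
      ⟨μ, hμ, hg, hI, hne⟩ | ⟨K, hK, hg, hII, hne⟩⟩
    · have h' : ∀ t ∈ domain U, F t =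
          prepotentialHalf γ g₁ (fun _ => 0) (fun _ => 0) (fun τ => μ * g₁ τ) t := fun t ht => by
        obtain ⟨e₂, e₃, e₄⟩ := hg _ ht
        rw [h t ht, prepotentialHalf, prepotentialHalf, e₂, e₃, e₄]
      have hW := fun t (ht : t ∈ domain U) => hI.wdvv hU hγ h₁ ht
      refine ⟨isPolynomialFrobenius_half hU hγ h₁ (differentiableOn_const 0)
        (differentiableOn_const 0) (h₁.const_mul μ) h' hW,
        IsSemisimple.congr hU (fun t ht => (h' t ht).symm) ?_⟩
      -- The determinant contains a power of g₁, so a point is needed where g₁ and the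
      -- non-degeneracy quantity are both non-zero.
      have n₁ : ∃ τ ∈ U, g₁ τ ≠ 0 := by
        by_contra! hz
        obtain ⟨τ, hτ, hn⟩ := hne
        refine hn ?_
        rw [deriv_eq_of_mem hU (g := fun _ => 0) hz hτ, hz τ hτ, deriv_const]
        ring
      obtain ⟨τ, hτ, h0, h1⟩ := exists_mul_ne_zero hU hc.isPreconnected h₁
        (g := fun τ => (deriv g₁ τ - γ τ * g₁ τ) ^ 2 - 576 * μ * g₁ τ ^ 4)
        ((((h₁.deriv hU).fun_sub (hγ.fun_mul h₁)).fun_pow 2).fun_sub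
          ((h₁.fun_pow 4).const_mul _)) n₁ (hne.imp fun τ hτ => ⟨hτ.1, sub_ne_zero.2 hτ.2⟩)
      have hD := hI.det_gram hU hγ h₁ hτ
      rw [prepotentialHalf_eq] at hD hW ⊢
      refine isSemisimple_of_det_gram_ne_zero hU hc.isPreconnected
        (fun p _ => differentiableOn_coeffHalf hγ h₁ (differentiableOn_const 0)
          (differentiableOn_const 0) (h₁.const_mul μ) p) hW (a := 0) (b := 0) (d := 1) hτ ?_
      rw [hD]
      exact mul_ne_zero (mul_ne_zero (mul_ne_zero (by norm_num) (pow_ne_zero 2 hμ))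
        (pow_ne_zero 4 h0)) h1
    · have h' : ∀ t ∈ domain U, F t =
          prepotentialHalf γ g₁ (fun τ => 4 / K * g₄ τ) (fun τ => K * g₁ τ) g₄ t := fun t ht => by
        obtain ⟨e₂, e₃⟩ := hg _ ht
        rw [h t ht, prepotentialHalf, prepotentialHalf, e₂, e₃]
      have hW := fun t (ht : t ∈ domain U) => hII.wdvv hU hK hγ h₁ h₄ ht
      refine ⟨isPolynomialFrobenius_half hU hγ h₁ (h₄.const_mul _) (h₁.const_mul K) h₄ h' hW,
        IsSemisimple.congr hU (fun t ht => (h' t ht).symm) ?_⟩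
      have n₁ : ∃ τ ∈ U, g₁ τ ≠ 0 := by
        by_contra! hz
        obtain ⟨τ, hτ, hn⟩ := hne
        have h2 := (hII τ hτ).2.1
        rw [deriv_eq_of_mem hU (g := fun _ => 0) hz hτ, hz τ hτ, deriv_const] at h2
        -- If g₁ vanished identically, its own equation would give g₄² = 0, contrary to
        -- non-degeneracy.
        have h3 : g₄ τ = 0 := by
          have : 4 / K ^ 2 * g₄ τ ^ 2 = 0 := by linear_combination -1 / 24 * h2
          exact pow_eq_zero_iff two_ne_zero |>.1
            ((mul_eq_zero.1 this).resolve_left (div_ne_zero (by norm_num) (pow_ne_zero 2 hK)))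
        refine hn ?_
        rw [hz τ hτ, h3]
        ring
      obtain ⟨τ, hτ, h0, h1⟩ := exists_mul_ne_zero hU hc.isPreconnected h₁
        (g := fun τ => (4 / K ^ 2)⁻¹ * g₁ τ ^ 3 - 4 / K ^ 2 * g₄ τ ^ 3)
        (((h₁.fun_pow 3).const_mul _).fun_sub ((h₄.fun_pow 3).const_mul _)) n₁
        (hne.imp fun τ hτ => ⟨hτ.1, sub_ne_zero.2 hτ.2⟩)
      have hD := hII.det_gram hU hK hγ h₁ h₄ hτ
      rw [prepotentialHalf_eq] at hD hW ⊢
      refine isSemisimple_of_det_gram_ne_zero hU hc.isPreconnected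
        (fun p _ => differentiableOn_coeffHalf hγ h₁ (h₄.const_mul _) (h₁.const_mul K) h₄ p) hW
          (a := 0) (b := 0) (d := 1) hτ ?_
      rw [hD]
      exact mul_ne_zero (mul_ne_zero (mul_ne_zero (by norm_num) (pow_ne_zero 2 hK))
        (pow_ne_zero 5 h0)) h1

end Half

/-! ## The classification for `σ = 1/3` -/

section Third

variable {U : Set ℂ} {γ g₁ g₃ g₄ : ℂ → ℂ}

/-- The degenerate family for σ = 1/3. A monomial of degree k + 2 has a coefficient of weight k,
hence the factors k/2 with k = 1, 3, 4; the nilpotent field is the same as for σ = 1/2. -/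
theorem nilpotentAt_third_of_weight (hU : IsOpen U) {u : ℂ → ℂ}
    (hu : ∀ τ ∈ U, HasDerivAt u (1 / 2 * u τ ^ 2) τ)
    (hγ : ∀ τ ∈ U, HasDerivAt γ (u τ * γ τ - 1 / 2 * u τ ^ 2) τ)
    (h₁ : ∀ τ ∈ U, HasDerivAt g₁ (1 / 2 * u τ * g₁ τ) τ)
    (h₃ : ∀ τ ∈ U, HasDerivAt g₃ (3 / 2 * u τ * g₃ τ) τ)
    (h₄ : ∀ τ ∈ U, HasDerivAt g₄ (2 * u τ * g₄ τ) τ)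
    {t : Fin 4 → ℂ} (ht : t ∈ domain U) : NilpotentAt (prepotentialThird γ g₁ g₃ g₄) t := by
  have hd : ∀ {f f' : ℂ → ℂ}, (∀ τ ∈ U, HasDerivAt f (f' τ) τ) → DifferentiableOn ℂ f U :=
    fun h τ hτ => (h τ hτ).differentiableAt.differentiableWithinAt
  obtain ⟨a1, a2, a3⟩ := iteratedDeriv_of_pivot hU hu hγ ht
  obtain ⟨b1, b2, b3⟩ := iteratedDeriv_of_weight hU hu h₁ ht
  obtain ⟨d1, d2, d3⟩ := iteratedDeriv_of_weight hU hu h₃ ht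
  obtain ⟨e1, e2, e3⟩ := iteratedDeriv_of_weight hU hu h₄ ht
  refine ⟨![-1 / 4 * u (t 3) ^ 2 * t 1 * t 2, -1 / 2 * u (t 3) * t 1, -1 / 2 * u (t 3) * t 2, 1],
    fun h => one_ne_zero (congrFun h 3), ?_⟩
  rw [mul_self_eq (c_prepotentialThird hU (hd hγ) (hd h₁) (hd h₃) (hd h₄) ht)]
  funext i
  fin_cases i <;>
    simp only [Fin.zero_eta, Fin.mk_one, Fin.reduceFinMk, Matrix.cons_val, Pi.zero_apply,
      jetThird_values, iteratedDeriv_zero, a1, a2, a3, b1, b2, b3, d1, d2, d3, e1, e2,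
      e3] <;> ring

theorem nilpotentAt_third_of_fst (hU : IsOpen U) (hγ : DifferentiableOn ℂ γ U)
    (h₁ : DifferentiableOn ℂ g₁ U) (h₃ : DifferentiableOn ℂ g₃ U) (h₄ : DifferentiableOn ℂ g₄ U)
    (z₁ : ∀ τ ∈ U, g₁ τ = 0) (hW : ∀ t ∈ domain U, WDVV (prepotentialThird γ g₁ g₃ g₄) t)
    {t : Fin 4 → ℂ} (ht : t ∈ domain U) : NilpotentAt (prepotentialThird γ g₁ g₃ g₄) t := by
  have h : ∀ t ∈ domain U, prepotentialThird γ g₁ g₃ g₄ t =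
      polyPrepotential {(2, 2), (0, 6), (1, 4)} (coeffThird γ g₁ g₃ g₄) t := fun t ht => by
    rw [polyPrepotential, Finset.sum_insert (by decide), Finset.sum_insert (by decide),
      Finset.sum_singleton, prepotentialThird, z₁ _ ht]
    simp only [coeffThird]
    ring
  exact (nilpotentAt_of_fst_le_one hU
    (fun p _ => differentiableOn_coeffThird hγ h₁ h₃ h₄ p) (by decide) (by decide)
    (fun t ht => (hW t ht).congr hU h ht) ht).congr hU (fun t ht => (h t ht).symm) ht

theorem nilpotentAt_third_of_snd (hU : IsOpen U) (hγ : DifferentiableOn ℂ γ U)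
    (h₁ : DifferentiableOn ℂ g₁ U) (h₃ : DifferentiableOn ℂ g₃ U) (h₄ : DifferentiableOn ℂ g₄ U)
    (z₃ : ∀ τ ∈ U, g₃ τ = 0) (z₄ : ∀ τ ∈ U, g₄ τ = 0)
    (hW : ∀ t ∈ domain U, WDVV (prepotentialThird γ g₁ g₃ g₄) t)
    {t : Fin 4 → ℂ} (ht : t ∈ domain U) : NilpotentAt (prepotentialThird γ g₁ g₃ g₄) t := by
  have h : ∀ t ∈ domain U, prepotentialThird γ g₁ g₃ g₄ t =
      polyPrepotential {(2, 2), (3, 0)} (coeffThird γ g₁ g₃ g₄) t := fun t ht => by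
    rw [polyPrepotential, Finset.sum_insert (by decide), Finset.sum_singleton, prepotentialThird,
      z₃ _ ht, z₄ _ ht]
    simp only [coeffThird]
    ring
  exact (nilpotentAt_of_snd_le_one hU
    (fun p _ => differentiableOn_coeffThird hγ h₁ h₃ h₄ p) (by decide) (by decide)
    (fun t ht => (hW t ht).congr hU h ht) ht).congr hU (fun t ht => (h t ht).symm) ht

/-- The differential equations between the coefficients of a solution of the WDVV equations. -/
theorem equations_of_wdvv_third (hU : IsOpen U) (hγ : DifferentiableOn ℂ γ U)
    (h₁ : DifferentiableOn ℂ g₁ U) (h₃ : DifferentiableOn ℂ g₃ U) (h₄ : DifferentiableOn ℂ g₄ U)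
    (hW : ∀ t ∈ domain U, WDVV (prepotentialThird γ g₁ g₃ g₄) t) :
    (∀ τ ∈ U, HasDerivAt γ (1 / 2 * γ τ ^ 2 - 72 * g₁ τ * g₃ τ) τ) ∧
    (∀ τ ∈ U, HasDerivAt g₃ (3 / 2 * γ τ * g₃ τ + 90 * g₁ τ * g₄ τ) τ) ∧
    (∀ τ ∈ U, deriv (deriv g₁) τ = 2 * γ τ * deriv g₁ τ - g₁ τ * deriv γ τ) ∧
    ∀ τ ∈ U, 3 * deriv g₁ τ * g₃ τ = g₁ τ * deriv g₃ τ := by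
  have hA : ∀ τ ∈ U, ∀ x y : ℂ, Associative (jetThird x y (iteratedDeriv · γ τ)
      (iteratedDeriv · g₁ τ) (iteratedDeriv · g₃ τ) (iteratedDeriv · g₄ τ)) := fun τ hτ x y => by
    have ht : ![0, x, y, τ] ∈ domain U := hτ
    exact (wdvv_prepotentialThird_iff hU hγ h₁ h₃ h₄ ht).1 (hW _ ht)
  have E1 := fun τ hτ x y => (hA τ hτ x y).e₁
  have E2 := fun τ hτ x y => (hA τ hτ x y).e₂
  simp only [jetThird_values, iteratedDeriv_zero, iteratedDeriv_one, iteratedDeriv_two'] at E1 E2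
  have dγ : ∀ τ ∈ U, HasDerivAt γ (1 / 2 * γ τ ^ 2 - 72 * g₁ τ * g₃ τ) τ := fun τ hτ => by
    have := hasDerivAt_of_mem hU hγ hτ
    rwa [show deriv γ τ = 1 / 2 * γ τ ^ 2 - 72 * g₁ τ * g₃ τ by
      linear_combination -1 / 2 * (E1 τ hτ 1 1 - E1 τ hτ 0 1)] at this
  have d3 : ∀ τ ∈ U, HasDerivAt g₃ (3 / 2 * γ τ * g₃ τ + 90 * g₁ τ * g₄ τ) τ := fun τ hτ => by
    have := hasDerivAt_of_mem hU h₃ hτ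
    rwa [show deriv g₃ τ = 3 / 2 * γ τ * g₃ τ + 90 * g₁ τ * g₄ τ by
      linear_combination 1 / 8 * E1 τ hτ 0 1] at this
  have d1 := fun τ hτ => hasDerivAt_of_mem hU h₁ (τ := τ) hτ
  refine ⟨dγ, d3, fun τ hτ => ?_, fun τ hτ => ?_⟩
  · linear_combination 1 / 3 * E2 τ hτ 1 0
  · have := deriv_deriv_of_mem hU dγ hτ ((((dγ τ hτ).fun_pow 2).const_mul (1 / 2)).fun_sub
      (((d1 τ hτ).const_mul 72).fun_mul (hasDerivAt_of_mem hU h₃ hτ)))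
    have e := E2 τ hτ 1 1
    have e' := E2 τ hτ 1 0
    have e'' := E2 τ hτ 0 1
    rw [this, (dγ τ hτ).deriv] at e
    rw [(dγ τ hτ).deriv] at e' e''
    linear_combination 1 / 36 * (e - e' - e'')

/-- Here g₁' − ½γg₁ = rg₁³ with r² = 36K, so u = γ + 2rg₁² satisfies g₁' = ½ug₁ and u' = ½u². Then
g₃ and g₄ are multiples of g₁³ and g₁⁴ and have the right weights. -/
theorem nilpotentAt_third_of_caseIII (hU : IsOpen U) (hc : IsPreconnected U) {K : ℂ}
    (hγ : DifferentiableOn ℂ γ U) (h₁ : DifferentiableOn ℂ g₁ U) (hI : CaseIII U K γ g₁)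
    (hD : DependentIII U K γ g₁ g₃ g₄)
    (h : ∀ τ ∈ U, (deriv g₁ τ - 1 / 2 * γ τ * g₁ τ) ^ 2 = 36 * K * g₁ τ ^ 6)
    {t : Fin 4 → ℂ} (ht : t ∈ domain U) : NilpotentAt (prepotentialThird γ g₁ g₃ g₄) t := by
  obtain ⟨r, hr, e⟩ := exists_eq_const_mul_of_sq_eq hU hc
    (A := fun τ => deriv g₁ τ - 1 / 2 * γ τ * g₁ τ) (B := fun τ => g₁ τ ^ 3) (μ := 36 * K)
    ((h₁.deriv hU).fun_sub ((hγ.const_mul (1 / 2)).fun_mul h₁)) (h₁.fun_pow 3)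
    (fun τ hτ => by
      rw [h τ hτ]
      ring)
  have dγ : ∀ τ ∈ U, HasDerivAt γ (1 / 2 * γ τ ^ 2 - 72 * K * g₁ τ ^ 4) τ := fun τ hτ =>
    (hI τ hτ).1 ▸ hasDerivAt_of_mem hU hγ hτ
  have D : ∀ τ ∈ U, HasDerivAt g₁ (1 / 2 * (γ τ + 2 * r * g₁ τ ^ 2) * g₁ τ) τ := fun τ hτ =>
    (hasDerivAt_of_mem hU h₁ hτ).congr_deriv (by linear_combination e τ hτ)
  have e₃ : ∀ τ ∈ U, g₃ τ = K * g₁ τ ^ 3 := fun τ hτ => (hD τ hτ).1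
  have e₄ : ∀ τ ∈ U, g₄ τ = K * r / 30 * g₁ τ ^ 4 := fun τ hτ => by
    rw [(hD τ hτ).2]
    linear_combination K * g₁ τ / 30 * e τ hτ
  refine nilpotentAt_third_of_weight hU (u := fun τ => γ τ + 2 * r * g₁ τ ^ 2) (fun τ hτ => ?_)
    (fun τ hτ => ?_) D (fun τ hτ => ?_) (fun τ hτ => ?_) ht
  · exact ((dγ τ hτ).fun_add (((D τ hτ).fun_pow 2).const_mul (2 * r))).congr_deriv (by
      linear_combination 2 * g₁ τ ^ 4 * hr)
  · exact (dγ τ hτ).congr_deriv (by linear_combination 2 * g₁ τ ^ 4 * hr)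
  · exact (hasDerivAt_congr_of_mem hU e₃ hτ (((D τ hτ).fun_pow 3).const_mul K)).congr_deriv (by
      rw [e₃ τ hτ]
      ring)
  · exact (hasDerivAt_congr_of_mem hU e₄ hτ
      (((D τ hτ).fun_pow 4).const_mul (K * r / 30))).congr_deriv (by
        rw [e₄ τ hτ]
        ring)

/-- The relation 3g₁'g₃ = g₁g₃' makes the Wronskian of g₁³ and g₃ vanish, whence g₃ = Kg₁³. For K =
0 both g₃ and g₄ vanish and no non-pivot monomial contains t₃. -/
theorem caseIII_of_wdvv (hU : IsOpen U) (hc : IsPreconnected U)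
    (hγ : DifferentiableOn ℂ γ U) (h₁ : DifferentiableOn ℂ g₁ U)
    (h₃ : DifferentiableOn ℂ g₃ U) (h₄ : DifferentiableOn ℂ g₄ U)
    (hW : ∀ t ∈ domain U, WDVV (prepotentialThird γ g₁ g₃ g₄) t) {t : Fin 4 → ℂ}
    (ht : t ∈ domain U) (hN : ¬ NilpotentAt (prepotentialThird γ g₁ g₃ g₄) t) :
    ∃ K : ℂ, K ≠ 0 ∧ DependentIII U K γ g₁ g₃ g₄ ∧ CaseIII U K γ g₁ ∧
      ∃ τ ∈ U, NondegenerateIII K γ g₁ τ := by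
  obtain ⟨dγ, d₃, dd₁, w⟩ := equations_of_wdvv_third hU hγ h₁ h₃ h₄ hW
  have n₁ : ∃ τ ∈ U, g₁ τ ≠ 0 := by
    by_contra! h
    exact hN (nilpotentAt_third_of_fst hU hγ h₁ h₃ h₄ h hW ht)
  have d₁ := fun τ hτ => hasDerivAt_of_mem hU h₁ (τ := τ) hτ
  obtain ⟨K, hK⟩ := exists_eq_const_mul_of_wronskian hU hc (h₁.fun_pow 3) h₃ (fun τ hτ => by
    rw [((d₁ τ hτ).fun_pow 3).deriv]
    linear_combination -g₁ τ ^ 2 * w τ hτ) (n₁.imp fun τ hτ => ⟨hτ.1, pow_ne_zero 3 hτ.2⟩)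
  -- Inserting g₃ = Kg₁³ into the equation for g₃' gives the formula for g₄ multiplied by g₁, which
  -- may be cancelled.
  have key : ∀ τ ∈ U, g₄ τ = K * g₁ τ / 30 * (deriv g₁ τ - 1 / 2 * g₁ τ * γ τ) := fun τ hτ => by
    have := eq_zero_of_mul_eq_zero hU hc h₁
      (g := fun τ => g₄ τ - K / 30 * g₁ τ * (deriv g₁ τ - 1 / 2 * g₁ τ * γ τ))
      (h₄.fun_sub ((h₁.const_mul (K / 30)).fun_mul ((h₁.deriv hU).fun_sub
        ((h₁.const_mul (1 / 2)).fun_mul hγ)))) (fun τ hτ => by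
          have := hasDerivAt_unique_of_mem hU hK hτ (d₃ τ hτ)
            (((d₁ τ hτ).fun_pow 3).const_mul K)
          rw [hK τ hτ] at this
          linear_combination 1 / 90 * this) n₁ τ hτ
    linear_combination this
  have hD : DependentIII U K γ g₁ g₃ g₄ := fun τ hτ => ⟨hK τ hτ, key τ hτ⟩
  have hI : CaseIII U K γ g₁ := fun τ hτ => ⟨by
    rw [(dγ τ hτ).deriv, hK τ hτ]
    ring, dd₁ τ hτ⟩
  refine ⟨K, ?_, hD, hI, ?_⟩
  · rintro rfl
    exact hN (nilpotentAt_third_of_snd hU hγ h₁ h₃ h₄ (fun τ hτ => by rw [hK τ hτ, zero_mul])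
      (fun τ hτ => by
        rw [key τ hτ]
        ring) hW ht)
  · by_contra hcon
    push Not at hcon
    exact hN (nilpotentAt_third_of_caseIII hU hc hγ h₁ hI hD
      (fun τ hτ => not_not.1 (hcon τ hτ)) ht)

theorem classification_third {F : (Fin 4 → ℂ) → ℂ} (hU : IsOpen U) (hc : IsConnected U) :
    (IsPolynomialFrobenius (1 / 3) U F ∧ IsSemisimple U F) ↔
      ∃ γ g₁ g₃ g₄ : ℂ → ℂ, DifferentiableOn ℂ γ U ∧ DifferentiableOn ℂ g₁ U ∧
        DifferentiableOn ℂ g₃ U ∧ DifferentiableOn ℂ g₄ U ∧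
        (∀ t ∈ domain U, F t = prepotentialThird γ g₁ g₃ g₄ t) ∧
        ∃ K : ℂ, K ≠ 0 ∧ DependentIII U K γ g₁ g₃ g₄ ∧ CaseIII U K γ g₁ ∧
          ∃ τ ∈ U, NondegenerateIII K γ g₁ τ := by
  constructor
  · rintro ⟨hF, hS⟩
    obtain ⟨γ, g₁, g₃, g₄, hγ, h₁, h₃, h₄, h⟩ := hF.exists_prepotentialThird hU
    obtain ⟨t, ht, hs⟩ := (hS.congr hU h).exists_semisimpleAt hc.nonempty
    exact ⟨γ, g₁, g₃, g₄, hγ, h₁, h₃, h₄, h,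
      caseIII_of_wdvv hU hc.isPreconnected hγ h₁ h₃ h₄
        (fun t ht => (hF.wdvv t ht).congr hU h ht) ht fun hN => hN.not_semisimpleAt hs⟩
  · rintro ⟨γ, g₁, g₃, g₄, hγ, h₁, h₃, h₄, h, K, hK, hD, hI, hne⟩
    have h' : ∀ t ∈ domain U, F t = prepotentialThird γ g₁ (fun τ => K * g₁ τ ^ 3)
        (fun τ => K / 30 * (g₁ τ * deriv g₁ τ - 1 / 2 * g₁ τ ^ 2 * γ τ)) t := fun t ht => by
      obtain ⟨e₃, e₄⟩ := hD _ ht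
      rw [h t ht, prepotentialThird, prepotentialThird, e₃, e₄]
      ring
    have d₃ := (h₁.fun_pow 3).const_mul K
    have d₄ := ((h₁.fun_mul (h₁.deriv hU)).fun_sub
      (((h₁.fun_pow 2).const_mul (1 / 2)).fun_mul hγ)).const_mul (K / 30)
    have hW := fun t (ht : t ∈ domain U) => hI.wdvv hU hγ h₁ ht
    refine ⟨isPolynomialFrobenius_third hU hγ h₁ d₃ d₄ h' hW,
      IsSemisimple.congr hU (fun t ht => (h' t ht).symm) ?_⟩
    have n₁ : ∃ τ ∈ U, g₁ τ ≠ 0 := by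
      by_contra! hz
      obtain ⟨τ, hτ, hn⟩ := hne
      refine hn ?_
      rw [deriv_eq_of_mem hU (g := fun _ => 0) hz hτ, hz τ hτ, deriv_const]
      ring
    obtain ⟨τ, hτ, h0, hn⟩ := exists_mul_ne_zero hU hc.isPreconnected h₁
      (g := fun τ => (deriv g₁ τ - 1 / 2 * γ τ * g₁ τ) ^ 2 - 36 * K * g₁ τ ^ 6)
      ((((h₁.deriv hU).fun_sub ((hγ.const_mul (1 / 2)).fun_mul h₁)).fun_pow 2).fun_sub
        ((h₁.fun_pow 6).const_mul _)) n₁ (hne.imp fun τ hτ => ⟨hτ.1, sub_ne_zero.2 hτ.2⟩)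
    have hdet := hI.det_gram hU hγ h₁ hτ
    rw [prepotentialThird_eq] at hdet hW ⊢
    refine isSemisimple_of_det_gram_ne_zero hU hc.isPreconnected
      (fun p _ => differentiableOn_coeffThird hγ h₁ d₃ d₄ p) hW (a := 0) (b := 1) (d := 0) hτ ?_
    rw [hdet]
    exact mul_ne_zero (mul_ne_zero (mul_ne_zero (by norm_num) (pow_ne_zero 2 hK))
      (pow_ne_zero 8 h0)) hn

end Third

end ModularFrobenius

/-! ### The main theorem -/

open ModularFrobenius in
theorem mainTheorem1 :
    -- the monomials allowed by quasi-homogeneity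
    (∀ (σ : ℝ) (U : Set ℂ) (S : Finset (ℕ × ℕ)) (g : ℕ × ℕ → ℂ → ℂ),
      0 < σ → σ ≤ 1 / 2 → IsOpen U → (∀ p ∈ S, DifferentiableOn ℂ (g p) U) →
      ((∀ t ∈ domain U, Quasihomogeneous σ (polyPrepotential S g) t) ↔
        ∀ p ∈ S, (∃ τ ∈ U, g p τ ≠ 0) → p = (2, 2) ∨ p ∈ nonPivotSolutions σ)) ∧
    -- the non-pivot monomials
    (nonPivotSolutions (1 / 2) = {(4, 0), (3, 1), (1, 3), (0, 4)} ∧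
      nonPivotSolutions (1 / 3) = {(3, 0), (1, 4), (0, 6)} ∧
      (∀ n : ℕ, 4 ≤ n → nonPivotSolutions (1 / (n : ℝ)) = {(1, n + 1), (0, 2 * n)}) ∧
      (∀ n : ℕ, 2 ≤ n → nonPivotSolutions (2 / (2 * (n : ℝ) + 1)) = {(0, 2 * n + 1)}) ∧
      (∀ σ : ℝ, 0 < σ → σ ≤ 1 / 2 → (∀ n : ℕ, 2 ≤ n → σ ≠ 1 / (n : ℝ)) →
        (∀ n : ℕ, 2 ≤ n → σ ≠ 2 / (2 * (n : ℝ) + 1)) → nonPivotSolutions σ = ∅)) ∧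
    -- σ ≠ 1/2, 1/3: nilpotent algebras
    (∀ (σ : ℝ) (U : Set ℂ) (F : (Fin 4 → ℂ) → ℂ), 0 < σ → σ ≤ 1 / 2 → σ ≠ 1 / 2 → σ ≠ 1 / 3 →
      IsOpen U → IsPolynomialFrobenius σ U F →
      ∀ t ∈ domain U, NilpotentAt F t ∧ ¬ SemisimpleAt F t) ∧
    -- σ = 1/2: classification
    (∀ (U : Set ℂ) (F : (Fin 4 → ℂ) → ℂ), IsOpen U → IsConnected U →
      ((IsPolynomialFrobenius (1 / 2) U F ∧ IsSemisimple U F) ↔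
        ∃ γ g₁ g₂ g₃ g₄ : ℂ → ℂ, DifferentiableOn ℂ γ U ∧ DifferentiableOn ℂ g₁ U ∧
          DifferentiableOn ℂ g₂ U ∧ DifferentiableOn ℂ g₃ U ∧ DifferentiableOn ℂ g₄ U ∧
          (∀ t ∈ domain U, F t = prepotentialHalf γ g₁ g₂ g₃ g₄ t) ∧
          ((∃ μ : ℂ, μ ≠ 0 ∧ (∀ τ ∈ U, g₂ τ = 0 ∧ g₃ τ = 0 ∧ g₄ τ = μ * g₁ τ) ∧
              CaseI U μ γ g₁ ∧ ∃ τ ∈ U, NondegenerateI μ γ g₁ τ) ∨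
            (∃ K : ℂ, K ≠ 0 ∧ (∀ τ ∈ U, g₂ τ = 4 / K * g₄ τ ∧ g₃ τ = K * g₁ τ) ∧
              CaseII U (4 / K ^ 2) γ g₁ g₄ ∧ ∃ τ ∈ U, NondegenerateII (4 / K ^ 2) g₁ g₄ τ)))) ∧
    -- Case I: elimination of g₁
    (∀ (U : Set ℂ) (μ : ℂ) (γ g₁ : ℂ → ℂ), IsOpen U → μ ≠ 0 →
      DifferentiableOn ℂ γ U → DifferentiableOn ℂ g₁ U → (∀ τ ∈ U, g₁ τ ≠ 0) →
      (CaseI U μ γ g₁ ↔ SolvesBureau (1 / 2) 8 (-10) 0 (halfDomain U) (rescale γ) ∧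
        ∀ t ∈ halfDomain U,
          deriv (rescale γ) t - rescale γ t ^ 2 = -576 * μ * rescale g₁ t ^ 2)) ∧
    -- Case I: solution by S[1/2, 1/4, 0, t]
    (∀ (U : Set ℂ) (μ : ℂ) (γ g₁ : ℂ → ℂ), IsOpen U → IsConnected U → μ ≠ 0 →
      DifferentiableOn ℂ γ U → DifferentiableOn ℂ g₁ U →
      ((CaseI U μ γ g₁ ∧ ∃ τ ∈ U, NondegenerateI μ γ g₁ τ) →
        ∃ y : ℂ → ℂ, DifferentiableOn ℂ y (halfDomain U) ∧
          halfDomain U ⊆ closure {t | t ∈ halfDomain U ∧ y t ≠ 0 ∧ y t ≠ 1} ∧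
          TriangleSolutionI μ {t | t ∈ halfDomain U ∧ y t ≠ 0 ∧ y t ≠ 1}
            (rescale γ) (rescale g₁) y) ∧
      ((∃ y : ℂ → ℂ, TriangleSolutionI μ (halfDomain U) (rescale γ) (rescale g₁) y) →
        CaseI U μ γ g₁ ∧ ∃ τ ∈ U, NondegenerateI μ γ g₁ τ)) ∧
    -- Case I: solution by the Halphen system
    (∀ (U : Set ℂ) (μ r : ℂ) (γ g₁ : ℂ → ℂ), IsOpen U → μ ≠ 0 → r ^ 2 = μ →
      DifferentiableOn ℂ γ U → DifferentiableOn ℂ g₁ U →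
      (CaseI U μ γ g₁ ↔ ∀ t₀ ∈ halfDomain U, ∃ T : Set ℂ, IsOpen T ∧ t₀ ∈ T ∧ T ⊆ halfDomain U ∧
        ∃ ω₁ ω₂ ω₃ : ℂ → ℂ, SolvesHalphen T ω₁ ω₂ ω₃ ∧ ∀ t ∈ T,
          rescale γ t = 1 / 4 * (ω₁ t + 2 * ω₂ t + ω₃ t) ∧
          rescale g₁ t = 1 / (96 * r) * (ω₁ t - 2 * ω₂ t + ω₃ t) ∧
          (NondegenerateI μ γ g₁ (2 * t) ↔ ω₁ t ≠ ω₂ t ∧ ω₂ t ≠ ω₃ t ∧ ω₃ t ≠ ω₁ t))) ∧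
    -- Case II: elimination of g₁ and g₄, and recovery of g₁ and g₄ from γ
    (∀ (U : Set ℂ) (L : ℂ) (γ g₁ g₄ : ℂ → ℂ), IsOpen U → IsConnected U → L ≠ 0 →
      DifferentiableOn ℂ γ U → DifferentiableOn ℂ g₁ U → DifferentiableOn ℂ g₄ U →
      (CaseII U L γ g₁ g₄ → SolvesChazy U γ) ∧
      ((∃ τ ∈ U, NondegenerateII L g₁ g₄ τ) →
        (CaseII U L γ g₁ g₄ ↔ SolvesChazy U γ ∧ ∀ τ ∈ U,
          288 * (g₁ τ * g₄ τ) = -(deriv γ τ - 1 / 2 * γ τ ^ 2) ∧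
          6912 * (L⁻¹ * g₁ τ ^ 3 + L * g₄ τ ^ 3) =
            -(deriv (deriv γ) τ - 3 * γ τ * deriv γ τ + γ τ ^ 3)))) ∧
    (∀ (U : Set ℂ) (L : ℂ) (γ : ℂ → ℂ), IsOpen U → IsConnected U → L ≠ 0 →
      DifferentiableOn ℂ γ U → SolvesChazy U γ →
      (∃ τ ∈ U, (-(deriv (deriv γ) τ - 3 * γ τ * deriv γ τ + γ τ ^ 3) / 6912) ^ 2 ≠
        4 * (-(deriv γ τ - 1 / 2 * γ τ ^ 2) / 288) ^ 3) →
      ∀ τ₀ ∈ U, ∃ V : Set ℂ, IsOpen V ∧ τ₀ ∈ V ∧ V ⊆ U ∧ ∃ g₁ g₄ : ℂ → ℂ,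
        DifferentiableOn ℂ g₁ V ∧ DifferentiableOn ℂ g₄ V ∧ CaseII V L γ g₁ g₄ ∧
        ∀ τ ∈ V, NondegenerateII L g₁ g₄ τ) ∧
    -- σ = 1/3: classification
    (∀ (U : Set ℂ) (F : (Fin 4 → ℂ) → ℂ), IsOpen U → IsConnected U →
      ((IsPolynomialFrobenius (1 / 3) U F ∧ IsSemisimple U F) ↔
        ∃ γ g₁ g₃ g₄ : ℂ → ℂ, DifferentiableOn ℂ γ U ∧ DifferentiableOn ℂ g₁ U ∧
          DifferentiableOn ℂ g₃ U ∧ DifferentiableOn ℂ g₄ U ∧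
          (∀ t ∈ domain U, F t = prepotentialThird γ g₁ g₃ g₄ t) ∧
          ∃ K : ℂ, K ≠ 0 ∧ DependentIII U K γ g₁ g₃ g₄ ∧ CaseIII U K γ g₁ ∧
            ∃ τ ∈ U, NondegenerateIII K γ g₁ τ)) ∧
    -- σ = 1/3: elimination of g₁
    (∀ (U : Set ℂ) (K : ℂ) (γ g₁ : ℂ → ℂ), IsOpen U → K ≠ 0 →
      DifferentiableOn ℂ γ U → DifferentiableOn ℂ g₁ U → (∀ τ ∈ U, g₁ τ ≠ 0) →
      (CaseIII U K γ g₁ ↔ SolvesBureau (3 / 4) 6 (-6) 0 (halfDomain U) (rescale γ) ∧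
        ∀ t ∈ halfDomain U,
          deriv (rescale γ) t - rescale γ t ^ 2 = -144 * K * rescale g₁ t ^ 4)) ∧
    -- σ = 1/3: solution by S[1/2, 1/6, 0, t]
    (∀ (U : Set ℂ) (K : ℂ) (γ g₁ : ℂ → ℂ), IsOpen U → IsConnected U → K ≠ 0 →
      DifferentiableOn ℂ γ U → DifferentiableOn ℂ g₁ U →
      ((CaseIII U K γ g₁ ∧ ∃ τ ∈ U, NondegenerateIII K γ g₁ τ) →
        ∃ y : ℂ → ℂ, DifferentiableOn ℂ y (halfDomain U) ∧
          halfDomain U ⊆ closure {t | t ∈ halfDomain U ∧ y t ≠ 0 ∧ y t ≠ 1} ∧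
          TriangleSolutionIII K {t | t ∈ halfDomain U ∧ y t ≠ 0 ∧ y t ≠ 1}
            (rescale γ) (rescale g₁) y) ∧
      ((∃ y : ℂ → ℂ, TriangleSolutionIII K (halfDomain U) (rescale γ) (rescale g₁) y) →
        CaseIII U K γ g₁ ∧ ∃ τ ∈ U, NondegenerateIII K γ g₁ τ)) ∧
    -- σ = 1/3: the remaining functions g₃ and g₄ in terms of y
    (∀ (U : Set ℂ) (K : ℂ) (γ g₁ g₃ g₄ y : ℂ → ℂ), IsOpen U → K ≠ 0 →
      DifferentiableOn ℂ γ U → DifferentiableOn ℂ g₁ U → DependentIII U K γ g₁ g₃ g₄ →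
      TriangleSolutionIII K (halfDomain U) (rescale γ) (rescale g₁) y →
      ∀ t ∈ halfDomain U,
        rescale g₃ t ^ 4 = K / 5184 ^ 3 * (deriv y t ^ 6 / (y t ^ 3 * (y t - 1) ^ 3)) ∧
        rescale g₄ t ^ 2 = K / 25920 ^ 2 * (deriv y t ^ 4 / (y t * (y t - 1) ^ 3)) ∧
        rescale g₄ t = K / 360 * (rescale g₁ t ^ 2 * deriv y t / (y t - 1))) ∧
    -- the inversion symmetry and modular invariance
    (∀ (γ g₁ g₂ g₃ g₄ : ℂ → ℂ),
      (∀ t : Fin 4 → ℂ, t 3 ≠ 0 → inversion (prepotentialHalf γ g₁ g₂ g₃ g₄) t =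
        prepotentialHalf (hatPivot γ) (hatWeight 2 g₁) (hatWeight 2 g₂) (hatWeight 2 g₃)
          (hatWeight 2 g₄) t) ∧
      (∀ t : Fin 4 → ℂ, t 3 ≠ 0 → inversion (prepotentialThird γ g₁ g₃ g₄) t =
        prepotentialThird (hatPivot γ) (hatWeight 1 g₁) (hatWeight 3 g₃) (hatWeight 4 g₄) t) ∧
      ∀ U : Set ℂ, (∀ τ ∈ U, τ ≠ 0 ∧ -(1 / τ) ∈ U) →
        (IsModular U (prepotentialHalf γ g₁ g₂ g₃ g₄) ↔ ∀ τ ∈ U, hatPivot γ τ = γ τ ∧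
          hatWeight 2 g₁ τ = g₁ τ ∧ hatWeight 2 g₂ τ = g₂ τ ∧ hatWeight 2 g₃ τ = g₃ τ ∧
          hatWeight 2 g₄ τ = g₄ τ) ∧
        (IsModular U (prepotentialThird γ g₁ g₃ g₄) ↔ ∀ τ ∈ U, hatPivot γ τ = γ τ ∧
          hatWeight 1 g₁ τ = g₁ τ ∧ hatWeight 3 g₃ τ = g₃ τ ∧ hatWeight 4 g₄ τ = g₄ τ)) := by
  refine ⟨fun σ U S g _ _ hU hg => quasihomogeneous_polyPrepotential_iff_monomials hU hg σ,
    ⟨nonPivotSolutions_half, nonPivotSolutions_third, fun n hn => nonPivotSolutions_one_div hn,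
      fun n hn => nonPivotSolutions_two_div hn,
      fun σ h0 h1 h2 h3 => nonPivotSolutions_eq_empty h0 h1 h2 h3⟩,
    fun σ U F h0 h1 h2 h3 hU hF t ht => ?_,
    fun U F hU hc => classification_half hU hc,
    fun U μ γ g₁ hU hμ hγ hg h0 => caseI_iff_bureau hU hμ hγ hg h0,
    fun U μ γ g₁ hU hc hμ hγ hg => ⟨?_, ?_⟩,
    fun U μ r γ g₁ hU hμ hr hγ hg => ⟨?_, ?_⟩,
    fun U L γ g₁ g₄ hU hc hL hγ h₁ h₄ => ⟨?_, ?_⟩,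
    fun U L γ hU hc hL hγ hC hne τ₀ hτ₀ =>
      exists_caseII_of_chazy hU hc.isPreconnected hL hγ hC hne hτ₀,
    fun U F hU hc => classification_third hU hc,
    fun U K γ g₁ hU hK hγ hg h0 => caseIII_iff_bureau hU hK hγ hg h0,
    fun U K γ g₁ hU hc hK hγ hg => ⟨?_, ?_⟩,
    fun U K γ g₁ g₃ g₄ y hU hK hγ hg hD h t ht =>
      dependentIII_of_triangleSolutionIII hU hK hγ hg hD h ht,
    fun γ g₁ g₂ g₃ g₄ => ⟨fun t ht => inversion_prepotentialHalf γ g₁ g₂ g₃ g₄ ht,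
      fun t ht => inversion_prepotentialThird γ g₁ g₃ g₄ ht, fun U hU =>
        ⟨isModular_prepotentialHalf γ g₁ g₂ g₃ g₄ hU, isModular_prepotentialThird γ g₁ g₃ g₄ hU⟩⟩⟩
  · have h := nilpotentAt_of_ne_half_of_ne_third h0 h1 h2 h3 hU hF ht
    exact ⟨h, h.not_semisimpleAt⟩
  · exact fun h => exists_triangleSolutionI hU hc.isPreconnected hμ hγ hg h.1 h.2
  · rintro ⟨y, hy⟩
    exact caseI_of_triangleSolutionI hU hc.nonempty hμ hγ hg hy
  · exact fun h t₀ ht₀ => exists_halphen_of_caseI hU hμ hr hγ hg h ht₀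
  · refine fun h => caseI_of_halphen hU hμ hr hγ hg fun t₀ ht₀ => ?_
    obtain ⟨T, hT, h0, hTU, ω₁, ω₂, ω₃, hω, e⟩ := h t₀ ht₀
    exact ⟨T, hT, h0, hTU, ω₁, ω₂, ω₃, hω, fun t ht => ⟨(e t ht).1, (e t ht).2.1⟩⟩
  · exact fun h => h.solvesChazy hU hL hγ h₁ h₄
  · exact fun hne => caseII_iff_chazy hU hc.isPreconnected hL hγ h₁ h₄ hne
  · exact fun h => exists_triangleSolutionIII hU hc.isPreconnected hK hγ hg h.1 h.2
  · rintro ⟨y, hy⟩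
    exact caseIII_of_triangleSolutionIII hU hc.nonempty hK hγ hg hy
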